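/- **Conventions.** All spaces are compactly generated Hausdorff and products carry the compactly generated topology. The product in the symmetric group $S_n$ is $(\sigma\cdot\tau)(i)=\tau(\sigma(i))$. A topological operad is a sequence of spaces $\mathscr C(n)$, $n\ge 0$, with $\mathscr C(0)=*$, a unit $1\in\mathscr C(1)$ and associative unital continuous compositions $\gamma:\mathscr C(k)\times\mathscr C(m_1)\times\cdots\times\mathscr C(m_k)\to\mathscr C(m_1+\cdots+m_k)$. A *group operad* $\mathscr G=\{G_n\}$ is a discrete operad ($G_0$ trivial) whose terms are groups, with the identity of $G_1$ as unit, together with homomorphisms $\pi:G_n\to S_n$ that commute with $\gamma$ ($S_n$ with block permutations), such that $\gamma(aa';b_1b_1',\dots,b_kb_k')=\gamma(a;b_1,\dots,b_k)\,\gamma(a';b'_{a^{-1}(1)},\dots,b'_{a^{-1}(k)})$, where $a(i)=(\pi a)(i)$; a sub group operad is non-crossed if $\pi$ is trivial on it. A *$\mathscr G$-operad* is a topological operad with left actions of $G_n$ on $\mathscr C(n)$ such that $\gamma(\sigma a;\tau_1b_1,\dots,\tau_kb_k)=\gamma(\sigma;\tau_1,\dots,\tau_k)\,\gamma(a;b_{\sigma^{-1}(1)},\dots,b_{\sigma^{-1}(k)})$;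 it is *covering* if every point of every $\mathscr C(n)$ has a neighbourhood whose $G_n$-translates are pairwise disjoint. A morphism of $\mathscr G$-operads is an *equivalence* if all its components are $G_n$-equivariant homotopy equivalences, or if they are all homotopy equivalences and source and target are covering $\mathscr G$-operads. We write $\mathscr C\sim\mathscr C'$ if $\mathscr C$ and $\mathscr C'$ are connected by a finite zigzag of equivalences. A *good basepoint* of $\mathscr C$ is the sequence $e_k=\eta(c_k)$, where $\eta:(\mathscr C_1)_0\to\mathscr C$ is a morphism of nonsymmetric topological operads, $c_k=([0,\frac1k],\dots,[\frac{k-1}k,1])$, and $(\mathscr C_1)_0(k)$ is the path component of $c_k$ in the $k$-th space of the little intervals operad. A space is a *$K(\pi,1)$* if it is path-connected, has the homotopy type of a CW complex, and has trivial homotopy groups in all degrees $\ge 2$. **Theorem.** Let $\mathscr G$ be a group operad and let $\mathscr C$ be a covering $\mathscr G$-operad with a good basepoint $\{e_k\}$, such that every $\mathscr C(k)$ is path-connected, locally path-connected, semilocally simply-connected and a $K(\pi,1)$ ($\pi$ may depend on $k$). Identify $\pi_1(\mathscr C(k)/G_k,G_ke_k)$ with the set of homotopy classes, relative to endpoints,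 of paths $f$ in $\mathscr C(k)$ from $e_k$ to a point $ge_k$, $g\in G_k$, with product $[f][f']=[f\cdot gf']$. Then: 1. The groups $\pi_1(\mathscr C(k)/G_k,G_ke_k)$ form a group operad $\pi_1(\mathscr C/\mathscr G)$. The map to $S_k$ is the composite of $[f]\mapsto g$ with $G_k\to S_k$. If $f$ ends at $ge_k$ and $f_i$ ends at $g_ie_{m_i}$, then $\gamma([f];[f_1],\dots,[f_k])$ is the class of the concatenation of the image under $\eta$ of the linear path from $e_m$ to $\gamma(e_k;e_{m_1},\dots,e_{m_k})$, the path $\gamma(f;f_1,\dots,f_k)$, and the $\gamma(g;g_1,\dots,g_k)$-translate of the inverse of the linear path from $e_m$ to $\gamma(e_k;e_{m_{g^{-1}(1)}},\dots,e_{m_{g^{-1}(k)}})$, where $m=m_1+\cdots+m_k$. 2. The subgroups $\pi_1(\mathscr C(k),e_k)$ of classes of loops form a normal non-crossed sub group operad $\pi_1\mathscr C$ of $\pi_1(\mathscr C/\mathscr G)$. 3. For a discrete group $\Pi$ let $|E\Pi|$ be the geometric realization of the simplicial set with $l$-simplices $(a_0,\dots,a_l)\in\Pi^{l+1}$, on which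 $\Pi$ acts by left multiplication. The spaces $|E\pi_1(\mathscr C(k)/G_k)|$ form a topological $\pi_1(\mathscr C/\mathscr G)$-operad $|E\pi_1(\mathscr C/\mathscr G)|$ with $\gamma([c;t];[a_1;t],\dots,[a_k;t])=[\gamma(c;a_1,\dots,a_k);t]$ for $l$-simplices $c,a_i$ and $t\in\Delta^l$, where $\gamma$ is applied vertexwise. 4. The orbit spaces of $|E\pi_1(\mathscr C(k)/G_k)|$ under $\pi_1(\mathscr C(k),e_k)$, with the induced composition and the induced action of $G_k=\pi_1(\mathscr C(k)/G_k)/\pi_1(\mathscr C(k))$, form a topological $\mathscr G$-operad $|E\pi_1(\mathscr C/\mathscr G)|/\pi_1\mathscr C$, and $$\mathscr C\;\sim\;|E\pi_1(\mathscr C/\mathscr G)|/\pi_1\mathscr C .$$ -/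

import Mathlib

open scoped Topology

universe u

/-! ### Block permutations -/

/-- The position, among `n = m₀ + ⋯ + m_{k-1}` letters, of letter `p.2` of block `p.1`. -/
def blockEquiv {k : ℕ} {m : Fin k → ℕ} {n : ℕ} (h : ∑ i, m i = n) :
    ((i : Fin k) × Fin (m i)) ≃ Fin n :=
  finSigmaFinEquiv.trans (finCongr h)

theorem sum_perm {k : ℕ} {m : Fin k → ℕ} {n : ℕ} (h : ∑ i, m i = n) (σ : Equiv.Perm (Fin k)) :
    ∑ i, m (σ.symm i) = n := by
  rw [← h]
  exact Equiv.sum_comp σ.symm m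

theorem sum_blocks {k : ℕ} {m : Fin k → ℕ} {n : ℕ} (h : ∑ i, m i = n) {l : Fin n → ℕ} {N : ℕ}
    (hN : ∑ j, l j = N) : ∑ i, ∑ j : Fin (m i), l (blockEquiv h ⟨i, j⟩) = N := by
  rw [← hN, ← Equiv.sum_comp (blockEquiv h) l, Fintype.sum_sigma]

/-- The composition `γ(σ; τ₀, …, τ_{k-1})` of the symmetric groups operad: letter `p` of block `i`
is sent to letter `τ i p` of block `σ i`, where the blocks of the target have sizes
`m (σ⁻¹ 0), …, m (σ⁻¹ (k-1))`. -/
def blockPerm {k : ℕ} {m : Fin k → ℕ} {n : ℕ} (h : ∑ i, m i = n) (σ : Equiv.Perm (Fin k))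
    (τ : ∀ i, Equiv.Perm (Fin (m i))) : Equiv.Perm (Fin n) :=
  (blockEquiv h).symm.trans
    (((Equiv.sigmaCongrRight τ).trans (Equiv.sigmaCongrLeft' σ)).trans
      (blockEquiv (sum_perm h σ)))

/-! ### Group operads -/

/-- The data of a group operad: groups `G n`, homomorphisms to the symmetric groups and
compositions.  The product of permutations is `(σ · τ)(i) = τ (σ i)`, which is the product of the
opposite of Mathlib's group `Equiv.Perm (Fin n)`.  The compositions
`G k × G (m 0) × ⋯ × G (m (k-1)) → G n` are indexed by proofs of `m 0 + ⋯ + m (k-1) = n`. -/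
structure GroupOperadData where
  G : ℕ → Type u
  [group : ∀ n, Group (G n)]
  π : ∀ n, G n →* (Equiv.Perm (Fin n))ᵐᵒᵖ
  γ : ∀ {k : ℕ} {m : Fin k → ℕ} {n : ℕ}, ∑ i, m i = n → G k → (∀ i, G (m i)) → G n

attribute [instance] GroupOperadData.group

namespace GroupOperadData

/-- The permutation `i ↦ g(i)` of `Fin n` given by an element `g` of `G n`. -/
def perm (𝒢 : GroupOperadData.{u}) {n : ℕ} (g : 𝒢.G n) : Equiv.Perm (Fin n) :=
  (𝒢.π n g).unop

/-- The laws of a group operad. -/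
structure IsGroupOperad (𝒢 : GroupOperadData.{u}) : Prop where
  zero : Subsingleton (𝒢.G 0)
  one_γ : ∀ {n : ℕ} (h : ∑ _ : Fin 1, n = n) (a : 𝒢.G n), 𝒢.γ h (1 : 𝒢.G 1) (fun _ => a) = a
  γ_one : ∀ {n : ℕ} (h : ∑ _ : Fin n, 1 = n) (a : 𝒢.G n), 𝒢.γ h a (fun _ => (1 : 𝒢.G 1)) = a
  assoc : ∀ {k : ℕ} {m : Fin k → ℕ} {n : ℕ} (h : ∑ i, m i = n) {l : Fin n → ℕ} {N : ℕ}
    (hN : ∑ j, l j = N) (a : 𝒢.G k) (b : ∀ i, 𝒢.G (m i)) (c : ∀ j, 𝒢.G (l j)),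
    𝒢.γ hN (𝒢.γ h a b) c =
      𝒢.γ (sum_blocks h hN) a fun i => 𝒢.γ rfl (b i) fun j => c (blockEquiv h ⟨i, j⟩)
  perm_γ : ∀ {k : ℕ} {m : Fin k → ℕ} {n : ℕ} (h : ∑ i, m i = n) (a : 𝒢.G k)
    (b : ∀ i, 𝒢.G (m i)), 𝒢.perm (𝒢.γ h a b) = blockPerm h (𝒢.perm a) fun i => 𝒢.perm (b i)
  crossed : ∀ {k : ℕ} {m : Fin k → ℕ} {n : ℕ} (h : ∑ i, m i = n) (a a' : 𝒢.G k)
    (b b' : ∀ i, 𝒢.G (m i)),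
    𝒢.γ h (a * a') (fun i => b i * b' i) =
      𝒢.γ h a b * 𝒢.γ (sum_perm h (𝒢.perm a)) a' fun i => b' ((𝒢.perm a).symm i)

/-- A sequence of subgroups is a normal non-crossed sub group operad: it is closed under
composition, consists of normal subgroups, and maps trivially to the symmetric groups. -/
structure IsNormalNonCrossed (𝒢 : GroupOperadData.{u}) (H : ∀ n, Subgroup (𝒢.G n)) : Prop where
  normal : ∀ n, (H n).Normal
  π_eq_one : ∀ n, ∀ g ∈ H n, 𝒢.π n g = 1
  γ_mem : ∀ {k : ℕ} {m : Fin k → ℕ} {n : ℕ} (h : ∑ i, m i = n) (a : 𝒢.G k) (b : ∀ i, 𝒢.G (m i)),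
    a ∈ H k → (∀ i, b i ∈ H (m i)) → 𝒢.γ h a b ∈ H n

end GroupOperadData

/-- Group operads. -/
structure GroupOperad extends GroupOperadData.{u} where
  isGroupOperad : toGroupOperadData.IsGroupOperad

/-! ### Topological operads with an action of a group operad -/

/-- The data of a topological `𝒢`-operad: a sequence of spaces with actions of the groups of `𝒢`,
a unit and compositions. -/
structure OperadData (𝒢 : GroupOperadData.{u}) where
  X : ℕ → Type u
  [top : ∀ n, TopologicalSpace (X n)]
  [action : ∀ n, MulAction (𝒢.G n) (X n)]
  [continuous_smul : ∀ n, ContinuousConstSMul (𝒢.G n) (X n)]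
  unit : X 1
  γ : ∀ {k : ℕ} {m : Fin k → ℕ} {n : ℕ}, ∑ i, m i = n → X k → (∀ i, X (m i)) → X n

attribute [instance] OperadData.top OperadData.action OperadData.continuous_smul

/-- The laws of a topological `𝒢`-operad, in the category of compactly generated Hausdorff spaces.
Products of such spaces carry the compactly generated topology, and a map is continuous for
that topology exactly when its restrictions to the compact subsets of the ordinary product are. -/
structure OperadData.IsOperad {𝒢 : GroupOperadData.{u}} (C : OperadData 𝒢) : Prop where
  t2 : ∀ n, T2Space (C.X n)
  compactlyGenerated : ∀ n, CompactlyCoherentSpace (C.X n)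
  zero : Nonempty (Unique (C.X 0))
  continuousOn_γ : ∀ {k : ℕ} {m : Fin k → ℕ} {n : ℕ} (h : ∑ i, m i = n)
    (K : Set (C.X k × ∀ i, C.X (m i))), IsCompact K → ContinuousOn (fun p => C.γ h p.1 p.2) K
  unit_γ : ∀ {n : ℕ} (h : ∑ _ : Fin 1, n = n) (a : C.X n), C.γ h C.unit (fun _ => a) = a
  γ_unit : ∀ {n : ℕ} (h : ∑ _ : Fin n, 1 = n) (a : C.X n), C.γ h a (fun _ => C.unit) = a
  assoc : ∀ {k : ℕ} {m : Fin k → ℕ} {n : ℕ} (h : ∑ i, m i = n) {l : Fin n → ℕ} {N : ℕ}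
    (hN : ∑ j, l j = N) (a : C.X k) (b : ∀ i, C.X (m i)) (c : ∀ j, C.X (l j)),
    C.γ hN (C.γ h a b) c =
      C.γ (sum_blocks h hN) a fun i => C.γ rfl (b i) fun j => c (blockEquiv h ⟨i, j⟩)
  equivariant : ∀ {k : ℕ} {m : Fin k → ℕ} {n : ℕ} (h : ∑ i, m i = n) (σ : 𝒢.G k)
    (τ : ∀ i, 𝒢.G (m i)) (a : C.X k) (b : ∀ i, C.X (m i)),
    C.γ h (σ • a) (fun i => τ i • b i) =
      𝒢.γ h σ τ • C.γ (sum_perm h (𝒢.perm σ)) a fun i => b ((𝒢.perm σ).symm i)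

/-- Topological `𝒢`-operads. -/
structure TopOperad (𝒢 : GroupOperadData.{u}) extends OperadData 𝒢 where
  isOperad : toOperadData.IsOperad

/-- Morphisms of topological `𝒢`-operads. -/
structure OperadHom {𝒢 : GroupOperadData.{u}} (C D : TopOperad 𝒢) where
  map : ∀ n, C.X n → D.X n
  continuous_map : ∀ n, Continuous (map n)
  map_smul : ∀ n (g : 𝒢.G n) (x : C.X n), map n (g • x) = g • map n x
  map_unit : map 1 C.unit = D.unit
  map_γ : ∀ {k : ℕ} {m : Fin k → ℕ} {n : ℕ} (h : ∑ i, m i = n) (a : C.X k)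
    (b : ∀ i, C.X (m i)), map n (C.γ h a b) = D.γ h (map k a) fun i => map (m i) (b i)

/-- A covering action of a discrete group: every point has a neighbourhood whose translates are
pairwise disjoint. -/
def IsCoveringAction (G X : Type*) [Group G] [TopologicalSpace X] [MulAction G X] : Prop :=
  ∀ x : X, ∃ U ∈ 𝓝 x, ∀ g h : G, g ≠ h → Disjoint ((g • ·) '' U) ((h • ·) '' U)

/-- Covering `𝒢`-operads. -/
def TopOperad.IsCovering {𝒢 : GroupOperadData.{u}} (C : TopOperad 𝒢) : Prop :=
  ∀ n, IsCoveringAction (𝒢.G n) (C.X n)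

/-- A continuous map is a homotopy equivalence. -/
def IsHomotopyEquivalence {X Y : Type*} [TopologicalSpace X] [TopologicalSpace Y] (f : C(X, Y)) :
    Prop :=
  ∃ g : C(Y, X), (g.comp f).Homotopic (.id X) ∧ (f.comp g).Homotopic (.id Y)

/-- A `G`-map is a `G`-equivariant homotopy equivalence: it has an equivariant homotopy inverse,
through homotopies that are equivariant at each time. -/
def IsEquivariantHomotopyEquivalence (G : Type*) {X Y : Type*} [Group G] [TopologicalSpace X]
    [TopologicalSpace Y] [MulAction G X] [MulAction G Y] (f : C(X, Y)) : Prop :=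
  (∀ (a : G) (x : X), f (a • x) = a • f x) ∧
  ∃ g : C(Y, X), (∀ (a : G) (y : Y), g (a • y) = a • g y) ∧
    (∃ H : (g.comp f).Homotopy (.id X), ∀ (a : G) (t : unitInterval) (x : X), H (t, a • x) = a • H (t, x)) ∧
    ∃ H : (f.comp g).Homotopy (.id Y), ∀ (a : G) (t : unitInterval) (y : Y), H (t, a • y) = a • H (t, y)

/-- A morphism is an equivalence if its components are equivariant homotopy equivalences, or if
they are homotopy equivalences and all the actions are covering actions. -/
def OperadHom.IsEquivalence {𝒢 : GroupOperadData.{u}} {C D : TopOperad 𝒢} (ψ : OperadHom C D) :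
    Prop :=
  (∀ n, IsEquivariantHomotopyEquivalence (𝒢.G n) ⟨ψ.map n, ψ.continuous_map n⟩) ∨
  ((∀ n, IsHomotopyEquivalence ⟨ψ.map n, ψ.continuous_map n⟩) ∧ C.IsCovering ∧ D.IsCovering)

/-- Two topological `𝒢`-operads are equivalent if a chain of equivalences connects them. -/
def TopOperad.Equivalent {𝒢 : GroupOperadData.{u}} (C D : TopOperad 𝒢) : Prop :=
  Relation.EqvGen (fun A B : TopOperad 𝒢 => ∃ ψ : OperadHom A B, ψ.IsEquivalence) C D

/-! ### Conditions on spaces -/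

/-- Every point has a neighbourhood all of whose loops at that point are null-homotopic in the
whole space. -/
def SemilocallySimplyConnected (X : Type*) [TopologicalSpace X] : Prop :=
  ∀ x : X, ∃ U ∈ 𝓝 x, ∀ p : Path x x, (∀ t, p t ∈ U) → p.Homotopic (Path.refl x)

/-- `X` is a `K(π,1)`: a path-connected space of the homotopy type of a CW complex whose homotopy
groups in degrees at least two vanish. -/
def IsKPiOne (X : Type u) [TopologicalSpace X] : Prop :=
  PathConnectedSpace X ∧
  (∀ n, 2 ≤ n → ∀ x : X, Subsingleton (HomotopyGroup.Pi n X x)) ∧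
  ∃ (Y : Type u) (_ : TopologicalSpace Y) (_ : T2Space Y),
    Nonempty (Topology.CWComplex (Set.univ : Set Y)) ∧ Nonempty (ContinuousMap.HomotopyEquiv X Y)

/-! ### Little intervals and good basepoints -/

/-- Tuples of little subintervals of `[0,1]` with disjoint interiors, given by
their endpoints `(c i).1 < (c i).2`: the space of arity `k` of the little intervals operad. -/
def LittleIntervals (k : ℕ) : Type :=
  {c : Fin k → ℝ × ℝ // (∀ i, 0 ≤ (c i).1 ∧ (c i).1 < (c i).2 ∧ (c i).2 ≤ 1) ∧
    ∀ i j, i ≠ j → (c i).2 ≤ (c j).1 ∨ (c j).2 ≤ (c i).1}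

instance (k : ℕ) : TopologicalSpace (LittleIntervals k) :=
  instTopologicalSpaceSubtype

/-- Tuples of little intervals in increasing order. This is the path component of
`([0,1/k], …, [(k-1)/k,1])` in `LittleIntervals k`, see
`OrderedIntervals.joined_iff`. -/
def OrderedIntervals (k : ℕ) : Type :=
  {c : Fin k → ℝ × ℝ // (∀ i, 0 ≤ (c i).1 ∧ (c i).1 < (c i).2 ∧ (c i).2 ≤ 1) ∧
    ∀ i j, i < j → (c i).2 ≤ (c j).1}

instance (k : ℕ) : TopologicalSpace (OrderedIntervals k) :=
  instTopologicalSpaceSubtype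

namespace OrderedIntervals

/-- The tuple `c_k = ([0,1/k], [1/k,2/k], …, [(k-1)/k,1])`; for `k = 1` it is the unit `[0,1]` of
the little intervals operad. -/
noncomputable def std (k : ℕ) : OrderedIntervals k :=
  ⟨fun i => ((i : ℝ) / k, ((i : ℝ) + 1) / k), by
    refine ⟨fun i => ?_, fun i j hij => ?_⟩
    · have hk : (0 : ℝ) < k := by exact_mod_cast i.pos
      have hi : (i : ℝ) + 1 ≤ k := by exact_mod_cast i.isLt
      refine ⟨by positivity, ?_, ?_⟩
      · exact div_lt_div_of_pos_right (by linarith) hk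
      · exact (div_le_one hk).2 hi
    · have hij' : (i : ℝ) + 1 ≤ j := by exact_mod_cast hij
      exact div_le_div_of_nonneg_right hij' (by positivity)⟩

theorem blockEquiv_lt_of_fst {k : ℕ} {m : Fin k → ℕ} {n : ℕ} (h : ∑ i, m i = n)
    {p q : (i : Fin k) × Fin (m i)} (hpq : p.1 < q.1) : blockEquiv h p < blockEquiv h q := by
  let f : ℕ → ℕ := fun t => if ht : t < k then m ⟨t, ht⟩ else 0
  have key : ∀ r : (i : Fin k) × Fin (m i),
      ((blockEquiv h r : Fin n) : ℕ) = ∑ t ∈ Finset.range r.1, f t + r.2 := by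
    intro r
    simp only [blockEquiv, Equiv.trans_apply, finCongr_apply, Fin.val_cast, finSigmaFinEquiv_apply]
    rw [← Fin.sum_univ_eq_sum_range]
    congr 1
    refine Finset.sum_congr rfl fun i _ => ?_
    have : (i : ℕ) < k := i.2.trans r.1.2
    simp only [f, this, dif_pos]
    rfl
  rw [Fin.lt_def, key, key]
  have h1 : (p.2 : ℕ) < f p.1 := by simp [f]
  have h2 : ∑ t ∈ Finset.range (p.1 + 1 : ℕ), f t ≤ ∑ t ∈ Finset.range (q.1 : ℕ), f t :=
    Finset.sum_le_sum_of_subset (Finset.range_subset_range.2 hpq)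
  rw [Finset.sum_range_succ] at h2
  omega

theorem blockEquiv_lt_of_snd {k : ℕ} {m : Fin k → ℕ} {n : ℕ} (h : ∑ i, m i = n)
    {i : Fin k} {j j' : Fin (m i)} (hj : j < j') :
    blockEquiv h ⟨i, j⟩ < blockEquiv h ⟨i, j'⟩ := by
  simp only [blockEquiv, Equiv.trans_apply, finCongr_apply, Fin.lt_def, Fin.val_cast,
    finSigmaFinEquiv_apply]
  exact Nat.add_lt_add_left hj _

/-- Composition of little intervals: interval `j` of `d i` is placed inside interval `i` of `c`. -/
noncomputable def comp {k : ℕ} {m : Fin k → ℕ} {n : ℕ} (h : ∑ i, m i = n) (c : OrderedIntervals k)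
    (d : ∀ i, OrderedIntervals (m i)) : OrderedIntervals n :=
  ⟨fun l =>
    let p := (blockEquiv h).symm l
    ((c.1 p.1).1 + ((c.1 p.1).2 - (c.1 p.1).1) * ((d p.1).1 p.2).1,
      (c.1 p.1).1 + ((c.1 p.1).2 - (c.1 p.1).1) * ((d p.1).1 p.2).2), by
    refine ⟨fun l => ?_, fun l l' hl => ?_⟩
    · obtain ⟨c0, c1, c2⟩ := c.2.1 ((blockEquiv h).symm l).1
      obtain ⟨d0, d1, d2⟩ := (d _).2.1 ((blockEquiv h).symm l).2
      refine ⟨?_, ?_, ?_⟩ <;> dsimp only <;> nlinarith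
    · have hl' : blockEquiv h ((blockEquiv h).symm l) < blockEquiv h ((blockEquiv h).symm l') := by
        simpa using hl
      dsimp only
      generalize (blockEquiv h).symm l = p at hl' ⊢
      generalize (blockEquiv h).symm l' = q at hl' ⊢
      obtain ⟨i, j⟩ := p
      obtain ⟨i', j'⟩ := q
      obtain ⟨c0, c1, c2⟩ := c.2.1 i
      obtain ⟨d0, d1, d2⟩ := (d i).2.1 j
      rcases lt_trichotomy i i' with hi | rfl | hi
      · obtain ⟨c0', c1', c2'⟩ := c.2.1 i'
        obtain ⟨d0', d1', d2'⟩ := (d i').2.1 j'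
        have := c.2.2 i i' hi
        dsimp only
        nlinarith
      · rcases lt_or_ge j j' with hj | hj
        · have := (d i).2.2 j j' hj
          dsimp only
          nlinarith
        · rcases hj.eq_or_lt with rfl | hj
          · exact absurd hl' (lt_irrefl _)
          · exact absurd hl' (blockEquiv_lt_of_snd h hj).not_gt
      · exact absurd hl' (blockEquiv_lt_of_fst h (p := ⟨i', j'⟩) (q := ⟨i, j⟩) hi).not_gt⟩

/-- The linear path `t ↦ (1 - t) c + t c'`. -/
noncomputable def linearPath {k : ℕ} (c c' : OrderedIntervals k) : Path c c' where
  toFun t := ⟨fun i => ((1 - (t : ℝ)) * (c.1 i).1 + t * (c'.1 i).1,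
    (1 - (t : ℝ)) * (c.1 i).2 + t * (c'.1 i).2), by
    have t0 := t.2.1
    have t1 := t.2.2
    refine ⟨fun i => ?_, fun i j hij => ?_⟩
    · obtain ⟨c0, c1, c2⟩ := c.2.1 i
      obtain ⟨d0, d1, d2⟩ := c'.2.1 i
      refine ⟨by nlinarith, ?_, by nlinarith⟩
      rcases t0.eq_or_lt with h | h
      · simp only [← h]; linarith
      · nlinarith
    · have h1 := c.2.2 i j hij
      have h2 := c'.2.2 i j hij
      nlinarith⟩
  continuous_toFun := by
    refine Continuous.subtype_mk ?_ _
    fun_prop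
  source' := by
    refine Subtype.ext (funext fun i => Prod.ext ?_ ?_) <;> simp
  target' := by
    refine Subtype.ext (funext fun i => Prod.ext ?_ ?_) <;> simp

/-- Ordered tuples as points of the space of all tuples of little intervals. -/
def toLittle {k : ℕ} (c : OrderedIntervals k) : LittleIntervals k :=
  ⟨c.1, c.2.1, fun i j hij => by
    rcases lt_or_gt_of_ne hij with h | h
    · exact Or.inl (c.2.2 i j h)
    · exact Or.inr (c.2.2 j i h)⟩

/-- The ordered tuples form the path component of `c_k` in the little intervals operad. -/
theorem joined_iff {k : ℕ} (c : LittleIntervals k) :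
    Joined (toLittle (std k)) c ↔ ∃ c' : OrderedIntervals k, toLittle c' = c := by
  constructor
  · rintro ⟨p⟩
    refine ⟨⟨c.1, c.2.1, fun i j hij => ?_⟩, rfl⟩
    have hcont : Continuous fun t => ((p t).1 j).1 - ((p t).1 i).1 := by
      have h1 : Continuous fun t => (p t).1 := continuous_subtype_val.comp p.continuous
      exact (((continuous_apply j).comp h1).fst).sub (((continuous_apply i).comp h1).fst)
    have hne : ∀ t, ((p t).1 j).1 - ((p t).1 i).1 ≠ 0 := by
      intro t ht
      obtain ⟨-, ci, -⟩ := (p t).2.1 i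
      obtain ⟨-, cj, -⟩ := (p t).2.1 j
      rcases (p t).2.2 i j hij.ne with h | h <;> linarith
    have h0 : 0 < ((p 0).1 j).1 - ((p 0).1 i).1 := by
      rw [p.source]
      have h1 := (std k).2.2 i j hij
      have h2 := ((std k).2.1 i).2.1
      change 0 < ((std k).1 j).1 - ((std k).1 i).1
      linarith
    have h1 : 0 < ((p 1).1 j).1 - ((p 1).1 i).1 := by
      by_contra hlt
      obtain ⟨t, ht⟩ := mem_range_of_exists_le_of_exists_ge hcont ⟨1, not_lt.1 hlt⟩ ⟨0, h0.le⟩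
      exact hne t ht
    rw [p.target] at h1
    obtain ⟨-, cj, -⟩ := c.2.1 j
    rcases c.2.2 i j hij.ne with h | h
    · exact h
    · linarith
  · rintro ⟨c', rfl⟩
    exact ⟨(linearPath (std k) c').map (f := toLittle)
      (Continuous.subtype_mk continuous_subtype_val _)⟩

end OrderedIntervals

/-! ### The group `π₁(X/G) = π₁(X; e, Ge)` -/

/-- Homotopy classes, relative to endpoints, of paths in `X` from `e` to a point of the orbit
`G e`. The element `elt` with endpoint `elt • e` is determined by the path if the action is free. -/
structure OrbitPathClass (G : Type u) {X : Type u} [Group G] [TopologicalSpace X] [MulAction G X]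
    (e : X) where
  elt : G
  path : Path.Homotopic.Quotient e (elt • e)

namespace OrbitPathClass

variable {G X : Type u} [Group G] [TopologicalSpace X] [MulAction G X] {e : X}

/-- The class of a path. -/
def ofPath (g : G) (p : Path e (g • e)) : OrbitPathClass G e :=
  ⟨g, Path.Homotopic.Quotient.mk p⟩

theorem exists_ofPath (x : OrbitPathClass G e) : ∃ g p, x = ofPath g p := by
  obtain ⟨g, p⟩ := x
  obtain ⟨p, rfl⟩ := Path.Homotopic.Quotient.mk_surjective p
  exact ⟨g, p, rfl⟩

theorem ofPath_eq {g h : G} {p : Path e (g • e)} {q : Path e (h • e)} (hgh : g = h)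
    (hpq : p.Homotopic (q.cast rfl (by rw [hgh]))) : ofPath g p = ofPath h q := by
  subst hgh
  exact congrArg (OrbitPathClass.mk g) (Path.Homotopic.Quotient.eq.2 hpq)

instance : One (OrbitPathClass G e) where
  one := ⟨1, (Path.Homotopic.Quotient.refl e).cast rfl (one_smul G e)⟩

theorem one_eq : (1 : OrbitPathClass G e) =
    ofPath 1 ((Path.refl e).cast rfl (one_smul G e)) := rfl

variable [ContinuousConstSMul G X]

/-- Translation by `g` as a continuous map. -/
def translate (g : G) : C(X, X) := ⟨(g • ·), continuous_const_smul g⟩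

/-- The product of `f` (ending at `g e`) and `f'` is the class of `f · (g f')`. -/
noncomputable instance : Mul (OrbitPathClass G e) where
  mul x y := ⟨x.elt * y.elt,
    (x.path.trans (y.path.map (translate x.elt))).cast rfl (mul_smul x.elt y.elt e)⟩

instance : Inv (OrbitPathClass G e) where
  inv x := ⟨x.elt⁻¹,
    (x.path.map (translate x.elt⁻¹)).symm.cast (inv_smul_smul x.elt e).symm rfl⟩

theorem ofPath_mul (g h : G) (p : Path e (g • e)) (q : Path e (h • e)) :
    ofPath g p * ofPath h q = ofPath (g * h)
      ((p.trans (q.map (continuous_const_smul g))).cast rfl (mul_smul g h e)) := rfl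

theorem ofPath_inv (g : G) (p : Path e (g • e)) :
    (ofPath g p)⁻¹ = ofPath g⁻¹
      ((p.map (continuous_const_smul g⁻¹)).symm.cast (inv_smul_smul g e).symm rfl) := rfl

noncomputable instance : Group (OrbitPathClass G e) :=
  Group.ofLeftAxioms
    (by
      intro x y z
      obtain ⟨g, p, rfl⟩ := exists_ofPath x
      obtain ⟨h, q, rfl⟩ := exists_ofPath y
      obtain ⟨k, r, rfl⟩ := exists_ofPath z
      simp only [ofPath_mul]
      refine ofPath_eq (mul_assoc g h k) ?_
      have key := Path.Homotopic.trans_assoc p (q.map (continuous_const_smul g))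
        ((r.map (continuous_const_smul h)).map (continuous_const_smul g))
      have key' := key.pathCast (x₂ := e) (x₃ := (g * h * k) • e) rfl
        (by simp only [mul_smul])
      convert key' using 1
      · ext t
        simp [Path.trans_apply, mul_smul]
      · ext t
        simp [Path.trans_apply])
    (by
      intro x
      obtain ⟨g, p, rfl⟩ := exists_ofPath x
      rw [one_eq, ofPath_mul]
      refine ofPath_eq (one_mul g) ?_
      have key := (Path.Homotopic.refl_trans p).pathCast (x₂ := e) (x₃ := (1 * g) • e) rfl
        (by simp)
      convert key using 1
      ext t
      simp [Path.trans_apply])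
    (by
      intro x
      obtain ⟨g, p, rfl⟩ := exists_ofPath x
      rw [one_eq, ofPath_inv, ofPath_mul]
      refine ofPath_eq (inv_mul_cancel g) ?_
      have key := (Path.Homotopic.symm_trans (p.map (continuous_const_smul g⁻¹))).pathCast
        (x₂ := e) (x₃ := (g⁻¹ * g) • e) (by simp) (by simp)
      convert key using 1 <;> ext t <;> simp)

/-- The homomorphism `π₁(X; e, Ge) → G` sending a path from `e` to `g e` to `g`. -/
def eltHom : OrbitPathClass G e →* G where
  toFun := elt
  map_one' := rfl
  map_mul' _ _ := rfl

/-- The comparison `π₁(X; e, Ge) → π₁(X/G, Ge)` sending a path to its image in the orbit space. -/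
def toQuotient (x : OrbitPathClass G e) :
    Path.Homotopic.Quotient (Quotient.mk (MulAction.orbitRel G X) e)
      (Quotient.mk (MulAction.orbitRel G X) e) :=
  (x.path.map ⟨Quotient.mk (MulAction.orbitRel G X), continuous_quotient_mk'⟩).cast rfl
    (Quotient.sound (s := MulAction.orbitRel G X)
      (MulAction.mem_orbit e x.elt)).symm

end OrbitPathClass

/-! ### Good basepoints and the fundamental groups operad -/

/-- A good basepoint of `C`: a morphism of nonsymmetric operads from the ordered little intervals
to `C`. -/
structure GoodBasepoint {𝒢 : GroupOperadData.{u}} (C : TopOperad 𝒢) where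
  η : ∀ k, OrderedIntervals k → C.X k
  continuous_η : ∀ k, Continuous (η k)
  η_unit : η 1 (OrderedIntervals.std 1) = C.unit
  η_comp : ∀ {k : ℕ} {m : Fin k → ℕ} {n : ℕ} (h : ∑ i, m i = n) (c : OrderedIntervals k)
    (d : ∀ i, OrderedIntervals (m i)),
    η n (OrderedIntervals.comp h c d) = C.γ h (η k c) fun i => η (m i) (d i)

/-- The path `t ↦ γ(f t; g₁ t, …, g_k t)`. -/
def TopOperad.γPath {𝒢 : GroupOperadData.{u}} (C : TopOperad 𝒢) {k : ℕ} {m : Fin k → ℕ} {n : ℕ}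
    (h : ∑ i, m i = n) {a a' : C.X k} {b b' : ∀ i, C.X (m i)} (f : Path a a')
    (g : ∀ i, Path (b i) (b' i)) : Path (C.γ h a b) (C.γ h a' b') where
  toFun t := C.γ h (f t) fun i => g i t
  continuous_toFun := by
    have hc : Continuous fun t : unitInterval => ((f t, fun i => g i t) : C.X k × ∀ i, C.X (m i)) :=
      f.continuous.prodMk (continuous_pi fun i => (g i).continuous)
    exact (C.isOperad.continuousOn_γ h _ (isCompact_range hc)).comp_continuous hc
      fun t => Set.mem_range_self t
  source' := by simp
  target' := by simp

theorem TopOperad.γPath_homotopic {𝒢 : GroupOperadData.{u}} (C : TopOperad 𝒢) {k : ℕ}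
    {m : Fin k → ℕ} {n : ℕ} (h : ∑ i, m i = n) {a a' : C.X k} {b b' : ∀ i, C.X (m i)}
    {f f' : Path a a'} {g g' : ∀ i, Path (b i) (b' i)} (hf : f.Homotopic f')
    (hg : ∀ i, (g i).Homotopic (g' i)) : (C.γPath h f g).Homotopic (C.γPath h f' g') := by
  obtain ⟨F⟩ := hf
  let H := fun i => (hg i).some
  have hc : Continuous fun t : unitInterval × unitInterval =>
      ((F t, fun i => H i t) : C.X k × ∀ i, C.X (m i)) :=
    F.continuous.prodMk (continuous_pi fun i => (H i).continuous)
  refine ⟨{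
    toFun := fun t => C.γ h (F t) fun i => H i t
    continuous_toFun := (C.isOperad.continuousOn_γ h _ (isCompact_range hc)).comp_continuous hc
      fun t => Set.mem_range_self t
    map_zero_left := fun t => by simp [TopOperad.γPath]
    map_one_left := fun t => by simp [TopOperad.γPath]
    prop' := ?_ }⟩
  rintro t s (rfl | rfl) <;> simp [TopOperad.γPath]

/-- The composition of `C` on homotopy classes of paths. -/
noncomputable def TopOperad.γClass {𝒢 : GroupOperadData.{u}} (C : TopOperad 𝒢) {k : ℕ}
    {m : Fin k → ℕ} {n : ℕ} (h : ∑ i, m i = n) {a a' : C.X k} {b b' : ∀ i, C.X (m i)}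
    (f : Path.Homotopic.Quotient a a') (g : ∀ i, Path.Homotopic.Quotient (b i) (b' i)) :
    Path.Homotopic.Quotient (C.γ h a b) (C.γ h a' b') :=
  letI (i : Fin k) : Setoid (Path (b i) (b' i)) := Path.Homotopic.setoid (b i) (b' i)
  Quotient.map₂ (fun f g => C.γPath h f g)
    (fun _ _ hf _ _ hg => C.γPath_homotopic h hf hg) f (Quotient.choice g)

namespace GoodBasepoint

variable {𝒢 : GroupOperadData.{u}} {C : TopOperad 𝒢} (η : GoodBasepoint C)

/-- The basepoint `e_k` of `C(k)`. -/
noncomputable def e (k : ℕ) : C.X k := η.η k (OrderedIntervals.std k)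

/-- The class of the linear path `e_n → γ(e_k; e_{m₁}, …, e_{m_k})`. -/
noncomputable def δ {k : ℕ} {m : Fin k → ℕ} {n : ℕ} (h : ∑ i, m i = n) :
    Path.Homotopic.Quotient (η.e n) (C.γ h (η.e k) fun i => η.e (m i)) :=
  Path.Homotopic.Quotient.mk
    (((OrderedIntervals.linearPath (OrderedIntervals.std n)
      (OrderedIntervals.comp h (OrderedIntervals.std k) fun i =>
        OrderedIntervals.std (m i))).map (η.continuous_η n)).cast rfl (η.η_comp h _ _).symm)

/-- The groups `π₁(C(k)/G_k)`, in the form `π₁(C(k); e_k, G_k e_k)`. -/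
abbrev Pi1 (k : ℕ) : Type u := OrbitPathClass (𝒢.G k) (η.e k)

/-- The composition of `π₁(C/𝒢)`: for `f` ending at `g e_k` and `f_i` ending at `g_i e_{m_i}`, the
class of the path
`e_n → γ(e_k; e_{m_i}) → γ(g e_k; g_i e_{m_i}) = γ(g; g_i) γ(e_k; e_{m_{g⁻¹(i)}}) → γ(g; g_i) e_n`,
where the first part is linear, the second is `γ(f; f_i)` and the third is the translate by
`γ(g; g_i)` of an inverse linear path. -/
noncomputable def pi1γ {k : ℕ} {m : Fin k → ℕ} {n : ℕ} (h : ∑ i, m i = n) (x : η.Pi1 k)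
    (y : ∀ i, η.Pi1 (m i)) : η.Pi1 n where
  elt := 𝒢.γ h x.elt fun i => (y i).elt
  path := (η.δ h).trans <| (C.γClass h x.path fun i => (y i).path).trans <|
    ((η.δ (sum_perm h (𝒢.perm x.elt))).symm.map
      (OrbitPathClass.translate (𝒢.γ h x.elt fun i => (y i).elt))).cast
      (C.isOperad.equivariant h x.elt (fun i => (y i).elt) (η.e k) fun i => η.e (m i)) rfl

/-- The fundamental groups operad `π₁(C/𝒢)`. -/
noncomputable def fundamental : GroupOperadData.{u} where
  G := η.Pi1
  π n := (𝒢.π n).comp OrbitPathClass.eltHom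
  γ := η.pi1γ

/-- The homomorphism `π₁(C(k)/G_k) → G_k`. -/
noncomputable def toBase (k : ℕ) : η.fundamental.G k →* 𝒢.G k :=
  (OrbitPathClass.eltHom : η.Pi1 k →* 𝒢.G k)

/-- The subgroup `π₁ C(k)` of `π₁(C(k)/G_k)`: the classes of loops at `e_k`, which form the kernel
of the homomorphism to `G_k`. -/
noncomputable def loops (k : ℕ) : Subgroup (η.fundamental.G k) :=
  (η.toBase k).ker

end GoodBasepoint

/-! ### Classifying operads -/

/-- The simplices of the simplicial set `EG`: an `l`-simplex is a tuple `(a₀, …, a_l)` in `G`. -/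
abbrev ESimplex (G : Type u) : Type u := (l : ℕ) × (Fin (l + 1) → G)

/-- Points of the disjoint union of the closed simplices of `EG`. -/
abbrev EPrespace (G : Type u) : Type u := (s : ESimplex G) × stdSimplex ℝ (Fin (s.1 + 1))

/-- The relations `(θ^* a, t) ∼ (a, θ_* t)` of the geometric realization, where `θ` runs through the
simplicial operators and `θ^* a = a ∘ θ`. -/
inductive ERel (G : Type u) : EPrespace G → EPrespace G → Prop
  | of {p q : ℕ} (θ : Fin (p + 1) →o Fin (q + 1)) (a : Fin (q + 1) → G)
      (t : stdSimplex ℝ (Fin (p + 1))) :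
      ERel G ⟨⟨p, a ∘ θ⟩, t⟩ ⟨⟨q, a⟩, stdSimplex.map θ t⟩

/-- The geometric realization `|EG|`, with the quotient topology; `G` is discrete. -/
def ESpace (G : Type u) : Type u := Quot (ERel G)

namespace ESpace

variable {G : Type u}

instance : TopologicalSpace (ESpace G) :=
  instTopologicalSpaceQuot

/-- The point `[a₀, …, a_l; t]`. -/
def mk {l : ℕ} (a : Fin (l + 1) → G) (t : stdSimplex ℝ (Fin (l + 1))) : ESpace G :=
  Quot.mk _ ⟨⟨l, a⟩, t⟩

/-- The point of `|EG|` given by the vertex `a`. -/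
noncomputable def vertex (a : G) : ESpace G :=
  mk (l := 0) (fun _ => a) (stdSimplex.vertex 0)

/-- `b · [a₀, …, a_l; t] = [b a₀, …, b a_l; t]`. -/
instance [Group G] : MulAction G (ESpace G) where
  smul b := Quot.map (fun p => ⟨⟨p.1.1, fun i => b * p.1.2 i⟩, p.2⟩) (by
    rintro _ _ ⟨θ, a, t⟩
    exact ERel.of θ (fun i => b * a i) t)
  one_smul x := by
    induction x using Quot.ind with | mk p =>
    exact congrArg (fun a => mk a p.2) (funext fun i => one_mul (p.1.2 i))
  mul_smul b c x := by
    induction x using Quot.ind with | mk p =>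
    exact congrArg (fun a => mk a p.2) (funext fun i => mul_assoc b c (p.1.2 i))

theorem smul_mk [Group G] (b : G) {l : ℕ} (a : Fin (l + 1) → G)
    (t : stdSimplex ℝ (Fin (l + 1))) : b • mk a t = mk (fun i => b * a i) t := rfl

instance [Group G] : ContinuousConstSMul G (ESpace G) where
  continuous_const_smul b := by
    refine continuous_quot_lift _ (continuous_quot_mk.comp ?_)
    refine continuous_sigma fun p => ?_
    exact continuous_sigmaMk (σ := fun s : ESimplex G => stdSimplex ℝ (Fin (s.1 + 1)))
      (i := ⟨p.1, fun i => b * p.2 i⟩)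

end ESpace

/-- The composition of `|E𝒢|`: for points `[c; t]` and `[a i; t]` given by `l`-simplices and one and
the same point `t` of the standard `l`-simplex (all finite families of points have this form), it is
`[γ(c; a); t]`, where `γ` is applied to the vertices. -/
noncomputable def ESpace.γ (𝒢 : GroupOperadData.{u}) {k : ℕ} {m : Fin k → ℕ} {n : ℕ}
    (h : ∑ i, m i = n) (x : ESpace (𝒢.G k)) (y : ∀ i, ESpace (𝒢.G (m i))) : ESpace (𝒢.G n) :=
  haveI : Nonempty (ESpace (𝒢.G n)) := ⟨ESpace.vertex 1⟩
  Classical.epsilon fun z => ∃ (l : ℕ) (t : stdSimplex ℝ (Fin (l + 1))) (c : Fin (l + 1) → 𝒢.G k)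
    (a : ∀ i, Fin (l + 1) → 𝒢.G (m i)), x = ESpace.mk c t ∧ (∀ i, y i = ESpace.mk (a i) t) ∧
      z = ESpace.mk (fun j => 𝒢.γ h (c j) fun i => a i j) t

/-- The classifying operad `|E𝒢|` of a group operad. -/
noncomputable def GroupOperadData.classifying (𝒢 : GroupOperadData.{u}) : OperadData 𝒢 where
  X n := ESpace (𝒢.G n)
  unit := ESpace.vertex 1
  γ := ESpace.γ 𝒢

/-! ### Quotient operads -/

section KerQuotient

variable {P G E : Type u} [Group P] [Group G] [MulAction P E] (p : P →* G)

/-- The orbit space of `E` under the kernel of `p`. -/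
abbrev KerQuotient (p : P →* G) (E : Type u) [MulAction P E] : Type u :=
  Quotient (MulAction.orbitRel p.ker E)

variable {p} in
theorem kerQuotient_sound {f f' : P} (hf : p f = p f') {x x' : E}
    (hx : MulAction.orbitRel p.ker E x x') :
    MulAction.orbitRel p.ker E (f • x) (f' • x') := by
  obtain ⟨⟨a, ha⟩, rfl⟩ := hx
  rw [MonoidHom.mem_ker] at ha
  refine ⟨⟨f * a * f'⁻¹, ?_⟩, ?_⟩
  · simp [MonoidHom.mem_ker, ha, hf]
  · simp [Subgroup.smul_def, mul_smul]

/-- The action of `G` on `E / ker p` given by `g · [x] = [f • x]` for any `f` with `p f = g`; here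
`s` chooses such elements. -/
abbrev kerQuotientAction (s : G → P) (hs : ∀ g, p (s g) = g) : MulAction G (KerQuotient p E) where
  smul g := Quotient.map (s g • ·) fun _ _ h => kerQuotient_sound rfl h
  one_smul x := by
    induction x using Quotient.ind with | _ x =>
    refine Quotient.sound (s := MulAction.orbitRel p.ker E) ?_
    have := kerQuotient_sound (p := p) (f := s 1) (f' := 1) (by simp [hs])
      ((MulAction.orbitRel p.ker E).refl x)
    rwa [one_smul] at this
  mul_smul g g' x := by
    induction x using Quotient.ind with | _ x =>
    refine Quotient.sound (s := MulAction.orbitRel p.ker E) ?_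
    have := kerQuotient_sound (p := p) (f := s (g * g')) (f' := s g * s g') (by simp [hs])
      ((MulAction.orbitRel p.ker E).refl x)
    rwa [mul_smul] at this

theorem kerQuotientAction_mk (s : G → P) (hs : ∀ g, p (s g) = g) (f : P) (x : E) :
    letI := kerQuotientAction (E := E) p s hs
    (p f • Quotient.mk (MulAction.orbitRel p.ker E) x : KerQuotient p E) =
      Quotient.mk (MulAction.orbitRel p.ker E) (f • x) :=
  Quotient.sound (s := MulAction.orbitRel p.ker E)
    (kerQuotient_sound (hs (p f)) ((MulAction.orbitRel p.ker E).refl x))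

end KerQuotient

namespace GoodBasepoint

variable {𝒢 : GroupOperadData.{u}} {C : TopOperad 𝒢} (η : GoodBasepoint C)

/-- The class of a path from `e_k` to `g e_k`. -/
noncomputable def lift [∀ k, PathConnectedSpace (C.X k)] {k : ℕ} (g : 𝒢.G k) :
    η.fundamental.G k :=
  OrbitPathClass.ofPath g (PathConnectedSpace.somePath (η.e k) (g • η.e k))

/-- The space `|Eπ₁(C/𝒢)|(n)/π₁ C(n)`. -/
abbrev Orbits (n : ℕ) : Type u :=
  KerQuotient (η.toBase n) (η.fundamental.classifying.X n)

/-- The projection `|Eπ₁(C/𝒢)|(n) → |Eπ₁(C/𝒢)|(n)/π₁ C(n)`. -/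
noncomputable def proj {n : ℕ} (x : η.fundamental.classifying.X n) : η.Orbits n :=
  Quotient.mk _ x

/-- An element `g` of `G_n` acts on `|Eπ₁(C/𝒢)|(n)/π₁ C(n)` through an element over `g`. -/
noncomputable abbrev orbitsAction [∀ k, PathConnectedSpace (C.X k)] (n : ℕ) :
    MulAction (𝒢.G n) (η.Orbits n) :=
  kerQuotientAction (E := η.fundamental.classifying.X n) (η.toBase n)
    (fun g => η.lift g) fun _ => rfl

/-- The quotient operad `|Eπ₁(C/𝒢)|/π₁C`. An element of `𝒢` acts through an element of `π₁(C/𝒢)`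
over it, and composition is computed on representatives. -/
noncomputable def reconstruction [∀ k, PathConnectedSpace (C.X k)] : OperadData 𝒢 where
  X := η.Orbits
  action := η.orbitsAction
  continuous_smul n :=
    letI := η.orbitsAction n
    ⟨fun g => continuous_quot_lift _
      (continuous_quot_mk.comp (continuous_const_smul (η.lift g)))⟩
  unit := η.proj η.fundamental.classifying.unit
  γ h x y := η.proj (η.fundamental.classifying.γ h (Quotient.out x) fun i => Quotient.out (y i))

theorem toBase_smul_proj [∀ k, PathConnectedSpace (C.X k)] {n : ℕ} (f : η.fundamental.G n)
    (x : η.fundamental.classifying.X n) :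
    (η.toBase n f • (show η.reconstruction.X n from η.proj x) : η.reconstruction.X n) =
      η.proj (f • x) :=
  kerQuotientAction_mk (η.toBase n) (fun g => η.lift g) (fun _ => rfl) f x

end GoodBasepoint

/-! Points of `|EG|` are treated as step functions. A point `t` of a simplex cuts `[0,1)` into
consecutive intervals whose lengths are the barycentric coordinates, and `[a₀, …, a_l; t]` becomes
the function with value `a_j` on the `j`-th interval. The simplicial identifications only merge
neighbouring intervals with equal values or drop empty ones, so a point is determined by its
function (`ESpace.val_injective`). In this model the composition of `|E𝒢|` is computed value by
value (`ESpace.val_γ`), and the laws of a group operad yield those of the operad `|E𝒢|`. The measure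
of the set where two functions differ is a metric. Its topology is coarser than that of the
realization but agrees with it on finite unions of simplices, and every compact set lies in such a
union. Continuity on compact sets, separation and the covering property thus become metric
estimates. Replacing `x` by `y` on `[0,t)` and letting `t` grow contracts `|EG|`, and also joins any
two equivariant maps into it by an equivariant homotopy.

The universal covers of the `C(k)`, as spaces of classes of paths from `e_k`, inherit a composition:
the linear path followed by `γ` of the given paths (`GoodBasepoint.coverγ`). Each operad identity is
carried along paths from the basepoints (`coverγ_along`), where it holds because the spaces of
ordered intervals are contractible (`coverγ_coverη`). The groups `π₁(C(k)/G_k)` act freely on the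
covers, and the composition of `π₁(C/𝒢)` is exactly the one that makes `coverγ` equivariant. Such a
free action forces the laws of a group operad: apply the operad laws to translated points and cancel
(`isGroupOperad_of_free`). The loops form the kernel of the map to `𝒢`, hence a normal non-crossed
sub group operad.

For the comparison, let `P` be the product of the operad of universal covers with `|Eπ₁(C/𝒢)|`. Both
projections of `P` are morphisms of operads. Dividing by `π₁C` gives a zigzag from `C`, which is the
quotient of the covers, through `P/π₁C` to `|Eπ₁(C/𝒢)|/π₁C`. To see homotopy equivalences one needs
maps in both directions between each cover and `|Eπ₁|`, equivariant under the loops but not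
compatible with composition. These come from obstruction theory: an equivariant map `A → F` from a
free space is a section of `(A × F)/K → A/K`, and an equivariant homotopy is a section of a bundle
of paths. As `F` has the extension property for discs, cell by cell lifting
(`CellStructure.exists_lift`) provides sections, up to a deformation, when `A/K` is a homotopy
retract of a cellular space (`IsDominated.exists_section`). This holds for `C(k)` by the `K(π,1)`
hypothesis, and for `|EΠ|/Π` because it has one cell for each word starting with `1` and without
consecutive repetitions (`ESpace.cellStructure`). -/

open MeasureTheory

/-! ### Points of the realization as step functions -/

/-- The half-open unit interval, on which the step functions live. -/
abbrev StepDomain : Type := Set.Ico (0 : ℝ) 1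

noncomputable instance : MeasureSpace StepDomain := Measure.Subtype.measureSpace

namespace StepDomain

theorem volume_real_lt {c : ℝ} (h0 : 0 ≤ c) (h1 : c ≤ 1) :
    volume.real {s : StepDomain | (s : ℝ) < c} = c := by
  have h : (Subtype.val '' {s : StepDomain | (s : ℝ) < c}) = Set.Ico 0 c := by
    ext x
    constructor
    · rintro ⟨s, hs, rfl⟩
      exact ⟨s.2.1, hs⟩
    · rintro ⟨hx, hx'⟩
      exact ⟨⟨x, hx, hx'.trans_le h1⟩, hx', rfl⟩
  rw [Measure.real, Measure.Subtype.volume_def, comap_subtype_coe_apply measurableSet_Ico, h,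
    Real.volume_Ico, sub_zero, ENNReal.toReal_ofReal h0]

instance : IsProbabilityMeasure (volume : Measure StepDomain) := by
  constructor
  have h := volume_real_lt zero_le_one le_rfl
  have h' : {s : StepDomain | (s : ℝ) < 1} = Set.univ :=
    Set.eq_univ_of_forall fun s => s.2.2
  rw [h', Measure.real] at h
  rw [← ENNReal.toReal_eq_one_iff, h]

/-- Monotone right-continuous maps to a discrete ordered set. -/
structure IsStep {L : Type*} [Preorder L] (ρ : StepDomain → L) : Prop where
  mono : Monotone ρ
  right : ∀ s : StepDomain, ∃ c : ℝ, s < c ∧ c ≤ 1 ∧ ∀ s' : StepDomain, s ≤ s' → (s' : ℝ) < c → ρ s' = ρ s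

theorem IsStep.comp {L L' : Type*} [Preorder L] [Preorder L'] {ρ : StepDomain → L} (hρ : IsStep ρ)
    {θ : L → L'} (hθ : Monotone θ) : IsStep (θ ∘ ρ) :=
  ⟨hθ.comp hρ.mono, fun s => by
    obtain ⟨c, h1, h2, h3⟩ := hρ.right s
    exact ⟨c, h1, h2, fun s' h h' => congrArg θ (h3 s' h h')⟩⟩

theorem exists_common_right {ι : Type*} (I : Finset ι) {L : ι → Type*} [∀ i, Preorder (L i)]
    {ρ : ∀ i, StepDomain → L i} (hρ : ∀ i, IsStep (ρ i)) (s : StepDomain) :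
    ∃ c : ℝ, s < c ∧ c ≤ 1 ∧ ∀ i ∈ I, ∀ s' : StepDomain, s ≤ s' → (s' : ℝ) < c → ρ i s' = ρ i s := by
  classical
  induction I using Finset.induction_on with
  | empty => exact ⟨1, s.2.2, le_rfl, by simp⟩
  | insert i I _ ih =>
    obtain ⟨c, h1, h2, h3⟩ := ih
    obtain ⟨c', h1', h2', h3'⟩ := (hρ i).right s
    refine ⟨min c c', lt_min h1 h1', (min_le_left _ _).trans h2, fun j hj s' h h' => ?_⟩
    rcases Finset.mem_insert.1 hj with rfl | hj
    · exact h3' s' h (h'.trans_le (min_le_right _ _))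
    · exact h3 j hj s' h (h'.trans_le (min_le_left _ _))

theorem IsStep.sum {ι : Type*} [Fintype ι] {ρ : ι → StepDomain → ℕ} (hρ : ∀ i, IsStep (ρ i)) :
    IsStep fun s => ∑ i, ρ i s :=
  ⟨fun _ _ h => Finset.sum_le_sum fun i _ => (hρ i).mono h, fun s => by
    obtain ⟨c, h1, h2, h3⟩ := exists_common_right Finset.univ hρ s
    exact ⟨c, h1, h2, fun s' h h' => Finset.sum_congr rfl fun i hi => h3 i hi s' h h'⟩⟩

theorem IsStep.measurableSet {L : Type*} [PartialOrder L] {ρ : StepDomain → L} (hρ : IsStep ρ)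
    (j : L) : MeasurableSet (ρ ⁻¹' {j}) := by
  have : (ρ ⁻¹' {j}).OrdConnected :=
    ⟨fun a ha b hb c hc => le_antisymm ((hρ.mono hc.2).trans_eq hb) (ha.symm.trans_le (hρ.mono hc.1))⟩
  exact this.measurableSet

end StepDomain

open StepDomain

/-- The point of the simplex whose coordinates are the lengths of the fibres of a step map. -/
noncomputable def stepPush {ι : Type*} [Fintype ι] [PartialOrder ι] (ρ : StepDomain → ι)
    (hρ : IsStep ρ) : stdSimplex ℝ ι :=
  ⟨fun j => volume.real (ρ ⁻¹' {j}), fun _ => measureReal_nonneg, by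
    classical
    have := sum_measureReal_preimage_singleton (μ := (volume : Measure StepDomain)) (f := ρ) Finset.univ
      (fun j _ => hρ.measurableSet j)
    rw [this]
    simp⟩

theorem stepPush_apply {ι : Type*} [Fintype ι] [PartialOrder ι] (ρ : StepDomain → ι)
    (hρ : IsStep ρ) (j : ι) : stepPush ρ hρ j = volume.real (ρ ⁻¹' {j}) := rfl

theorem sum_stepPush {ι : Type*} [Fintype ι] [PartialOrder ι] {ρ : StepDomain → ι}
    (hρ : IsStep ρ) (I : Finset ι) : ∑ i ∈ I, stepPush ρ hρ i = volume.real {s | ρ s ∈ I} := by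
  simp only [stepPush_apply]
  rw [sum_measureReal_preimage_singleton _ (fun i _ => hρ.measurableSet i)]
  rfl

/-- Additivity of length over fibres; simplicial operators become composition of step maps. -/
theorem map_stepPush {ι κ : Type*} [Fintype ι] [PartialOrder ι] [Fintype κ] [PartialOrder κ]
    {ρ : StepDomain → ι} (hρ : IsStep ρ) {θ : ι → κ} (hθ : Monotone θ) :
    stdSimplex.map θ (stepPush ρ hρ) = stepPush (θ ∘ ρ) (hρ.comp hθ) := by
  classical
  ext j
  simp only [stdSimplex.map_coe, FunOnFinite.linearMap_apply_apply]
  change ∑ i with θ i = j, stepPush ρ hρ i = volume.real ((θ ∘ ρ) ⁻¹' {j})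
  rw [sum_stepPush]
  congr 1
  ext s
  simp

/-! ### Barycentric coordinates and step maps determine each other -/

section idx

variable {l : ℕ} (t : stdSimplex ℝ (Fin (l + 1)))

/-- Partial sums of barycentric coordinates. -/
noncomputable def stepCum (j : ℕ) : ℝ := ∑ i with i.val < j, t i

theorem stepCum_mono {j j' : ℕ} (h : j ≤ j') : stepCum t j ≤ stepCum t j' :=
  Finset.sum_le_sum_of_subset_of_nonneg
    (fun i hi => by simp only [Finset.mem_filter, Finset.mem_univ, true_and] at hi ⊢; omega)
    fun i _ _ => stdSimplex.zero_le t i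

theorem stepCum_zero : stepCum t 0 = 0 := by simp [stepCum]

theorem stepCum_nonneg (j : ℕ) : 0 ≤ stepCum t j := Finset.sum_nonneg fun i _ => stdSimplex.zero_le t i

theorem stepCum_of_lt {j : ℕ} (h : l < j) : stepCum t j = 1 := by
  rw [stepCum, Finset.filter_true_of_mem fun i _ => by omega, stdSimplex.sum_eq_one]

theorem stepCum_le_one (j : ℕ) : stepCum t j ≤ 1 := by
  rw [← stdSimplex.sum_eq_one t]
  exact Finset.sum_le_sum_of_subset_of_nonneg (Finset.filter_subset _ _)
    fun i _ _ => stdSimplex.zero_le t i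

theorem stepCum_succ (j : Fin (l + 1)) : stepCum t (j + 1) = stepCum t j + t j := by
  classical
  have : Finset.univ.filter (fun i : Fin (l + 1) => i.val < j + 1) =
      insert j (Finset.univ.filter (fun i : Fin (l + 1) => i.val < j)) := by
    ext i
    simp only [Finset.mem_filter, Finset.mem_univ, true_and, Finset.mem_insert, Fin.ext_iff]
    omega
  rw [stepCum, this, Finset.sum_insert (by simp), add_comm]
  rfl

/-- The index of the edge of the subdivision of `[0,1)` with lengths `t` that contains `s`. -/
noncomputable def stepIdx (s : StepDomain) : Fin (l + 1) :=
  letI := Classical.decPred fun j => stepCum t j ≤ s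
  ⟨Nat.findGreatest (fun j => stepCum t j ≤ s) l, Nat.lt_succ_of_le (Nat.findGreatest_le l)⟩

theorem le_stepIdx_iff (s : StepDomain) (j : ℕ) : j ≤ stepIdx t s ↔ stepCum t j ≤ s := by
  let := Classical.decPred fun j => stepCum t j ≤ s
  rcases le_or_gt j l with hj | hj
  · constructor
    · intro h
      have h0 : stepCum t 0 ≤ s := by rw [stepCum_zero]; exact s.2.1
      have := Nat.findGreatest_spec (P := fun j => stepCum t j ≤ s) (Nat.zero_le l) h0
      exact (stepCum_mono t h).trans this
    · intro h
      exact Nat.le_findGreatest hj h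
  · have h1 := (stepIdx t s).2
    have h2 := stepCum_of_lt t hj
    have h3 := s.2.2
    constructor
    · intro h; omega
    · intro h; linarith

theorem stepIdx_lt_iff (s : StepDomain) (j : ℕ) : stepIdx t s < j ↔ s < stepCum t j := by
  rw [← not_le, le_stepIdx_iff, not_le]

theorem isStep_stepIdx : IsStep (stepIdx t) := by
  constructor
  · intro s s' h
    rw [Fin.le_def, le_stepIdx_iff]
    exact ((le_stepIdx_iff t s _).1 le_rfl).trans h
  · intro s
    refine ⟨stepCum t (stepIdx t s + 1), ?_, stepCum_le_one t _, fun s' h h' => ?_⟩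
    · rw [← stepIdx_lt_iff]
      exact Nat.lt_succ_self _
    · rw [← stepIdx_lt_iff] at h'
      refine Fin.ext (le_antisymm (Nat.le_of_lt_succ h') ?_)
      rw [le_stepIdx_iff]
      exact ((le_stepIdx_iff t s _).1 le_rfl).trans h

/-- The points of index less than `j` form the interval from `0` to the `j`-th partial sum, so all
partial sums agree, and coordinates are their differences. -/
theorem stepPush_stepIdx : stepPush (stepIdx t) (isStep_stepIdx t) = t := by
  have h : ∀ j, stepCum (stepPush (stepIdx t) (isStep_stepIdx t)) j = stepCum t j := by
    intro j
    rw [stepCum, sum_stepPush]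
    simp only [Finset.mem_filter, Finset.mem_univ, true_and, stepIdx_lt_iff]
    exact volume_real_lt (stepCum_nonneg t j) (stepCum_le_one t j)
  ext j
  have h1 := stepCum_succ t j
  have h2 := stepCum_succ (stepPush (stepIdx t) (isStep_stepIdx t)) j
  rw [h, h] at h2
  linarith

theorem stepIdx_stepPush {ρ : StepDomain → Fin (l + 1)} (hρ : IsStep ρ) :
    stepIdx (stepPush ρ hρ) = ρ := by
  have key : ∀ (s : StepDomain) (j : ℕ), s < stepCum (stepPush ρ hρ) j ↔ ρ s < j := by
    intro s j
    rw [stepCum, sum_stepPush]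
    simp only [Finset.mem_filter, Finset.mem_univ, true_and]
    constructor
    · contrapose!
      intro h
      have hsub : {s' | (ρ s' : ℕ) < j} ⊆ {s' : StepDomain | (s' : ℝ) < s} := by
        intro s' hs'
        by_contra hlt
        have : s ≤ s' := not_lt.1 hlt
        have := hρ.mono this
        rw [Fin.le_def] at this
        simp only [Set.mem_ofPred_eq] at hs'
        omega
      exact (measureReal_mono hsub).trans_eq (volume_real_lt s.2.1 s.2.2.le)
    · intro h
      -- Right-continuity makes the inequality strict: the index stays below `j` up to some `c > s`.
      obtain ⟨c, h1, h2, h3⟩ := hρ.right s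
      have hsub : {s' : StepDomain | (s' : ℝ) < c} ⊆ {s' | (ρ s' : ℕ) < j} := by
        intro s' hs'
        rcases le_total s s' with hss | hss
        · simp only [Set.mem_ofPred_eq, h3 s' hss hs', h]
        · have := hρ.mono hss
          rw [Fin.le_def] at this
          exact this.trans_lt h
      calc (s : ℝ) < c := h1
        _ = _ := (volume_real_lt (s.2.1.trans h1.le) h2).symm
        _ ≤ _ := measureReal_mono hsub
  funext s
  refine Fin.ext (le_antisymm ?_ ?_)
  · rw [← Nat.lt_succ_iff, stepIdx_lt_iff, key]
    exact Nat.lt_succ_self _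
  · rw [← Nat.lt_succ_iff, ← key, ← stepIdx_lt_iff]
    exact Nat.lt_succ_self _

/-- This naturality is what makes `ESpace.val` well defined on the realization. -/
theorem stepIdx_map {l' : ℕ} {θ : Fin (l + 1) → Fin (l' + 1)} (hθ : Monotone θ) :
    stepIdx (stdSimplex.map θ t) = θ ∘ stepIdx t := by
  conv_lhs => rw [← stepPush_stepIdx t]
  rw [map_stepPush _ hθ, stepIdx_stepPush]

end idx

/-! ### Common refinements of step maps -/

/-- Enumerate the image in increasing order. On points of simplices this drops the vanishing
coordinates, so it passes to a face. -/
theorem exists_surjective_factor {L : ℕ} {ρ : StepDomain → Fin (L + 1)} (hρ : IsStep ρ) :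
    ∃ N ≤ L, ∃ (ρ' : StepDomain → Fin (N + 1)) (θ : Fin (N + 1) → Fin (L + 1)), IsStep ρ' ∧
      StrictMono θ ∧ Function.Surjective ρ' ∧ ρ = θ ∘ ρ' := by
  classical
  let S : Finset (Fin (L + 1)) := Finset.univ.filter fun j => ∃ s, ρ s = j
  have hS : ∀ s, ρ s ∈ S := fun s => Finset.mem_filter.2 ⟨Finset.mem_univ _, s, rfl⟩
  obtain ⟨N, hN⟩ : ∃ N, S.card = N + 1 :=
    Nat.exists_eq_succ_of_ne_zero (Finset.card_pos.2 ⟨_, hS ⟨0, le_rfl, one_pos⟩⟩).ne'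
  have hNL : N ≤ L := by
    have := S.card_le_univ
    rw [Fintype.card_fin] at this
    omega
  let e := S.orderIsoOfFin hN
  refine ⟨N, hNL, fun s => e.symm ⟨ρ s, hS s⟩, fun j => e j, ?_, fun i j h => e.strictMono h, ?_, ?_⟩
  · refine ⟨fun s s' h => e.symm.monotone (Subtype.mk_le_mk.2 (hρ.mono h)), fun s => ?_⟩
    obtain ⟨c, h1, h2, h3⟩ := hρ.right s
    refine ⟨c, h1, h2, fun s' h h' => ?_⟩
    simp only [h3 s' h h']
  · intro j
    have := (e j).2
    simp only [S, Finset.mem_filter, Finset.mem_univ, true_and] at this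
    obtain ⟨s, hs⟩ := this
    refine ⟨s, ?_⟩
    simp only [hs]
    exact e.symm_apply_apply j
  · funext s
    simp

/-- The sum of the `ρ i`, as natural numbers, is again a step map and already determines every `ρ
i`, since all of them are monotone. Its surjective part is the common refinement, and the value of
the sum bounds the dimension. -/
theorem exists_common_step {ι : Type*} [Fintype ι] {l : ι → ℕ} {ρ : ∀ i, StepDomain → Fin (l i + 1)}
    (hρ : ∀ i, IsStep (ρ i)) :
    ∃ N ≤ ∑ i, l i, ∃ (ρ' : StepDomain → Fin (N + 1)) (θ : ∀ i, Fin (N + 1) → Fin (l i + 1)),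
      IsStep ρ' ∧ Function.Surjective ρ' ∧ (∀ i, Monotone (θ i)) ∧ ∀ i, ρ i = θ i ∘ ρ' := by
  have hκ := IsStep.sum (ρ := fun i s => (ρ i s : ℕ))
    fun i => (hρ i).comp (θ := fun j => (j : ℕ)) fun _ _ h => h
  let κ : StepDomain → Fin ((∑ i, l i) + 1) := fun s =>
    ⟨∑ i, (ρ i s : ℕ), Nat.lt_succ_of_le (Finset.sum_le_sum fun i _ => Nat.le_of_lt_succ (ρ i s).2)⟩
  have hκ' : IsStep κ := ⟨fun s s' h => hκ.mono h, fun s => by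
    obtain ⟨c, h1, h2, h3⟩ := hκ.right s
    exact ⟨c, h1, h2, fun s' h h' => Fin.ext (h3 s' h h')⟩⟩
  -- Termwise comparable families with equal sums are equal.
  have hinj : ∀ s s', s ≤ s' → κ s = κ s' → ∀ i, ρ i s = ρ i s' := by
    intro s s' h hs i
    have h1 := (Finset.sum_eq_sum_iff_of_le
      (fun i _ => (hρ i).mono h : ∀ i ∈ Finset.univ, (ρ i s : ℕ) ≤ ρ i s')).1 (Fin.ext_iff.1 hs)
    exact Fin.ext (h1 i (Finset.mem_univ i))
  obtain ⟨N, hN, ρ', θ, h1, h2, h3, h4⟩ := exists_surjective_factor hκ'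
  choose r hr using h3
  refine ⟨N, hN, ρ', fun i j => ρ i (r j), h1, fun j => ⟨r j, hr j⟩, fun i j j' h => ?_, fun i => ?_⟩
  · refine (hρ i).mono ?_
    by_contra hlt
    have h' := h1.mono (not_le.1 hlt).le
    rw [hr, hr] at h'
    rw [le_antisymm h h'] at hlt
    exact hlt le_rfl
  · funext s
    have hk : κ s = κ (r (ρ' s)) := by rw [h4]; simp [hr]
    rcases le_total s (r (ρ' s)) with h | h
    · exact hinj _ _ h hk i
    · exact (hinj _ _ h hk.symm i).symm

/-! ### Step functions of points of the realization -/

namespace ESpace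

variable {G : Type u}

theorem mk_comp {l l' : ℕ} {θ : Fin (l + 1) → Fin (l' + 1)} (hθ : Monotone θ) (a : Fin (l' + 1) → G)
    (t : stdSimplex ℝ (Fin (l + 1))) : mk (a ∘ θ) t = mk a (stdSimplex.map θ t) :=
  Quot.sound (ERel.of ⟨θ, hθ⟩ a t)

/-- The step function of a point of `|EG|`. -/
noncomputable def val : ESpace G → StepDomain → G :=
  Quot.lift (fun p s => p.1.2 (stepIdx p.2 s)) (by
    rintro _ _ ⟨θ, a, t⟩
    funext s
    simp only [stepIdx_map t θ.monotone]
    rfl)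

theorem val_mk {l : ℕ} (a : Fin (l + 1) → G) (t : stdSimplex ℝ (Fin (l + 1))) (s : StepDomain) :
    val (mk a t) s = a (stepIdx t s) := rfl

theorem exists_mk (x : ESpace G) : ∃ (l : ℕ) (a : Fin (l + 1) → G) (t : stdSimplex ℝ (Fin (l + 1))),
    x = mk a t := by
  induction x using Quot.ind with | mk p =>
  exact ⟨p.1.1, p.1.2, p.2, rfl⟩

/-- Finitely many points can be written with one and the same point of a simplex. -/
theorem exists_common_mk {ι : Type*} [Fintype ι] {G : ι → Type*} {l : ι → ℕ}
    (a : ∀ i, Fin (l i + 1) → G i) (t : ∀ i, stdSimplex ℝ (Fin (l i + 1))) :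
    ∃ N ≤ ∑ i, l i, ∃ (θ : ∀ i, Fin (N + 1) → Fin (l i + 1)) (t' : stdSimplex ℝ (Fin (N + 1))),
      Function.Surjective (stepIdx t') ∧ ∀ i, mk (a i) (t i) = mk (a i ∘ θ i) t' := by
  obtain ⟨N, hN, ρ, θ, h1, h2, h3, h4⟩ := exists_common_step fun i => isStep_stepIdx (t i)
  refine ⟨N, hN, θ, stepPush ρ h1, by rwa [stepIdx_stepPush], fun i => ?_⟩
  rw [mk_comp (h3 i), map_stepPush h1 (h3 i)]
  congr 1
  rw [← stepPush_stepIdx (t i)]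
  congr 1
  exact h4 i

/-- Over a common point of a simplex with surjective index map, every letter of the two words is a
value of the function. -/
theorem val_injective : Function.Injective (val : ESpace G → StepDomain → G) := by
  intro x y hxy
  obtain ⟨l, a, t, rfl⟩ := exists_mk x
  obtain ⟨l', a', t', rfl⟩ := exists_mk y
  obtain ⟨N, -, θ, t'', h1, h2⟩ := exists_common_mk (ι := Bool) (G := fun _ => G)
    (l := fun b => cond b l l') (fun b => match b with | true => a | false => a')
    (fun b => match b with | true => t | false => t')
  have ht := h2 true
  have hf := h2 false
  simp only at ht hf
  rw [ht, hf] at hxy ⊢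
  congr 1
  funext j
  obtain ⟨s, rfl⟩ := h1 j
  exact congrFun hxy s

theorem val_mk_stepPush {l : ℕ} {ρ : StepDomain → Fin (l + 1)} (hρ : IsStep ρ) (a : Fin (l + 1) → G) :
    val (mk a (stepPush ρ hρ)) = a ∘ ρ := by
  funext s
  rw [val_mk, stepIdx_stepPush, Function.comp_apply]

theorem val_smul [Group G] (b : G) (x : ESpace G) (s : StepDomain) : val (b • x) s = b * val x s := by
  obtain ⟨l, a, t, rfl⟩ := exists_mk x
  rfl

/-- The choice in the definition of `ESpace.γ` is harmless: the step function of the result is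
computed from those of the arguments, whichever representatives are chosen. -/
theorem γ_mk (𝒢 : GroupOperadData.{u}) {k : ℕ} {m : Fin k → ℕ} {n : ℕ}
    (h : ∑ i, m i = n) {l : ℕ} (t : stdSimplex ℝ (Fin (l + 1))) (c : Fin (l + 1) → 𝒢.G k)
    (a : ∀ i, Fin (l + 1) → 𝒢.G (m i)) :
    ESpace.γ 𝒢 h (mk c t) (fun i => mk (a i) t) = mk (fun j => 𝒢.γ h (c j) fun i => a i j) t := by
  have := Classical.epsilon_spec (p := fun z => ∃ (l' : ℕ) (t' : stdSimplex ℝ (Fin (l' + 1)))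
    (c' : Fin (l' + 1) → 𝒢.G k) (a' : ∀ i, Fin (l' + 1) → 𝒢.G (m i)), mk c t = ESpace.mk c' t' ∧
      (∀ i, mk (a i) t = ESpace.mk (a' i) t') ∧
      z = ESpace.mk (fun j => 𝒢.γ h (c' j) fun i => a' i j) t') ⟨_, l, t, c, a, rfl, fun _ => rfl, rfl⟩
  obtain ⟨l', t', c', a', h1, h2, h3⟩ := this
  refine Eq.trans h3 (val_injective ?_)
  funext s
  have h1' := congrFun (congrArg val h1) s
  have h2' := fun i => congrFun (congrArg val (h2 i)) s
  simp only [val_mk] at h1' h2' ⊢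
  rw [h1']
  simp only [h2']

theorem exists_common_mk' (𝒢 : GroupOperadData.{u}) {k : ℕ} {m : Fin k → ℕ}
    (x : ESpace (𝒢.G k)) (y : ∀ i, ESpace (𝒢.G (m i))) :
    ∃ (l : ℕ) (t : stdSimplex ℝ (Fin (l + 1))) (c : Fin (l + 1) → 𝒢.G k)
    (a : ∀ i, Fin (l + 1) → 𝒢.G (m i)), x = mk c t ∧ y = fun i => mk (a i) t := by
  obtain ⟨l, c, t, rfl⟩ := exists_mk x
  choose l' a t' h using fun i => exists_mk (y i)
  obtain ⟨N, -, θ, u, -, h2⟩ := exists_common_mk (ι := Option (Fin k))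
    (G := fun o => o.elim (𝒢.G k) fun i => 𝒢.G (m i))
    (l := fun o => o.elim l l') (fun o => match o with | none => c | some i => a i)
    (fun o => match o with | none => t | some i => t' i)
  exact ⟨N, u, _, _, h2 none, funext fun i => (h i).trans (h2 (some i))⟩

/-- The composition of `|E𝒢|` is the pointwise composition of step functions. -/
theorem val_γ (𝒢 : GroupOperadData.{u}) {k : ℕ} {m : Fin k → ℕ} {n : ℕ}
    (h : ∑ i, m i = n) (x : ESpace (𝒢.G k)) (y : ∀ i, ESpace (𝒢.G (m i))) (s : StepDomain) :
    val (ESpace.γ 𝒢 h x y) s = 𝒢.γ h (val x s) fun i => val (y i) s := by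
  obtain ⟨l, t, c, a, rfl, rfl⟩ := exists_common_mk' 𝒢 x y
  rw [γ_mk]
  rfl

end ESpace

open MeasureTheory StepDomain

/-! ### The topology of the realization -/

namespace ESpace

variable {G : Type u}

theorem val_right (x : ESpace G) (s : StepDomain) :
    ∃ c : ℝ, s < c ∧ c ≤ 1 ∧ ∀ s' : StepDomain, s ≤ s' → (s' : ℝ) < c → val x s' = val x s := by
  obtain ⟨l, a, t, rfl⟩ := exists_mk x
  obtain ⟨c, h1, h2, h3⟩ := (isStep_stepIdx t).right s
  exact ⟨c, h1, h2, fun s' h h' => congrArg a (h3 s' h h')⟩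

theorem volume_real_Ico {p q : ℝ} (hp : 0 ≤ p) (hpq : p ≤ q) (hq : q ≤ 1) :
    volume.real {s : StepDomain | p ≤ s ∧ (s : ℝ) < q} = q - p := by
  have h1 : {s : StepDomain | p ≤ s ∧ (s : ℝ) < q} =
      {s : StepDomain | (s : ℝ) < q} \ {s : StepDomain | (s : ℝ) < p} := by
    ext s
    rw [Set.mem_sdiff]
    simp only [Set.mem_ofPred_eq, not_lt, and_comm]
  have hm : MeasurableSet {s : StepDomain | (s : ℝ) < p} :=
    measurableSet_lt measurable_subtype_coe measurable_const
  have hsub : {s : StepDomain | (s : ℝ) < p} ⊆ {s : StepDomain | (s : ℝ) < q} :=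
    fun s hs => lt_of_lt_of_le hs hpq
  rw [h1, measureReal_sdiff hsub hm, volume_real_lt (hp.trans hpq) hq,
    volume_real_lt hp (hpq.trans hq)]

/-- Any pointwise operation on finitely many step functions stays in the realization. The bound on
the dimension keeps results in finite unions of simplices, and surjectivity identifies every vertex
as a value. -/
theorem exists_combine {ι : Type*} [Fintype ι] {l : ι → ℕ} {ρ : ∀ i, StepDomain → Fin (l i + 1)}
    (hρ : ∀ i, IsStep (ρ i)) (Φ : (∀ i, Fin (l i + 1)) → G) :
    ∃ N ≤ ∑ i, l i, ∃ (a : Fin (N + 1) → G) (t : stdSimplex ℝ (Fin (N + 1))),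
      Function.Surjective (stepIdx t) ∧ ∀ s, val (mk a t) s = Φ fun i => ρ i s := by
  obtain ⟨N, hN, ρ', θ, h1, h2, -, h4⟩ := exists_common_step hρ
  refine ⟨N, hN, fun j => Φ fun i => θ i j, stepPush ρ' h1, by rwa [stepIdx_stepPush], fun s => ?_⟩
  rw [val_mk_stepPush h1]
  simp only [h4, Function.comp_apply]

/-! ### The metric of disagreement and the weak topology -/

/-- The measure of the set on which two step functions differ. -/
noncomputable def mdist (x y : ESpace G) : ℝ := volume.real {s | val x s ≠ val y s}

theorem mdist_nonneg (x y : ESpace G) : 0 ≤ mdist x y := measureReal_nonneg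

theorem mdist_self (x : ESpace G) : mdist x x = 0 := by simp [mdist]

theorem mdist_comm (x y : ESpace G) : mdist x y = mdist y x := by simp only [mdist, ne_comm]

theorem mdist_triangle (x y z : ESpace G) : mdist x z ≤ mdist x y + mdist y z := by
  refine (measureReal_mono fun s hs => ?_).trans (measureReal_union_le _ _)
  by_contra h
  simp only [Set.mem_union, Set.mem_ofPred_eq, not_or, not_not] at h hs
  exact hs (h.1.trans h.2)

/-- By right-continuity, functions that differ at `s` differ on an interval of positive length
starting at `s`. -/
theorem eq_of_mdist_eq_zero {x y : ESpace G} (h : mdist x y = 0) : x = y := by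
  by_contra hne
  obtain ⟨s, hs⟩ := Function.ne_iff.1 (val_injective.ne hne)
  obtain ⟨c, h1, h2, h3⟩ := val_right x s
  obtain ⟨c', h1', h2', h3'⟩ := val_right y s
  have hsub : {s' : StepDomain | (s' : ℝ) < min c c'} ⊆
      {s' : StepDomain | (s' : ℝ) < s} ∪ {s' | val x s' ≠ val y s'} := by
    intro s' hs'
    rcases lt_or_ge s' s with h | h
    · exact Or.inl h
    · refine Or.inr ?_
      simp only [Set.mem_ofPred_eq] at hs' ⊢
      rw [h3 s' h (hs'.trans_le (min_le_left _ _)), h3' s' h (hs'.trans_le (min_le_right _ _))]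
      exact hs
  have h4 := (measureReal_mono hsub (measure_ne_top volume _)).trans (measureReal_union_le _ _)
  rw [volume_real_lt (s.2.1.trans (lt_min h1 h1').le) ((min_le_left _ _).trans h2),
    volume_real_lt s.2.1 s.2.2.le] at h4
  have h5 : (s : ℝ) < min c c' := lt_min h1 h1'
  change volume.real _ = 0 at h
  linarith

theorem mdist_smul [Group G] (b : G) (x y : ESpace G) : mdist (b • x) (b • y) = mdist x y := by
  simp only [mdist, val_smul, ne_eq, mul_right_inj]

theorem mdist_smul_of_ne [Group G] {b c : G} (h : b ≠ c) (x : ESpace G) : mdist (b • x) (c • x) = 1 := by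
  simp [mdist, val_smul, h]

variable (G) in
/-- The set `|EG|` with the metric `mdist`. -/
def Met : Type u := ESpace G

noncomputable instance : MetricSpace (Met G) where
  dist x y := mdist (G := G) x y
  dist_self := mdist_self
  dist_comm := mdist_comm
  dist_triangle := mdist_triangle
  eq_of_dist_eq_zero := eq_of_mdist_eq_zero

/-- The identity map to the metric realization. -/
def toMet (x : ESpace G) : Met G := x

theorem toMet_injective : Function.Injective (toMet : ESpace G → Met G) := fun _ _ h => h

theorem continuous_mk {l : ℕ} (a : Fin (l + 1) → G) : Continuous (mk a) :=
  continuous_quot_mk.comp (continuous_sigmaMk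
    (σ := fun s : ESimplex G => stdSimplex ℝ (Fin (s.1 + 1))) (i := ⟨l, a⟩))

theorem isClosed_iff {S : Set (ESpace G)} :
    IsClosed S ↔ ∀ (l : ℕ) (a : Fin (l + 1) → G), IsClosed (mk a ⁻¹' S) := by
  constructor
  · intro h l a
    exact h.preimage (continuous_mk a)
  · intro h
    refine isQuotientMap_quot_mk.isClosed_preimage.1 ?_
    rw [isClosed_sigma_iff]
    exact fun p => h p.1 p.2

theorem continuous_iff {A : Type*} [TopologicalSpace A] {f : ESpace G → A} :
    Continuous f ↔ ∀ (l : ℕ) (a : Fin (l + 1) → G), Continuous (f ∘ mk a) := by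
  constructor
  · intro h l a
    exact h.comp (continuous_mk a)
  · intro h
    rw [continuous_iff_isClosed]
    intro S hS
    rw [isClosed_iff]
    exact fun l a => hS.preimage (h l a)

/-- If the two index maps differ at `s`, then `s` lies between the two values of a partial sum; the
larger of the two indices names that sum. -/
theorem mdist_mk_le {l : ℕ} (a : Fin (l + 1) → G) (t t' : stdSimplex ℝ (Fin (l + 1))) :
    mdist (mk a t) (mk a t') ≤ ∑ j ∈ Finset.range (l + 1), |stepCum t j - stepCum t' j| := by
  have hsub : {s | val (mk a t) s ≠ val (mk a t') s} ⊆ ⋃ j ∈ Finset.range (l + 1),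
      {s : StepDomain | min (stepCum t j) (stepCum t' j) ≤ s ∧
        s < max (stepCum t j) (stepCum t' j)} := by
    intro s hs
    simp only [val_mk, Set.mem_ofPred_eq] at hs
    have hne : stepIdx t s ≠ stepIdx t' s := fun h => hs (congrArg a h)
    simp only [Set.mem_iUnion, Finset.mem_range]
    rcases lt_or_gt_of_ne hne with h | h
    · refine ⟨stepIdx t' s, (stepIdx t' s).2, ?_, ?_⟩
      · exact (min_le_right _ _).trans ((le_stepIdx_iff t' s _).1 le_rfl)
      · exact lt_of_lt_of_le ((stepIdx_lt_iff t s _).1 h) (le_max_left _ _)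
    · refine ⟨stepIdx t s, (stepIdx t s).2, ?_, ?_⟩
      · exact (min_le_left _ _).trans ((le_stepIdx_iff t s _).1 le_rfl)
      · exact lt_of_lt_of_le ((stepIdx_lt_iff t' s _).1 h) (le_max_right _ _)
  refine (measureReal_mono hsub (measure_ne_top _ _)).trans ((measureReal_biUnion_finset_le _ _).trans
    (Finset.sum_le_sum fun j _ => ?_))
  rw [volume_real_Ico (le_min (stepCum_nonneg _ _) (stepCum_nonneg _ _)) min_le_max
    (max_le (stepCum_le_one _ _) (stepCum_le_one _ _)), max_sub_min_eq_abs, abs_sub_comm]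

theorem continuous_stepCum {l : ℕ} (j : ℕ) :
    Continuous fun t : stdSimplex ℝ (Fin (l + 1)) => stepCum t j :=
  continuous_finsetSum _ fun i _ => (continuous_apply i).comp continuous_subtype_val

theorem continuous_toMet : Continuous (toMet : ESpace G → Met G) := by
  rw [continuous_iff]
  intro l a
  rw [continuous_iff_continuousAt]
  intro t
  rw [ContinuousAt, tendsto_iff_dist_tendsto_zero]
  have h0 : Filter.Tendsto (fun t' => ∑ j ∈ Finset.range (l + 1), |stepCum t' j - stepCum t j|) (𝓝 t)
      (𝓝 0) := by
    have hc : Continuous fun t' : stdSimplex ℝ (Fin (l + 1)) =>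
        ∑ j ∈ Finset.range (l + 1), |stepCum t' j - stepCum t j| :=
      continuous_finsetSum _ fun j _ => ((continuous_stepCum j).sub continuous_const).abs
    simpa using hc.tendsto t
  exact squeeze_zero (fun _ => dist_nonneg) (fun t' => mdist_mk_le a t' t) h0

instance : T2Space (ESpace G) := T2Space.of_injective_continuous toMet_injective continuous_toMet

theorem continuous_mdist : Continuous fun p : ESpace G × ESpace G => mdist p.1 p.2 :=
  (continuous_toMet.comp continuous_fst).dist (continuous_toMet.comp continuous_snd)

/-- The union of the simplices of dimension at most `N` with vertices in `F`. -/
def bounded (F : Set G) (N : ℕ) : Set (ESpace G) :=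
  {x | ∃ l ≤ N, ∃ a : Fin (l + 1) → G, (∀ j, a j ∈ F) ∧ ∃ t, x = mk a t}

theorem isCompact_bounded {F : Set G} (hF : F.Finite) (N : ℕ) : IsCompact (bounded F N) := by
  have : bounded F N = ⋃ l ∈ Set.Iic N, ⋃ a ∈ Set.pi Set.univ fun _ : Fin (l + 1) => F,
      Set.range (mk a) := by
    ext x
    simp only [bounded, Set.mem_ofPred_eq, Set.mem_iUnion, Set.mem_Iic, Set.mem_pi, Set.mem_univ,
      true_imp_iff, Set.mem_range, exists_prop, eq_comm]
  rw [this]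
  exact (Set.finite_Iic N).isCompact_biUnion fun l _ =>
    (Set.Finite.pi fun _ => hF).isCompact_biUnion fun a _ =>
      isCompact_range (continuous_mk a)

/-- In a representation of least dimension no coordinate vanishes, since otherwise
`exists_surjective_factor` would shorten it. -/
theorem exists_minimal (x : ESpace G) : ∃ (l : ℕ) (a : Fin (l + 1) → G) (t : stdSimplex ℝ (Fin (l + 1))),
    x = mk a t ∧ Function.Surjective (stepIdx t) ∧
      ∀ (l' : ℕ) (a' : Fin (l' + 1) → G) (t' : stdSimplex ℝ (Fin (l' + 1))), x = mk a' t' → l ≤ l' := by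
  classical
  have hex : ∃ (l : ℕ) (a : Fin (l + 1) → G) (t : stdSimplex ℝ (Fin (l + 1))), x = mk a t := exists_mk x
  obtain ⟨a, t, hx⟩ := Nat.find_spec hex
  have hmin : ∀ (l' : ℕ) (a' : Fin (l' + 1) → G) (t' : stdSimplex ℝ (Fin (l' + 1))), x = mk a' t' →
      Nat.find hex ≤ l' := fun l' a' t' h => Nat.find_min' hex ⟨a', t', h⟩
  generalize Nat.find hex = l at a t hx hmin
  obtain ⟨N, hN, ρ, θ, h1, h2, h3, h4⟩ := exists_surjective_factor (isStep_stepIdx t)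
  have hx' : x = mk (a ∘ θ) (stepPush ρ h1) := by
    apply val_injective
    rw [val_mk_stepPush h1, hx]
    funext s
    rw [val_mk, h4]
    rfl
  have : l = N := le_antisymm (hmin _ _ _ hx') hN
  exact ⟨N, a ∘ θ, _, hx', by rwa [stepIdx_stepPush], fun l' a' t' h => this ▸ hmin l' a' t' h⟩

/-- A compact set meets finitely many open simplices. -/
theorem exists_bounded_of_isCompact {K : Set (ESpace G)} (hK : IsCompact K) :
    ∃ F : Set G, F.Finite ∧ ∃ N, K ⊆ bounded F N := by
  choose l a t hx hsurj hmin using fun x : ESpace G => exists_minimal x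
  let w : ESpace G → ESimplex G := fun x => ⟨l x, a x⟩
  -- By minimality, a point of the simplex `b` has a carrier `w` of dimension at most `p` with
  -- letters among those of `b`, so finitely many carriers occur.
  have hw : ∀ (p : ℕ) (b : Fin (p + 1) → G), (w '' Set.range (mk b)).Finite := by
    intro p b
    have hfin : (⋃ i ∈ Set.Iic p, (fun c : Fin (i + 1) → G => (⟨i, c⟩ : ESimplex G)) ''
        Set.pi Set.univ fun _ => Set.range b).Finite :=
      (Set.finite_Iic p).biUnion fun i _ => Set.Finite.image _
        (Set.Finite.pi fun _ => Set.finite_range b)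
    refine hfin.subset ?_
    rintro _ ⟨_, ⟨u, rfl⟩, rfl⟩
    simp only [Set.mem_iUnion]
    refine ⟨l (mk b u), hmin _ _ _ _ rfl, a (mk b u), fun j _ => ?_, rfl⟩
    obtain ⟨s, rfl⟩ := hsurj _ j
    refine ⟨stepIdx u s, ?_⟩
    have := congrFun (congrArg val (hx (mk b u))) s
    simpa only [val_mk] using this
  have hfin : (w '' K).Finite := by
    -- Pick one point of `K` for each carrier. Every subset of `S` meets each simplex in a finite
    -- set and is therefore closed; thus `S` is compact and discrete, hence finite.
    obtain ⟨S, hSK, hS⟩ := (Set.surjOn_image w K).exists_bijOn_subset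
    have hclosed : ∀ S' ⊆ S, IsClosed S' := by
      intro S' hS'
      rw [isClosed_iff]
      intro p b
      have : (S' ∩ Set.range (mk b)).Finite := by
        refine Set.Finite.of_finite_image ((hw p b).subset (Set.image_mono Set.inter_subset_right)) ?_
        exact hS.injOn.mono (Set.inter_subset_left.trans hS')
      have h2 := this.isClosed.preimage (continuous_mk b)
      convert h2 using 1
      ext u
      simp
    have hdisc : DiscreteTopology S := by
      rw [discreteTopology_iff_forall_isClosed]
      intro T
      have := (hclosed (Subtype.val '' T) (by rintro _ ⟨x, -, rfl⟩; exact x.2)).preimage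
        (continuous_subtype_val (p := (· ∈ S)))
      rwa [Set.preimage_image_eq _ Subtype.val_injective] at this
    have hSc : IsCompact S := hK.of_isClosed_subset (hclosed S subset_rfl) hSK
    have : S.Finite := by
      have : CompactSpace S := isCompact_iff_compactSpace.1 hSc
      have : Finite S := finite_of_compact_of_discrete
      exact S.toFinite
    rw [← hS.image_eq]
    exact this.image w
  refine ⟨⋃ p ∈ w '' K, Set.range p.2, hfin.biUnion fun p _ => Set.finite_range _, ?_⟩
  obtain ⟨N, hN⟩ := (hfin.image Sigma.fst).bddAbove
  refine ⟨N, fun x hxK => ⟨l x, hN ⟨w x, ⟨x, hxK, rfl⟩, rfl⟩, a x, fun j => ?_, t x, hx x⟩⟩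
  simp only [Set.mem_iUnion]
  exact ⟨w x, ⟨x, hxK, rfl⟩, j, rfl⟩

theorem bounded_mono {F F' : Set G} (hF : F ⊆ F') {N N' : ℕ} (hN : N ≤ N') :
    bounded F N ⊆ bounded F' N' := fun _ ⟨l, hl, a, ha, h⟩ => ⟨l, hl.trans hN, a, fun j => hF (ha j), h⟩

/-- A map into finitely many simplices is continuous if it is continuous for the metric. -/
theorem continuousOn_of_mdist {A : Type*} [TopologicalSpace A] {f : A → ESpace G} {S : Set A}
    {F : Set G} (hF : F.Finite) {N : ℕ} (hf : ∀ a ∈ S, f a ∈ bounded F N)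
    (hd : ∀ a ∈ S, Filter.Tendsto (fun a' => mdist (f a') (f a)) (𝓝[S] a) (𝓝 0)) :
    ContinuousOn f S := by
  have : CompactSpace (bounded F N) := isCompact_iff_compactSpace.1 (isCompact_bounded hF N)
  -- A continuous injection of a compact space into a metric space is an embedding, so on this set
  -- the two topologies coincide.
  have hemb : Topology.IsClosedEmbedding fun x : bounded F N => toMet x.1 :=
    (continuous_toMet.comp continuous_subtype_val).isClosedEmbedding
      (toMet_injective.comp Subtype.val_injective)
  have hmet : ContinuousOn (fun a => toMet (f a)) S := fun a ha =>
    tendsto_iff_dist_tendsto_zero.2 (hd a ha)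
  rw [continuousOn_iff_continuous_domRestrict] at hmet ⊢
  have h2 : Continuous fun a : S => (⟨f a, hf a a.2⟩ : bounded F N) :=
    hemb.isInducing.continuous_iff.2 hmet
  exact continuous_subtype_val.comp h2

instance : CompactlyCoherentSpace (ESpace G) := by
  have h : ∀ s : ESimplex G, CompactSpace (stdSimplex ℝ (Fin (s.1 + 1))) := fun s => inferInstance
  refine .of_isClosed fun S hS => isClosed_iff.2 fun l a => ?_
  have h1 := hS (Set.range (mk a)) (isCompact_range (continuous_mk a))
  have h2 := h1.preimage ((continuous_mk a).codRestrict fun t => Set.mem_range_self t)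
  exact h2

theorem γ_mem_bounded (𝒢 : GroupOperadData.{u}) {k : ℕ} {m : Fin k → ℕ} {n : ℕ}
    (h : ∑ i, m i = n) {x : ESpace (𝒢.G k)} {y : ∀ i, ESpace (𝒢.G (m i))} {F : Set (𝒢.G k)} {N : ℕ}
    {F' : ∀ i, Set (𝒢.G (m i))} {N' : Fin k → ℕ} (hx : x ∈ bounded F N)
    (hy : ∀ i, y i ∈ bounded (F' i) (N' i)) :
    ESpace.γ 𝒢 h x y ∈ bounded ((fun p : 𝒢.G k × ∀ i, 𝒢.G (m i) => 𝒢.γ h p.1 p.2) ''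
      (F ×ˢ {a | ∀ i, a i ∈ F' i})) (N + ∑ i, N' i) := by
  obtain ⟨l, hl, c, hc, t, rfl⟩ := hx
  choose l' hl' a ha t' hy using hy
  obtain ⟨M, hM, b, u, hu, hv⟩ := exists_combine (ι := Option (Fin k))
    (l := fun o => o.elim l l')
    (ρ := fun o => match o with | none => stepIdx t | some i => stepIdx (t' i))
    (fun o => match o with | none => isStep_stepIdx t | some i => isStep_stepIdx (t' i))
    (fun j => 𝒢.γ h (c (j none)) fun i => a i (j (some i)))
  refine ⟨M, hM.trans ?_, b, fun j => ?_, u, val_injective (funext fun s => ?_)⟩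
  · rw [Fintype.sum_option]
    exact Nat.add_le_add hl (Finset.sum_le_sum fun i _ => hl' i)
  · obtain ⟨s, rfl⟩ := hu j
    rw [← val_mk b u s, hv]
    exact ⟨⟨_, _⟩, ⟨hc _, fun i => ha i _⟩, rfl⟩
  · rw [hv, val_γ]
    simp only [hy]
    rfl

/-- Composition is pointwise, so the results differ only where some argument does. -/
theorem mdist_γ_le (𝒢 : GroupOperadData.{u}) {k : ℕ} {m : Fin k → ℕ} {n : ℕ}
    (h : ∑ i, m i = n) (x x' : ESpace (𝒢.G k)) (y y' : ∀ i, ESpace (𝒢.G (m i))) :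
    mdist (ESpace.γ 𝒢 h x y) (ESpace.γ 𝒢 h x' y') ≤ mdist x x' + ∑ i, mdist (y i) (y' i) := by
  have hsub : {s | val (ESpace.γ 𝒢 h x y) s ≠ val (ESpace.γ 𝒢 h x' y') s} ⊆
      {s | val x s ≠ val x' s} ∪ ⋃ i ∈ Finset.univ, {s | val (y i) s ≠ val (y' i) s} := by
    intro s hs
    by_contra hcon
    simp only [Set.mem_union, Set.mem_iUnion, Set.mem_ofPred_eq, not_or, not_exists, not_not] at hcon
    refine hs ?_
    rw [val_γ, val_γ, hcon.1]
    congr 1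
    funext i
    exact hcon.2 i (Finset.mem_univ i)
  refine (measureReal_mono hsub (measure_ne_top _ _)).trans ((measureReal_union_le _ _).trans ?_)
  exact add_le_add le_rfl (measureReal_biUnion_finset_le _ _)

/-- The projections of a compact set lie in finite unions of simplices, and so do the composites;
there the metric estimate is enough. -/
theorem continuousOn_γ (𝒢 : GroupOperadData.{u}) {k : ℕ} {m : Fin k → ℕ} {n : ℕ}
    (h : ∑ i, m i = n) (K : Set (ESpace (𝒢.G k) × ∀ i, ESpace (𝒢.G (m i)))) (hK : IsCompact K) :
    ContinuousOn (fun p => ESpace.γ 𝒢 h p.1 p.2) K := by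
  obtain ⟨F, hF, N, hN⟩ := exists_bounded_of_isCompact (hK.image continuous_fst)
  choose F' hF' N' hN' using fun i => exists_bounded_of_isCompact
    (hK.image (f := fun p => p.2 i) ((continuous_apply i).comp continuous_snd))
  refine continuousOn_of_mdist (Set.Finite.image _ (hF.prod (Set.Finite.pi' hF')))
    (fun p hp => γ_mem_bounded 𝒢 h (hN ⟨p, hp, rfl⟩) fun i => hN' i ⟨p, hp, rfl⟩) fun p _ => ?_
  refine squeeze_zero (fun _ => mdist_nonneg _ _) (fun q => mdist_γ_le 𝒢 h _ _ _ _) ?_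
  have hc : Continuous fun q : ESpace (𝒢.G k) × ∀ i, ESpace (𝒢.G (m i)) =>
      mdist q.1 p.1 + ∑ i, mdist (q.2 i) (p.2 i) := by
    refine (continuous_mdist.comp (continuous_fst.prodMk continuous_const)).add
      (continuous_finsetSum _ fun i _ => ?_)
    have hi : Continuous fun q : ESpace (𝒢.G k) × ∀ i, ESpace (𝒢.G (m i)) => q.2 i :=
      (continuous_apply i).comp continuous_snd
    exact continuous_mdist.comp (hi.prodMk continuous_const)
  have := hc.tendsto p
  simp only [mdist_self, Finset.sum_const_zero, add_zero] at this
  exact this.mono_left nhdsWithin_le_nhds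

/-! ### Separation of translates -/

/-- Translates of one point by different elements differ everywhere, so their distance is `1`, and
balls of radius `1/2` have disjoint translates. -/
theorem isCoveringAction [Group G] : IsCoveringAction G (ESpace G) := by
  intro x
  refine ⟨{y | mdist x y < 1 / 2}, ?_, fun g h hgh => ?_⟩
  · refine IsOpen.mem_nhds ?_ (by simp [mdist_self])
    exact isOpen_lt (continuous_mdist.comp (continuous_const.prodMk continuous_id)) continuous_const
  · rw [Set.disjoint_left]
    rintro _ ⟨y, hy, rfl⟩ ⟨z, hz, hyz⟩
    simp only [Set.mem_ofPred_eq] at hy hz hyz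
    have h1 := mdist_smul_of_ne hgh z
    rw [hyz, mdist_smul, mdist_comm] at h1
    have := mdist_triangle y x z
    rw [mdist_comm y x] at this
    linarith

/-- Points in different orbits of a subgroup have neighbourhoods that no translates meet. -/
theorem exists_disjoint_smul [Group G] (H : Subgroup G) (x y : ESpace G) (hxy : ∀ h ∈ H, h • y ≠ x) :
    ∃ U ∈ 𝓝 x, ∃ V ∈ 𝓝 y, ∀ h ∈ H, ∀ v ∈ V, h • v ∉ U := by
  -- A translate of `y` agrees with `x` somewhere only for the finitely many quotients of a letter
  -- of `x` by a letter of `y`.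
  have hfin : {g : G | mdist x (g • y) < 1}.Finite := by
    obtain ⟨l, a, t, rfl⟩ := exists_mk x
    obtain ⟨l', a', t', rfl⟩ := exists_mk y
    refine (Set.finite_range fun p : Fin (l + 1) × Fin (l' + 1) => a p.1 * (a' p.2)⁻¹).subset ?_
    intro g hg
    by_contra hcon
    refine (ne_of_lt (show mdist _ _ < 1 from hg)) ?_
    have : {s | val (mk a t) s ≠ val (g • mk a' t') s} = Set.univ := by
      refine Set.eq_univ_of_forall fun s hs => hcon ⟨(stepIdx t s, stepIdx t' s), ?_⟩
      rw [val_smul, val_mk, val_mk] at hs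
      simp [hs]
    rw [mdist, this]
    simp
  -- The minimum of `1` and of finitely many positive distances.
  obtain ⟨ε, hε, hε1, hε2⟩ : ∃ ε > 0, ε ≤ 1 ∧ ∀ h ∈ H, ε ≤ mdist x (h • y) := by
    have hfin' : ∀ S : Set G, S.Finite → ∃ ε : ℝ, ε > 0 ∧ ε ≤ 1 ∧ ∀ h ∈ S, h ∈ H → ε ≤ mdist x (h • y) := by
      intro S hS
      induction S, hS using Set.Finite.induction_on with
      | empty => exact ⟨1, one_pos, le_rfl, by simp⟩
      | insert _ _ ih =>
        rename_i g S _ _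
        obtain ⟨ε, h1, h2, h3⟩ := ih
        by_cases hg : g ∈ H
        · refine ⟨min ε (mdist x (g • y)), lt_min h1 ?_, (min_le_left _ _).trans h2, ?_⟩
          · exact lt_of_le_of_ne (mdist_nonneg _ _)
              fun h => hxy g hg (eq_of_mdist_eq_zero h.symm).symm
          · rintro h (rfl | hh) hH
            · exact min_le_right _ _
            · exact (min_le_left _ _).trans (h3 h hh hH)
        · refine ⟨ε, h1, h2, ?_⟩
          rintro h (rfl | hh) hH
          · exact absurd hH hg
          · exact h3 h hh hH
    obtain ⟨ε, h1, h2, h3⟩ := hfin' _ hfin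
    refine ⟨ε, h1, h2, fun h hh => ?_⟩
    by_cases hlt : mdist x (h • y) < 1
    · exact h3 h hlt hh
    · exact h2.trans (not_lt.1 hlt)
  have hball : ∀ z : ESpace G, {w | mdist z w < ε / 2} ∈ 𝓝 z := fun z =>
    IsOpen.mem_nhds (isOpen_lt (continuous_mdist.comp (continuous_const.prodMk continuous_id))
      continuous_const) (by simp [mdist_self, hε])
  refine ⟨_, hball x, _, hball y, fun h hh v hv hu => ?_⟩
  have h1 := mdist_triangle x (h • v) (h • y)
  rw [mdist_smul, mdist_comm v y] at h1
  have h2 := hε2 h hh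
  simp only [Set.mem_ofPred_eq] at hv hu
  linarith

/-! ### Concatenation of step functions and contractibility -/

/-- The only breaks of `z` are those of `x` and `y` and one at `t`, whence the bound `1 + N + N'`.
-/
theorem exists_concat (t : unitInterval) (x y : ESpace G) :
    ∃ z, ∀ s : StepDomain, ((s : ℝ) < t → val z s = val y s) ∧ (t ≤ (s : ℝ) → val z s = val x s) ∧
      ∀ F N N', x ∈ bounded F N → y ∈ bounded F N' → z ∈ bounded F (1 + N + N') := by
  classical
  -- Representations of least dimension make the bound valid for all `N` and `N'` at once.
  obtain ⟨l, a, u, rfl, hu, hmin⟩ := exists_minimal x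
  obtain ⟨l', a', u', rfl, hu', hmin'⟩ := exists_minimal y
  let τ : StepDomain → Fin (1 + 1) := fun s => if (s : ℝ) < t then 0 else 1
  have hτ : IsStep τ := by
    constructor
    · intro s s' h
      have h' : (s : ℝ) ≤ s' := h
      simp only [τ]
      split_ifs with h1 h2
      · exact le_rfl
      · exact Fin.zero_le _
      · exact absurd (h'.trans_lt (by assumption)) h1
      · exact le_rfl
    · intro s
      by_cases hs : (s : ℝ) < t
      · exact ⟨t, hs, t.2.2, fun s' _ h => by simp [τ, h, hs]⟩
      · refine ⟨1, s.2.2, le_rfl, fun s' h _ => ?_⟩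
        have h' : (s : ℝ) ≤ s' := h
        simp [τ, hs, not_lt.2 ((not_lt.1 hs).trans h')]
  obtain ⟨M, hM, b, w, hw, hv⟩ := exists_combine (ι := Fin 3) (l := ![1, l, l'])
    (ρ := fun i => match i with | 0 => τ | 1 => stepIdx u | 2 => stepIdx u')
    (fun i => match i with | 0 => hτ | 1 => isStep_stepIdx u | 2 => isStep_stepIdx u')
    (fun j => if (show Fin (1 + 1) from j 0) = 0 then a' (j 2) else a (j 1))
  refine ⟨mk b w, fun s => ⟨fun h => ?_, fun h => ?_, fun F N N' hx hy => ?_⟩⟩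
  · rw [hv]
    have : τ s = 0 := by simp [τ, h]
    exact if_pos this
  · rw [hv]
    have : τ s ≠ 0 := by simp [τ, h]
    exact if_neg this
  · obtain ⟨p, hp, c, hc, r, hr⟩ := hx
    obtain ⟨p', hp', c', hc', r', hr'⟩ := hy
    refine ⟨M, hM.trans ?_, b, fun j => ?_, w, rfl⟩
    · rw [Fin.sum_univ_three]
      have h1 := (hmin _ _ _ hr).trans hp
      have h2 := (hmin' _ _ _ hr').trans hp'
      simp only [Matrix.cons_val]
      omega
    · obtain ⟨s, rfl⟩ := hw j
      rw [← val_mk b w s, hv]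
      split_ifs
      · have h3 : a' (stepIdx u' s) = c' (stepIdx r' s) := congrFun (congrArg val hr') s
        exact h3 ▸ hc' _
      · have h3 : a (stepIdx u s) = c (stepIdx r s) := congrFun (congrArg val hr) s
        exact h3 ▸ hc _

/-- The step function that agrees with `y` on `[0,t)` and with `x` on `[t,1)`. -/
noncomputable def concat (t : unitInterval) (x y : ESpace G) : ESpace G := (exists_concat t x y).choose

theorem val_concat (t : unitInterval) (x y : ESpace G) (s : StepDomain) [Decidable ((s : ℝ) < t)] :
    val (concat t x y) s = if (s : ℝ) < t then val y s else val x s := by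
  have := (exists_concat t x y).choose_spec s
  split_ifs with h
  · exact this.1 h
  · exact this.2.1 (not_lt.1 h)

theorem concat_mem_bounded {t : unitInterval} {x y : ESpace G} {F : Set G} {N N' : ℕ}
    (hx : x ∈ bounded F N) (hy : y ∈ bounded F N') : concat t x y ∈ bounded F (1 + N + N') :=
  ((exists_concat t x y).choose_spec ⟨0, le_rfl, one_pos⟩).2.2 F N N' hx hy

theorem concat_zero (x y : ESpace G) : concat 0 x y = x := by
  classical
  exact val_injective (funext fun s => by rw [val_concat, if_neg]; exact not_lt.2 s.2.1)

theorem concat_one (x y : ESpace G) : concat 1 x y = y := by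
  classical
  exact val_injective (funext fun s => by rw [val_concat, if_pos]; exact s.2.2)

theorem smul_concat [Group G] (g : G) (t : unitInterval) (x y : ESpace G) :
    concat t (g • x) (g • y) = g • concat t x y := by
  classical
  refine val_injective (funext fun s => ?_)
  rw [val_smul, val_concat, val_concat, val_smul, val_smul]
  split_ifs <;> rfl

/-- The results differ at most between the two cut points and where the arguments differ. -/
theorem mdist_concat_le (t t' : unitInterval) (x x' y y' : ESpace G) :
    mdist (concat t x y) (concat t' x' y') ≤ |(t : ℝ) - t'| + (mdist x x' + mdist y y') := by
  classical
  have hsub : {s | val (concat t x y) s ≠ val (concat t' x' y') s} ⊆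
      {s : StepDomain | min (t : ℝ) t' ≤ s ∧ (s : ℝ) < max (t : ℝ) t'} ∪
        ({s | val x s ≠ val x' s} ∪ {s | val y s ≠ val y' s}) := by
    intro s hs
    by_contra hcon
    simp only [Set.mem_union, Set.mem_ofPred_eq, not_or, not_not, not_and, not_lt] at hcon
    obtain ⟨h1, h2, h3⟩ := hcon
    refine hs ?_
    rw [val_concat, val_concat, h2, h3]
    rcases lt_or_ge (s : ℝ) (min (t : ℝ) t') with h | h
    · rw [if_pos (h.trans_le (min_le_left _ _)), if_pos (h.trans_le (min_le_right _ _))]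
    · have := h1 h
      rw [if_neg (not_lt.2 ((le_max_left _ _).trans this)),
        if_neg (not_lt.2 ((le_max_right _ _).trans this))]
  refine (measureReal_mono hsub (measure_ne_top _ _)).trans ((measureReal_union_le _ _).trans
    (add_le_add ?_ (measureReal_union_le _ _)))
  rw [volume_real_Ico (le_min t.2.1 t'.2.1) min_le_max (max_le t.2.2 t'.2.2), max_sub_min_eq_abs,
    abs_sub_comm]

/-- Maps of two variables are continuous if they are so on compact sets of the second variable. -/
theorem continuous_of_continuousOn_univ_prod {A Z W : Type*} [TopologicalSpace A]
    [LocallyCompactSpace A] [TopologicalSpace Z]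
    [CompactlyCoherentSpace Z] [TopologicalSpace W] {F : A × Z → W}
    (h : ∀ K : Set Z, IsCompact K → ContinuousOn F (Set.univ ×ˢ K)) : Continuous F := by
  have hA : ∀ z, Continuous fun a => F (a, z) := fun z =>
    (h {z} isCompact_singleton).comp_continuous (by fun_prop) fun a => ⟨trivial, rfl⟩
  -- The adjoint map can be tested on compact subsets of `Z`, and local compactness of `A` allows
  -- going back to the product.
  let Φ : Z → C(A, W) := fun z => ⟨fun a => F (a, z), hA z⟩
  have hΦ : Continuous Φ := by
    rw [CompactlyCoherentSpace.isCoherentWith.continuous_iff]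
    intro K hK
    rw [continuousOn_iff_continuous_domRestrict]
    refine ContinuousMap.continuous_of_continuous_uncurry _ ?_
    exact (h K hK).comp_continuous (f := fun p : K × A => (p.2, (p.1 : Z))) (by fun_prop)
      fun p => ⟨trivial, p.1.2⟩
  have := ContinuousMap.continuous_uncurry_of_continuous ⟨Φ, hΦ⟩
  exact this.comp continuous_swap

theorem continuous_concat {Z : Type*} [TopologicalSpace Z] [CompactlyCoherentSpace Z]
    {x y : Z → ESpace G} (hx : Continuous x) (hy : Continuous y) :
    Continuous fun p : unitInterval × Z => concat p.1 (x p.2) (y p.2) := by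
  refine continuous_of_continuousOn_univ_prod fun K hK => ?_
  obtain ⟨F, hF, N, hN⟩ := exists_bounded_of_isCompact (hK.image hx)
  obtain ⟨F', hF', N', hN'⟩ := exists_bounded_of_isCompact (hK.image hy)
  refine continuousOn_of_mdist (hF.union hF') (N := 1 + N + N') (fun p hp => concat_mem_bounded
    (bounded_mono Set.subset_union_left le_rfl (hN ⟨p.2, hp.2, rfl⟩))
    (bounded_mono Set.subset_union_right le_rfl (hN' ⟨p.2, hp.2, rfl⟩))) fun p _ => ?_
  refine squeeze_zero (fun _ => mdist_nonneg _ _) (fun q => mdist_concat_le _ _ _ _ _ _) ?_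
  have hc : Continuous fun q : unitInterval × Z =>
      |(q.1 : ℝ) - p.1| + (mdist (x q.2) (x p.2) + mdist (y q.2) (y p.2)) := by
    refine Continuous.add (by fun_prop) (Continuous.add ?_ ?_)
    · exact continuous_mdist.comp ((hx.comp continuous_snd).prodMk continuous_const)
    · exact continuous_mdist.comp ((hy.comp continuous_snd).prodMk continuous_const)
  have := hc.tendsto p
  simp only [mdist_self, sub_self, abs_zero, add_zero] at this
  exact this.mono_left nhdsWithin_le_nhds

/-- Moving the cut point from `0` to `1` replaces each step function by a constant one. -/
instance [Nonempty G] : ContractibleSpace (ESpace G) := by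
  rw [contractible_iff_id_nullhomotopic]
  refine ⟨vertex (Classical.arbitrary G), ⟨⟨⟨fun p => concat p.1 p.2 (vertex (Classical.arbitrary G)),
    continuous_concat continuous_id continuous_const⟩, fun x => ?_, fun x => ?_⟩⟩⟩
  · exact concat_zero _ _
  · exact concat_one _ _

/-! ### The operad laws, checked value by value -/

theorem γ_assoc {𝒢 : GroupOperadData.{u}} (h𝒢 : 𝒢.IsGroupOperad) {k : ℕ} {m : Fin k → ℕ} {n : ℕ}
    (h : ∑ i, m i = n) {l : Fin n → ℕ} {N : ℕ} (hN : ∑ j, l j = N) (a : ESpace (𝒢.G k))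
    (b : ∀ i, ESpace (𝒢.G (m i))) (c : ∀ j, ESpace (𝒢.G (l j))) :
    ESpace.γ 𝒢 hN (ESpace.γ 𝒢 h a b) c = ESpace.γ 𝒢 (sum_blocks h hN) a fun i =>
      ESpace.γ 𝒢 rfl (b i) fun j => c (blockEquiv h ⟨i, j⟩) := by
  refine val_injective (funext fun s => ?_)
  simp only [val_γ]
  exact h𝒢.assoc h hN _ _ _

theorem γ_smul {𝒢 : GroupOperadData.{u}} (h𝒢 : 𝒢.IsGroupOperad) {k : ℕ} {m : Fin k → ℕ} {n : ℕ}
    (h : ∑ i, m i = n) (σ : 𝒢.G k) (τ : ∀ i, 𝒢.G (m i)) (a : ESpace (𝒢.G k))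
    (b : ∀ i, ESpace (𝒢.G (m i))) :
    ESpace.γ 𝒢 h (σ • a) (fun i => τ i • b i) =
      𝒢.γ h σ τ • ESpace.γ 𝒢 (sum_perm h (𝒢.perm σ)) a fun i => b ((𝒢.perm σ).symm i) := by
  refine val_injective (funext fun s => ?_)
  simp only [val_γ, val_smul]
  exact h𝒢.crossed h _ _ _ _

end ESpace

/-- `|E𝒢|` is a topological `𝒢`-operad. -/
theorem GroupOperadData.IsGroupOperad.classifying {𝒢 : GroupOperadData.{u}} (h𝒢 : 𝒢.IsGroupOperad) :
    𝒢.classifying.IsOperad where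
  t2 n := inferInstanceAs (T2Space (ESpace (𝒢.G n)))
  compactlyGenerated n := inferInstanceAs (CompactlyCoherentSpace (ESpace (𝒢.G n)))
  zero := ⟨{
    default := ESpace.vertex 1
    uniq := fun _ => ESpace.val_injective (funext fun _ => h𝒢.zero.elim _ _) }⟩
  continuousOn_γ h K hK := ESpace.continuousOn_γ 𝒢 h K hK
  unit_γ h _ := ESpace.val_injective (funext fun _ => (ESpace.val_γ _ _ _ _ _).trans (h𝒢.one_γ h _))
  γ_unit h _ := ESpace.val_injective (funext fun _ => (ESpace.val_γ _ _ _ _ _).trans (h𝒢.γ_one h _))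
  assoc h _ _ hN a b c := ESpace.γ_assoc h𝒢 h hN a b c
  equivariant h σ τ a b := ESpace.γ_smul h𝒢 h σ τ a b

/-! ### Lifting along cells -/

/-- Lifts of maps on `s` prescribed on `b` exist along `p`. -/
def HasLift {W Z M : Type*} [TopologicalSpace W] [TopologicalSpace Z] [TopologicalSpace M]
    (p : W → Z) (s b : Set M) : Prop :=
  ∀ (χ : M → Z) (σ : M → W), ContinuousOn χ s → ContinuousOn σ b → (∀ z ∈ b, p (σ z) = χ z) →
    ∃ τ : M → W, ContinuousOn τ s ∧ Set.EqOn τ σ b ∧ ∀ z ∈ s, p (τ z) = χ z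

/-- Only `f ∘ g = id` on `s'` matters: lift over `s` after pulling back along `f`, then restrict
along `g`. -/
theorem HasLift.of_equiv {W Z M M' : Type*} [TopologicalSpace W] [TopologicalSpace Z]
    [TopologicalSpace M] [TopologicalSpace M'] {p : W → Z} {s b : Set M} {s' b' : Set M'}
    (h : HasLift p s b) (hb : b ⊆ s) (hb' : b' ⊆ s') {f : M → M'} {g : M' → M} (hf : ContinuousOn f s)
    (hg : ContinuousOn g s') (hfs : Set.MapsTo f s s') (hgs : Set.MapsTo g s' s)
    (hfb : Set.MapsTo f b b') (hgb : Set.MapsTo g b' b) (hfg : ∀ z ∈ s', f (g z) = z) :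
    HasLift p s' b' := by
  intro χ σ hχ hσ hp
  obtain ⟨τ, h1, h2, h3⟩ := h (χ ∘ f) (σ ∘ f) (hχ.comp hf hfs) (hσ.comp (hf.mono hb) hfb)
    fun z hz => hp _ (hfb hz)
  refine ⟨τ ∘ g, h1.comp hg hgs, fun z hz => ?_, fun z hz => ?_⟩
  · simp only [Function.comp_apply, h2 (hgb hz), hfg z (hb' hz)]
  · simp only [Function.comp_apply, h3 _ (hgs hz), hfg z hz]

/-- A decomposition of a space into cells, the models of which are the compact sets `s n` with
boundaries `b n`. -/
structure CellStructure {M : ℕ → Type*} [∀ n, TopologicalSpace (M n)] (s b : ∀ n, Set (M n))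
    (Y : Type u) [TopologicalSpace Y] where
  cell : ℕ → Type u
  χ : ∀ {n}, cell n → M n → Y
  continuousOn_χ : ∀ {n} (c : cell n), ContinuousOn (χ c) (s n)
  exists_rep : ∀ y, ∃ (n : ℕ) (c : cell n), ∃ z ∈ s n \ b n, χ c z = y
  rep_unique : ∀ {n n'} (c : cell n) (c' : cell n') (z : M n) (z' : M n'), z ∈ s n \ b n →
    z' ∈ s n' \ b n' → χ c z = χ c' z' → (⟨n, c, z⟩ : (n : ℕ) × cell n × M n) = ⟨n', c', z'⟩
  b_finite : ∀ n (c : cell n), ∃ I : Set ((n : ℕ) × cell n), I.Finite ∧ (∀ i ∈ I, i.1 < n) ∧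
    ∀ z ∈ b n, ∃ i ∈ I, ∃ w ∈ s i.1, χ i.2 w = χ c z
  coherent : ∀ S : Set Y, (∀ n (c : cell n), ∃ u, IsClosed u ∧ χ c ⁻¹' S ∩ s n = u ∩ s n) → IsClosed S

namespace CellStructure

variable {M : ℕ → Type*} [∀ n, TopologicalSpace (M n)] {s b : ∀ n, Set (M n)}
    {Y : Type u} [TopologicalSpace Y]

section

variable (K : CellStructure s b Y)

/-- The dimension of the open cell of a point. -/
noncomputable def rank (y : Y) : ℕ := (K.exists_rep y).choose

theorem rank_spec (y : Y) : ∃ c : K.cell (K.rank y), ∃ z ∈ s _ \ b _, K.χ c z = y :=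
  (K.exists_rep y).choose_spec

theorem rank_χ {n : ℕ} (c : K.cell n) {z : M n} (hz : z ∈ s n \ b n) : K.rank (K.χ c z) = n := by
  obtain ⟨c', z', hz', h⟩ := K.rank_spec (K.χ c z)
  exact congrArg Sigma.fst (K.rep_unique _ _ _ _ hz' hz h)

theorem rank_χ_le {n : ℕ} (c : K.cell n) {z : M n} (hz : z ∈ s n) : K.rank (K.χ c z) ≤ n := by
  induction n using Nat.strong_induction_on with
  | _ n ih =>
  by_cases hb : z ∈ b n
  · obtain ⟨I, -, h2, h3⟩ := K.b_finite n c
    obtain ⟨i, hi, w, hw, h⟩ := h3 z hb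
    rw [← h]
    exact (ih i.1 (h2 i hi) i.2 hw).trans (h2 i hi).le
  · exact (K.rank_χ c ⟨hz, hb⟩).le

theorem rank_χ_lt {n : ℕ} (c : K.cell n) {z : M n} (hz : z ∈ b n) : K.rank (K.χ c z) < n := by
  obtain ⟨I, -, h2, h3⟩ := K.b_finite n c
  obtain ⟨i, hi, w, hw, h⟩ := h3 z hz
  rw [← h]
  exact (K.rank_χ_le i.2 hw).trans_lt (h2 i hi)

theorem continuous_of_χ {W : Type*} [TopologicalSpace W] {f : Y → W}
    (h : ∀ n (c : K.cell n), ContinuousOn (f ∘ K.χ c) (s n)) : Continuous f := by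
  rw [continuous_iff_isClosed]
  exact fun T hT => K.coherent _ fun n c => continuousOn_iff_isClosed.1 (h n c) T hT

variable {W Z : Type*} [TopologicalSpace W] [TopologicalSpace Z] {p : W → Z} {g : Y → Z}

/-- `f` is a lift of `g` on the cells of dimension less than `n`. -/
def IsPartialLift (p : W → Z) (g : Y → Z) (n : ℕ) (f : Y → W) : Prop :=
  (∀ y, K.rank y < n → p (f y) = g y) ∧ ∀ m < n, ∀ c : K.cell m, ContinuousOn (f ∘ K.χ c) (s m)

/-- The partial lift prescribes values on the boundary of every `n`-cell; the lifting property
extends them over the cell, and the extensions do not interfere because open cells are disjoint. -/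
theorem IsPartialLift.exists_succ [T2Space Y] (hs : ∀ n, IsCompact (s n)) (hsb : ∀ n, b n ⊆ s n)
    (hp : ∀ n, HasLift p (s n) (b n))
    (hg : Continuous g) {n : ℕ} {f : Y → W} (hf : K.IsPartialLift p g n f) :
    ∃ f' : Y → W, K.IsPartialLift p g (n + 1) f' ∧ ∀ y, K.rank y < n → f' y = f y := by
  classical
  -- The boundary is covered by finitely many lower cells. On each of them the preimage of a closed
  -- set is compact, so its image in `Y` is closed.
  have hcont : ∀ c : K.cell n, ContinuousOn (f ∘ K.χ c) (b n) := by
    intro c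
    rw [continuousOn_iff_isClosed]
    intro T hT
    obtain ⟨I, h1, h2, h3⟩ := K.b_finite n c
    have hcl : IsClosed (⋃ i ∈ I, K.χ i.2 '' ((f ∘ K.χ i.2) ⁻¹' T ∩ s i.1)) := by
      refine h1.isClosed_biUnion fun i hi => ?_
      obtain ⟨u, hu, hu'⟩ := continuousOn_iff_isClosed.1 (hf.2 i.1 (h2 i hi) i.2) T hT
      rw [hu', Set.inter_comm]
      exact (((hs i.1).inter_right hu).image_of_continuousOn
        ((K.continuousOn_χ i.2).mono Set.inter_subset_left)).isClosed
    obtain ⟨v, hv, hv'⟩ := continuousOn_iff_isClosed.1 ((K.continuousOn_χ c).mono (hsb n)) _ hcl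
    refine ⟨v, hv, ?_⟩
    rw [← hv']
    ext z
    simp only [Set.mem_inter_iff, Set.mem_preimage, Function.comp_apply, Set.mem_iUnion, Set.mem_image]
    constructor
    · rintro ⟨h, hz⟩
      obtain ⟨i, hi, w, hw, hwz⟩ := h3 z hz
      exact ⟨⟨i, hi, w, ⟨by rwa [hwz], hw⟩, hwz⟩, hz⟩
    · rintro ⟨⟨i, hi, w, ⟨h, hw⟩, hwz⟩, hz⟩
      exact ⟨by rwa [hwz] at h, hz⟩
  choose τ hτ1 hτ2 hτ3 using fun c : K.cell n => hp n (g ∘ K.χ c) (f ∘ K.χ c)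
    (hg.comp_continuousOn (K.continuousOn_χ c)) (hcont c) fun z hz => hf.1 _ (K.rank_χ_lt c hz)
  let f' : Y → W := fun y =>
    if h : ∃ (c : K.cell n) (z : M n), z ∈ s n \ b n ∧ K.χ c z = y then τ h.choose h.choose_spec.choose
    else f y
  have hf1 : ∀ (c : K.cell n), ∀ z ∈ s n \ b n, f' (K.χ c z) = τ c z := by
    intro c z hz
    have h : ∃ (c' : K.cell n) (z' : M n), z' ∈ s n \ b n ∧ K.χ c' z' = K.χ c z := ⟨c, z, hz, rfl⟩
    simp only [f', dif_pos h]
    have h' := K.rep_unique _ _ _ _ h.choose_spec.choose_spec.1 hz h.choose_spec.choose_spec.2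
    simp only [Sigma.mk.injEq, heq_eq_eq, true_and, Prod.mk.injEq] at h'
    exact congrArg (fun q : K.cell n × M n => τ q.1 q.2) (Prod.ext h'.1 h'.2 :
      ((h.choose, h.choose_spec.choose) : K.cell n × M n) = (c, z))
  have hf2 : ∀ y, K.rank y ≠ n → f' y = f y := by
    intro y hy
    refine dif_neg ?_
    rintro ⟨c, z, hz, rfl⟩
    exact hy (K.rank_χ c hz)
  have hf3 : ∀ c : K.cell n, ∀ z ∈ s n, f' (K.χ c z) = τ c z := by
    intro c z hz
    by_cases hb : z ∈ b n
    · rw [hτ2 c hb, hf2 _ (K.rank_χ_lt c hb).ne]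
      rfl
    · exact hf1 c z ⟨hz, hb⟩
  refine ⟨f', ⟨fun y hy => ?_, fun m hm c => ?_⟩, fun y hy => hf2 y hy.ne⟩
  · rcases Nat.lt_succ_iff_lt_or_eq.1 hy with h | h
    · rw [hf2 y h.ne, hf.1 y h]
    · obtain ⟨c, z, hz, hy'⟩ := K.rank_spec y
      revert c z
      rw [h]
      rintro c z hz rfl
      rw [hf3 c z hz.1]
      exact hτ3 c z hz.1
  · rcases Nat.lt_succ_iff_lt_or_eq.1 hm with h | rfl
    · exact (hf.2 m h c).congr fun z hz => hf2 _ ((K.rank_χ_le c hz).trans_lt h).ne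
    · exact (hτ1 c).congr fun z hz => hf3 c z hz

end

variable {W Z : Type*} [TopologicalSpace W] [TopologicalSpace Z] {p : W → Z} {g : Y → Z}

/-- Maps from a space with a cell structure lift along maps that have the lifting property for the
cells. -/
theorem exists_lift (K : CellStructure s b Y) [T2Space Y] [Nonempty W] (hs : ∀ n, IsCompact (s n)) (hsb : ∀ n, b n ⊆ s n)
    (hp : ∀ n, HasLift p (s n) (b n)) (hg : Continuous g) :
    ∃ f : Y → W, Continuous f ∧ ∀ y, p (f y) = g y := by
  choose! next h1 h2 using fun (n : ℕ) (f : Y → W) (hf : K.IsPartialLift p g n f) =>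
    IsPartialLift.exists_succ K hs hsb hp hg hf
  -- An arbitrary constant is a partial lift below dimension `0`, vacuously.
  let F : ℕ → Y → W := fun n => Nat.rec (fun _ => Classical.arbitrary W) (fun n f => next n f) n
  have hF : ∀ n, K.IsPartialLift p g n (F n) := by
    intro n
    induction n with
    | zero => exact ⟨fun y h => absurd h (Nat.not_lt_zero _), fun m h => absurd h (Nat.not_lt_zero _)⟩
    | succ n ih => exact h1 n _ ih
  have hF' : ∀ n y, K.rank y < n → F n y = F (K.rank y + 1) y := by
    intro n y h
    induction n with
    | zero => exact absurd h (Nat.not_lt_zero _)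
    | succ n ih =>
      rcases Nat.lt_succ_iff_lt_or_eq.1 h with h | h
      · exact (h2 n _ (hF n) y h).trans (ih h)
      · rw [h]
  -- The value at `y` is final once the cells of the dimension of `y` have been treated.
  refine ⟨fun y => F (K.rank y + 1) y, K.continuous_of_χ fun n c => ?_,
    fun y => (hF _).1 y (Nat.lt_succ_self _)⟩
  refine ((hF (n + 1)).2 n (Nat.lt_succ_self n) c).congr fun z hz => ?_
  exact (hF' (n + 1) _ (Nat.lt_succ_of_le (K.rank_χ_le c hz))).symm

end CellStructure

/-- Cell structures on CW complexes. -/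
noncomputable def CellStructure.ofCWComplex (Y : Type u) [TopologicalSpace Y] [T2Space Y]
    [Topology.CWComplex (Set.univ : Set Y)] :
    CellStructure (fun n => Metric.closedBall (0 : Fin n → ℝ) 1) (fun n => Metric.sphere 0 1) Y where
  cell := Topology.CWComplex.cell (Set.univ : Set Y)
  χ c := Topology.CWComplex.map _ c
  continuousOn_χ c := Topology.CWComplex.continuousOn _ c
  exists_rep y := by
    have h := Topology.CWComplex.iUnion_openCell_eq_complex (C := (Set.univ : Set Y))
    have hy := Set.mem_univ y
    rw [← h] at hy
    simp only [Set.mem_iUnion] at hy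
    obtain ⟨n, c, z, hz, h⟩ := hy
    exact ⟨n, c, z, by rwa [Metric.closedBall_sdiff_sphere], h⟩
  rep_unique {n n'} c c' z z' hz hz' h := by
    rw [Metric.closedBall_sdiff_sphere] at hz hz'
    by_cases hc : (⟨n, c⟩ : (n : ℕ) × Topology.CWComplex.cell (Set.univ : Set Y) n) = ⟨n', c'⟩
    · obtain ⟨rfl, hc⟩ := Sigma.mk.inj_iff.1 hc
      obtain rfl := eq_of_heq hc
      rw [(Topology.CWComplex.map n c).injOn (by rwa [Topology.CWComplex.source_eq])
        (by rwa [Topology.CWComplex.source_eq]) h]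
    · have := Topology.CWComplex.pairwiseDisjoint' (C := (Set.univ : Set Y)) (Set.mem_univ ⟨n, c⟩)
        (Set.mem_univ ⟨n', c'⟩) hc
      exact absurd ⟨z', hz', h.symm⟩ (Set.disjoint_left.1 this ⟨z, hz, rfl⟩)
  b_finite n c := by
    obtain ⟨I, hI⟩ := Topology.CWComplex.mapsTo n c
    refine ⟨{i | i.1 < n ∧ i.2 ∈ I i.1}, ?_, fun i hi => hi.1, fun z hz => ?_⟩
    · have : {i : (m : ℕ) × Topology.CWComplex.cell (Set.univ : Set Y) m | i.1 < n ∧ i.2 ∈ I i.1} =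
          ↑((Finset.range n).sigma I) := by
        ext i; simp
      rw [this]
      exact Finset.finite_toSet _
    · have := hI hz
      simp only [Set.mem_iUnion] at this
      obtain ⟨m, hm, j, hj, w, hw, h⟩ := this
      exact ⟨⟨m, j⟩, ⟨hm, hj⟩, w, hw, h⟩
  coherent S hS := by
    refine Topology.CWComplex.closed' (C := Set.univ) S (Set.subset_univ _) fun n c => ?_
    obtain ⟨u, hu, hu'⟩ := hS n c
    have : S ∩ Topology.CWComplex.map n c '' Metric.closedBall 0 1 =
        Topology.CWComplex.map n c '' (Metric.closedBall 0 1 ∩ u) := by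
      rw [Set.inter_comm _ u, ← hu']
      ext y
      constructor
      · rintro ⟨h, z, hz, rfl⟩
        exact ⟨z, ⟨h, hz⟩, rfl⟩
      · rintro ⟨z, ⟨h, hz⟩, rfl⟩
        exact ⟨h, z, hz, rfl⟩
    change IsClosed (S ∩ Topology.CWComplex.map n c '' Metric.closedBall 0 1)
    rw [this]
    exact (((isCompact_closedBall _ _).inter_right hu).image_of_continuousOn
      ((Topology.CWComplex.continuousOn n c).mono Set.inter_subset_left)).isClosed

/-! ### Extension of maps over discs -/

/-- Maps from spheres extend over discs. -/
def DiscExtension (X : Type*) [TopologicalSpace X] : Prop :=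
  ∀ (d : ℕ) (σ : C(Metric.sphere (0 : EuclideanSpace ℝ (Fin d)) 1, X)),
    ∃ τ : C(Metric.closedBall (0 : EuclideanSpace ℝ (Fin d)) 1, X),
      ∀ z : Metric.sphere (0 : EuclideanSpace ℝ (Fin d)) 1,
        τ ⟨z, Metric.sphere_subset_closedBall z.2⟩ = σ z

/-- The lifting property for discs and their boundary spheres. -/
def HasDiscLift {W Z : Type*} [TopologicalSpace W] [TopologicalSpace Z] (p : W → Z) : Prop :=
  ∀ d : ℕ, HasLift p (Metric.closedBall (0 : EuclideanSpace ℝ (Fin d)) 1) (Metric.sphere 0 1)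

/-- Neighbourhoods of the point at infinity have compact complements in `U`, whose images in the
Hausdorff space `K` are closed. -/
theorem Topology.IsOpenEmbedding.continuous_collapse {U K : Type*} [TopologicalSpace U] [TopologicalSpace K]
    [T2Space K] {i : U → K} (hi : Topology.IsOpenEmbedding i) {c : K → OnePoint U}
    (hc : ∀ u, c (i u) = u) (hc' : ∀ k, k ∉ Set.range i → c k = OnePoint.infty) : Continuous c := by
  refine ⟨fun W hW => ?_⟩
  by_cases h : OnePoint.infty ∈ W
  · rw [OnePoint.isOpen_iff_of_mem h] at hW
    have : c ⁻¹' W = (i '' ((↑) ⁻¹' W : Set U)ᶜ)ᶜ := by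
      ext k
      simp only [Set.mem_preimage, Set.mem_compl_iff, Set.mem_image, not_exists, not_and]
      constructor
      · rintro hk u hu rfl
        exact hu (hc u ▸ hk)
      · intro hk
        by_cases hr : k ∈ Set.range i
        · obtain ⟨u, rfl⟩ := hr
          rw [hc]
          by_contra hu
          exact hk u hu rfl
        · rwa [hc' k hr]
    rw [this, isOpen_compl_iff]
    exact (hW.2.image hi.continuous).isClosed
  · rw [OnePoint.isOpen_iff_of_notMem h] at hW
    have : c ⁻¹' W = i '' ((↑) ⁻¹' W : Set U) := by
      ext k
      simp only [Set.mem_preimage, Set.mem_image]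
      constructor
      · intro hk
        by_cases hr : k ∈ Set.range i
        · obtain ⟨u, rfl⟩ := hr
          exact ⟨u, hc u ▸ hk, rfl⟩
        · rw [hc' k hr] at hk
          exact absurd hk h
      · rintro ⟨u, hu, rfl⟩
        rwa [hc]
    rw [this]
    exact hi.isOpenMap _ hW

/-- The cube maps onto the sphere, with its boundary collapsed to a point. -/
theorem exists_cube_to_sphere (d : ℕ) : ∃ (r : C(Fin (d + 1) → unitInterval,
      Metric.sphere (0 : EuclideanSpace ℝ (Fin (d + 2))) 1)), Function.Surjective r ∧
    (∀ z z', r z = r z' →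
      z = z' ∨ (z ∈ Cube.boundary (Fin (d + 1)) ∧ z' ∈ Cube.boundary (Fin (d + 1)))) ∧
    ∀ z z', z ∈ Cube.boundary (Fin (d + 1)) → z' ∈ Cube.boundary (Fin (d + 1)) → r z = r z' := by
  classical
  -- The open cube is a copy of `ℝ^(d+1)`; collapsing its complement gives the one-point
  -- compactification, which is the sphere.
  let i : (Fin (d + 1) → ℝ) → (Fin (d + 1) → unitInterval) := Pi.map fun _ => unitInterval.sigmoid
  have hrange : Set.range i = (Cube.boundary (Fin (d + 1)))ᶜ := by
    rw [Set.range_piMap]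
    ext z
    simp only [unitInterval.range_sigmoid, Cube.boundary, Set.mem_pi, Set.mem_univ, true_implies,
      Set.mem_compl_iff, Set.mem_ofPred_eq, not_exists, not_or, Set.mem_Ioo]
    exact forall_congr' fun j => ⟨fun h => ⟨h.1.ne', h.2.ne⟩,
      fun h => ⟨lt_of_le_of_ne (z j).2.1 (Ne.symm h.1), lt_of_le_of_ne (z j).2.2 h.2⟩⟩
  have hsig : Topology.IsOpenEmbedding unitInterval.sigmoid :=
    ⟨Topology.isEmbedding_sigmoid, by rw [unitInterval.range_sigmoid]; exact isOpen_Ioo⟩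
  have hi : Topology.IsOpenEmbedding i := by
    refine ⟨.piMap fun _ => hsig.isEmbedding, ?_⟩
    rw [Set.range_piMap]
    exact isOpen_set_pi Set.finite_univ fun _ _ => hsig.isOpen_range
  let c : (Fin (d + 1) → unitInterval) → OnePoint (Fin (d + 1) → ℝ) := fun k =>
    if h : k ∈ Set.range i then (h.choose : OnePoint _) else OnePoint.infty
  have hc : ∀ u, c (i u) = u := fun u => by
    have h : i u ∈ Set.range i := ⟨u, rfl⟩
    simp only [c, dif_pos h]
    exact congrArg _ (hi.injective h.choose_spec)
  have hc' : ∀ k, k ∉ Set.range i → c k = OnePoint.infty := fun k hk => dif_neg hk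
  let f := onePointEquivSphereOfFinrankEq (ι := Fin (d + 2)) (V := Fin (d + 1) → ℝ) (by simp)
  have hb : ∀ z, z ∈ Cube.boundary (Fin (d + 1)) ↔ z ∉ Set.range i := fun z => by
    rw [hrange, Set.mem_compl_iff, not_not]
  refine ⟨⟨f ∘ c, f.continuous.comp (hi.continuous_collapse hc hc')⟩, ?_, ?_, ?_⟩
  · refine f.surjective.comp fun y => ?_
    induction y using OnePoint.rec with
    | infty => exact ⟨fun _ => 0, hc' _ ((hb _).1 ⟨0, Or.inl rfl⟩)⟩
    | coe u => exact ⟨i u, hc u⟩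
  · intro z z' h
    replace h : c z = c z' := f.injective h
    rw [hb, hb]
    by_cases hz : z ∈ Set.range i <;> by_cases hz' : z' ∈ Set.range i
    · obtain ⟨u, rfl⟩ := hz
      obtain ⟨u', rfl⟩ := hz'
      rw [hc, hc] at h
      exact Or.inl (congrArg i (OnePoint.coe_injective h))
    · obtain ⟨u, rfl⟩ := hz
      rw [hc, hc' _ hz'] at h
      exact absurd h (OnePoint.coe_ne_infty u)
    · obtain ⟨u, rfl⟩ := hz'
      rw [hc, hc' _ hz] at h
      exact absurd h (OnePoint.infty_ne_coe u)
    · exact Or.inr ⟨hz, hz'⟩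
  · intro z z' hz hz'
    rw [hb] at hz hz'
    change f (c z) = f (c z')
    rw [hc' _ hz, hc' _ hz']

/-- Precomposed with the collapse of the cube, `σ` is a based loop of dimension `d + 1`. A
null-homotopy relative to the boundary is constant on the fibres of the collapse and descends to the
sphere. -/
theorem nullhomotopic_of_homotopyGroup {X : Type*} [TopologicalSpace X] {d : ℕ}
    (h : ∀ x : X, Subsingleton (HomotopyGroup.Pi (d + 1) X x))
    (σ : C(Metric.sphere (0 : EuclideanSpace ℝ (Fin (d + 2))) 1, X)) : σ.Nullhomotopic := by
  obtain ⟨r, hr, hr1, hr2⟩ := exists_cube_to_sphere d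
  have h0 : (0 : Fin (d + 1) → unitInterval) ∈ Cube.boundary (Fin (d + 1)) := ⟨0, Or.inl rfl⟩
  let x := σ (r 0)
  let f : GenLoop (Fin (d + 1)) X x := ⟨σ.comp r, fun y hy => congrArg σ (hr2 y 0 hy h0)⟩
  obtain ⟨H⟩ : GenLoop.Homotopic f GenLoop.const := Quotient.exact ((h x).elim ⟦f⟧ ⟦GenLoop.const⟧)
  have : CompactSpace (Metric.sphere (0 : EuclideanSpace ℝ (Fin (d + 2))) 1) :=
    isCompact_iff_compactSpace.1 (isCompact_sphere _ _)
  let q : C(unitInterval × (Fin (d + 1) → unitInterval),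
    unitInterval × Metric.sphere (0 : EuclideanSpace ℝ (Fin (d + 2))) 1) := (ContinuousMap.id _).prodMap r
  have hquot : Topology.IsQuotientMap q :=
    .of_surjective_continuous (Function.surjective_id.prodMap hr) q.continuous
  have hcomp : ∀ p p', q p = q p' → H p = H p' := by
    rintro ⟨t, z⟩ ⟨t', z'⟩ hqq
    obtain rfl : t = t' := congrArg Prod.fst hqq
    obtain rfl | ⟨hz, hz'⟩ := hr1 z z' (congrArg Prod.snd hqq)
    · rfl
    · have h1 : ∀ z ∈ Cube.boundary (Fin (d + 1)), H (t, z) = x := fun z hz =>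
        (H.prop t z hz).trans (f.2 z hz)
      rw [h1 z hz, h1 z' hz']
  refine ⟨x, ⟨⟨hquot.lift H.toContinuousMap hcomp, fun y => ?_, fun y => ?_⟩⟩⟩
  · obtain ⟨z, rfl⟩ := hr y
    exact (DFunLike.congr_fun (hquot.lift_comp H.toContinuousMap hcomp) (0, z)).trans (H.apply_zero z)
  · obtain ⟨z, rfl⟩ := hr y
    exact (DFunLike.congr_fun (hquot.lift_comp H.toContinuousMap hcomp) (1, z)).trans (H.apply_one z)

/-- This sphere is finite, so one path for each of its points is enough. -/
theorem nullhomotopic_sphere_zero {X : Type*} [TopologicalSpace X] [PathConnectedSpace X]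
    (σ : C(Metric.sphere (0 : EuclideanSpace ℝ (Fin 1)) 1, X)) : σ.Nullhomotopic := by
  let f := onePointEquivSphereOfFinrankEq (ι := Fin 1) (V := Fin 0 → ℝ) (by simp)
  have : Finite (OnePoint (Fin 0 → ℝ)) := inferInstanceAs (Finite (Option (Fin 0 → ℝ)))
  have : Finite (Metric.sphere (0 : EuclideanSpace ℝ (Fin 1)) 1) := Finite.of_equiv _ f.toEquiv
  let x : X := Classical.choice PathConnectedSpace.nonempty
  let p := fun z => PathConnectedSpace.somePath (σ z) x
  refine ⟨x, ⟨⟨⟨fun z => p z.2 z.1, ?_⟩, fun z => (p z).source, fun z => (p z).target⟩⟩⟩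
  rw [continuous_prod_of_discrete_right]
  exact fun z => (p z).continuous

/-- The ball is the quotient of `[0,1] × S` under `(t, z) ↦ (1 - t) z`, and a null-homotopy is
constant on the only nontrivial fibre, at `t = 1`. In dimension `0` the sphere is empty and any
constant works. -/
theorem DiscExtension.of_nullhomotopic {X : Type*} [TopologicalSpace X] [Nonempty X]
    (h : ∀ (d : ℕ) (σ : C(Metric.sphere (0 : EuclideanSpace ℝ (Fin (d + 1))) 1, X)), σ.Nullhomotopic) :
    DiscExtension X := by
  intro d σ
  obtain _ | d := d
  · refine ⟨.const _ (Classical.arbitrary X), fun z => ?_⟩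
    have := z.2
    rw [Metric.mem_sphere, Subsingleton.elim (z : EuclideanSpace ℝ (Fin 0)) 0, dist_self] at this
    exact absurd this (by norm_num)
  · obtain ⟨x, ⟨H⟩⟩ := h d σ
    let S := Metric.sphere (0 : EuclideanSpace ℝ (Fin (d + 1))) 1
    let B := Metric.closedBall (0 : EuclideanSpace ℝ (Fin (d + 1))) 1
    have hS : ∀ z : S, ‖(z : EuclideanSpace ℝ (Fin (d + 1)))‖ = 1 := fun z => mem_sphere_zero_iff_norm.1 z.2
    have : CompactSpace S := isCompact_iff_compactSpace.1 (isCompact_sphere _ _)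
    let q : C(unitInterval × S, B) := ⟨fun p => ⟨(1 - (p.1 : ℝ)) • (p.2 : EuclideanSpace ℝ (Fin (d + 1))), by
      rw [mem_closedBall_zero_iff, norm_smul, hS, mul_one, Real.norm_eq_abs, abs_of_nonneg]
      · linarith [p.1.2.1]
      · linarith [p.1.2.2]⟩, by fun_prop⟩
    have hq : ∀ p, ‖(q p : EuclideanSpace ℝ (Fin (d + 1)))‖ = 1 - p.1 := by
      intro p
      change ‖(1 - (p.1 : ℝ)) • (p.2 : EuclideanSpace ℝ (Fin (d + 1)))‖ = _
      rw [norm_smul, hS, mul_one, Real.norm_eq_abs, abs_of_nonneg]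
      linarith [p.1.2.2]
    have hsurj : Function.Surjective q := by
      rintro ⟨y, hy⟩
      rw [mem_closedBall_zero_iff] at hy
      by_cases h0 : y = 0
      · obtain ⟨z, hz⟩ := NormedSpace.sphere_nonempty (x := (0 : EuclideanSpace ℝ (Fin (d + 1)))) (r := 1) |>.2 zero_le_one
        refine ⟨(1, ⟨z, hz⟩), Subtype.ext ?_⟩
        change (1 - (1 : ℝ)) • z = y
        rw [h0, sub_self, zero_smul]
      · refine ⟨(⟨1 - ‖y‖, by linarith, by linarith [norm_nonneg y]⟩, ⟨‖y‖⁻¹ • y, ?_⟩), Subtype.ext ?_⟩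
        · rw [mem_sphere_zero_iff_norm, norm_smul, norm_inv, norm_norm, inv_mul_cancel₀ (norm_ne_zero_iff.2 h0)]
        · change (1 - (1 - ‖y‖)) • (‖y‖⁻¹ • y) = y
          rw [sub_sub_cancel, smul_smul, mul_inv_cancel₀ (norm_ne_zero_iff.2 h0), one_smul]
    have hquot : Topology.IsQuotientMap q := .of_surjective_continuous hsurj q.continuous
    have hcomp : ∀ p p', q p = q p' → H p = H p' := by
      rintro ⟨t, z⟩ ⟨t', z'⟩ hqq
      have h1 : t = t' := by
        have h2 := hq (t, z)
        rw [hqq, hq] at h2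
        exact Subtype.ext (by simpa using h2.symm)
      subst h1
      by_cases ht : t = 1
      · subst ht
        exact (H.apply_one z).trans (H.apply_one z').symm
      · have h2 : (1 - (t : ℝ)) • (z : EuclideanSpace ℝ (Fin (d + 1))) = (1 - (t : ℝ)) • z' := congrArg Subtype.val hqq
        have h3 : (1 - (t : ℝ)) ≠ 0 := fun h => ht (Subtype.ext (by rw [Set.Icc.coe_one]; linarith))
        rw [Subtype.ext (smul_right_injective _ h3 h2)]
    refine ⟨hquot.lift H.toContinuousMap hcomp, fun z => ?_⟩
    have h4 : (⟨z, Metric.sphere_subset_closedBall z.2⟩ : B) = q (0, z) := by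
      refine Subtype.ext ?_
      change (z : EuclideanSpace ℝ (Fin (d + 1))) = (1 - (0 : ℝ)) • (z : EuclideanSpace ℝ (Fin (d + 1)))
      rw [sub_zero, one_smul]
    rw [h4]
    exact (DFunLike.congr_fun (hquot.lift_comp H.toContinuousMap hcomp) (0, z)).trans (H.apply_zero z)

theorem DiscExtension.of_contractible (X : Type*) [TopologicalSpace X] [ContractibleSpace X] :
    DiscExtension X := by
  have : Nonempty X := (ContractibleSpace.hequiv_unit X).elim fun e => ⟨e.invFun ()⟩
  refine .of_nullhomotopic fun _ σ => ?_
  simpa using (id_nullhomotopic X).comp_left σ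

theorem DiscExtension.of_homotopyGroup {X : Type*} [TopologicalSpace X] [PathConnectedSpace X]
    (h : ∀ d (x : X), Subsingleton (HomotopyGroup.Pi (d + 1) X x)) : DiscExtension X := by
  have : Nonempty X := PathConnectedSpace.nonempty
  refine .of_nullhomotopic fun d σ => ?_
  obtain _ | d := d
  · exact nullhomotopic_sphere_zero σ
  · exact nullhomotopic_of_homotopyGroup (h d) σ

/-- The first coordinate of the lift is forced; only the second has to be extended from the sphere.
-/
theorem HasDiscLift.fst {A F : Type*} [TopologicalSpace A] [TopologicalSpace F] (hF : DiscExtension F) :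
    HasDiscLift (Prod.fst : A × F → A) := by
  classical
  intro d χ σ hχ hσ hp
  obtain ⟨τ, hτ⟩ := hF d ⟨fun z => (σ z).2, (continuousOn_iff_continuous_domRestrict.1 hσ).snd⟩
  have hne : Nonempty F := ⟨τ ⟨0, by simp⟩⟩
  let τ' : EuclideanSpace ℝ (Fin d) → F := fun z =>
    if h : z ∈ Metric.closedBall 0 1 then τ ⟨z, h⟩ else Classical.arbitrary F
  have hτ' : ContinuousOn τ' (Metric.closedBall 0 1) := by
    rw [continuousOn_iff_continuous_domRestrict]
    refine τ.continuous.congr fun z => ?_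
    simp only [τ', Set.domRestrict_apply, z.2, dif_pos]
  refine ⟨fun z => (χ z, τ' z), hχ.prodMk hτ', fun z hz => Prod.ext (hp z hz).symm ?_, fun _ _ => rfl⟩
  have h := Metric.sphere_subset_closedBall hz
  simp only [τ', dif_pos h]
  exact hτ ⟨z, hz⟩

/-- Discs can be replaced by convex bodies. -/
theorem HasDiscLift.convexBody {W Z : Type*} [TopologicalSpace W] [TopologicalSpace Z] {p : W → Z}
    (hp : HasDiscLift p) {V : Type*} [NormedAddCommGroup V] [NormedSpace ℝ V] [FiniteDimensional ℝ V]
    {s : Set V} (hs : Convex ℝ s) (hc : IsCompact s) (hi : (interior s).Nonempty) :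
    HasLift p s (frontier s) := by
  let L := toEuclidean (E := V)
  obtain ⟨e, -, h2, h3⟩ := exists_homeomorph_image_interior_closure_frontier_eq_unitBall
    (s := L '' s) (hs.linear_image L.toLinearMap)
    (by rw [show interior (L '' s) = L '' interior s from (L.toHomeomorph.image_interior s).symm]; exact hi.image _) (hc.image L.continuous).isBounded
  rw [(hc.image L.continuous).isClosed.closure_eq] at h2
  have h4 : frontier (L '' s) = L '' frontier s := (L.toHomeomorph.image_frontier s).symm
  rw [h4] at h3
  have hb := hc.isClosed.frontier_subset
  let f := L.toHomeomorph.trans e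
  have h2' : f '' s = Metric.closedBall 0 1 := by rw [← h2, Set.image_image]; rfl
  have h3' : f '' frontier s = Metric.sphere 0 1 := by rw [← h3, Set.image_image]; rfl
  refine (hp _).of_equiv Metric.sphere_subset_closedBall hb f.symm.continuous.continuousOn
    f.continuous.continuousOn ?_ ?_ ?_ ?_ fun z _ => f.symm_apply_apply z
  · rw [← h2']; rintro _ ⟨z, hz, rfl⟩; simpa using hz
  · rw [← h2']; exact Set.mapsTo_image _ _
  · rw [← h3']; rintro _ ⟨z, hz, rfl⟩; simpa using hz
  · rw [← h3']; exact Set.mapsTo_image _ _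

/-- The cells of a CW complex are modelled on balls of the maximum norm, which are convex bodies but
not Euclidean balls. -/
theorem HasDiscLift.cube {W Z : Type*} [TopologicalSpace W] [TopologicalSpace Z] {p : W → Z}
    (hp : HasDiscLift p) (n : ℕ) : HasLift p (Metric.closedBall (0 : Fin n → ℝ) 1) (Metric.sphere 0 1) := by
  rw [← frontier_closedBall _ one_ne_zero]
  refine hp.convexBody (convex_closedBall _ _) (isCompact_closedBall _ _) ?_
  rw [interior_closedBall _ one_ne_zero]
  exact ⟨0, by simp⟩

/-! ### Cells of `|EG| / G` -/

theorem HasLift.subtype {W Z M : Type*} [TopologicalSpace W] [TopologicalSpace Z] [TopologicalSpace M]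
    {p : W → Z} {s b : Set M} (h : HasLift p s b) (hb : b ⊆ s) :
    HasLift p (Set.univ : Set s) (Subtype.val ⁻¹' b) := by
  classical
  rcases s.eq_empty_or_nonempty with rfl | ⟨z₀, hz₀⟩
  · exact fun _ σ _ _ _ => ⟨σ, continuous_of_discreteTopology.continuousOn, fun _ _ => rfl,
      fun z => z.2.elim⟩
  · let r : M → s := fun z => if hz : z ∈ s then ⟨z, hz⟩ else ⟨z₀, hz₀⟩
    have hr : ∀ z (hz : z ∈ s), r z = ⟨z, hz⟩ := fun z hz => dif_pos hz
    have hrc : ContinuousOn r s := by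
      rw [continuousOn_iff_continuous_domRestrict]
      exact continuous_id.congr fun z => (hr z z.2).symm
    refine h.of_equiv hb (Set.subset_univ _) (f := r) (g := Subtype.val) hrc
      continuous_subtype_val.continuousOn (Set.mapsTo_univ _ _) (fun z _ => z.2) (fun z hz => ?_)
      (fun z hz => hz) fun z _ => hr z z.2
    rwa [hr z (hb hz), Set.mem_preimage]

/-- The lifting property for simplices. -/
theorem HasDiscLift.simplex {W Z : Type*} [TopologicalSpace W] [TopologicalSpace Z] {p : W → Z}
    (hp : HasDiscLift p) (n : ℕ) :
    HasLift p (Set.univ : Set (stdSimplex ℝ (Fin (n + 1)))) {t | ∃ j, t j = 0} := by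
  -- Dropping coordinate `0` turns the simplex into a convex body with interior points; `F` restores
  -- that coordinate.
  let s : Set (Fin n → ℝ) := {x | (∀ i, 0 ≤ x i) ∧ ∑ i, x i ≤ 1}
  let F : (Fin n → ℝ) → Fin (n + 1) → ℝ := fun x => Fin.cons (1 - ∑ i, x i) x
  have hFc : Continuous F := continuous_pi fun j => by
    refine Fin.cases ?_ (fun j => ?_) j
    · simp only [F, Fin.cons_zero]; fun_prop
    · simp only [F, Fin.cons_succ]; fun_prop
  have hFs : ∀ x, x ∈ s ↔ ∀ j, 0 ≤ F x j := by
    intro x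
    rw [Fin.forall_fin_succ]
    simp only [F, Fin.cons_zero, Fin.cons_succ, s, Set.mem_ofPred_eq, sub_nonneg, and_comm]
  have hFsum : ∀ x, ∑ j, F x j = 1 := fun x => by simp [F, Fin.sum_univ_succ]
  have hFsimplex : ∀ x ∈ s, F x ∈ stdSimplex ℝ (Fin (n + 1)) := fun x hx => ⟨(hFs x).1 hx, hFsum x⟩
  have hGF : ∀ t ∈ stdSimplex ℝ (Fin (n + 1)), F (Fin.tail t) = t := by
    rintro t ⟨-, ht⟩
    rw [Fin.sum_univ_succ] at ht
    have : 1 - ∑ i : Fin n, Fin.tail t i = t 0 := by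
      change 1 - ∑ i : Fin n, t i.succ = t 0
      linarith
    simp only [F, this]
    exact Fin.cons_self_tail t
  have hclosed : IsClosed s := by
    have : s = ⋂ j, {x | 0 ≤ F x j} := by ext x; simp only [hFs, Set.mem_iInter, Set.mem_ofPred_eq]
    rw [this]
    exact isClosed_iInter fun j => isClosed_le continuous_const ((continuous_apply j).comp hFc)
  have hcompact : IsCompact s := by
    have h1 : s = Fin.tail '' stdSimplex ℝ (Fin (n + 1)) := by
      ext x
      constructor
      · exact fun hx => ⟨F x, hFsimplex x hx, Fin.tail_cons _ _⟩
      · rintro ⟨t, ht, rfl⟩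
        rw [hFs, hGF t ht]
        exact ht.1
    rw [h1]
    exact (isCompact_stdSimplex ℝ _).image (continuous_pi fun i => continuous_apply i.succ)
  have hconv : Convex ℝ s := by
    intro x hx y hy a b ha hb hab
    refine ⟨fun i => ?_, ?_⟩
    · have := hx.1 i; have := hy.1 i
      simp only [Pi.add_apply, Pi.smul_apply, smul_eq_mul]
      positivity
    · simp only [Pi.add_apply, Pi.smul_apply, smul_eq_mul, Finset.sum_add_distrib, ← Finset.mul_sum]
      nlinarith [hx.2, hy.2]
  have hopen : {x | ∀ j, 0 < F x j} ⊆ interior s := by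
    refine interior_maximal (fun x hx => (hFs x).2 fun j => (hx j).le) ?_
    have : {x | ∀ j, 0 < F x j} = ⋂ j, {x | 0 < F x j} := by ext x; simp
    rw [this]
    exact isOpen_iInter_of_finite fun j => isOpen_lt continuous_const ((continuous_apply j).comp hFc)
  -- The barycentre.
  let c : Fin n → ℝ := fun _ => 1 / (n + 1)
  have hn : (0 : ℝ) < n + 1 := by positivity
  have hc : ∀ j, F c j = 1 / (n + 1) := by
    intro j
    refine Fin.cases ?_ (fun j => ?_) j
    · simp only [F, Fin.cons_zero, c, Finset.sum_const, Finset.card_univ, Fintype.card_fin, nsmul_eq_mul]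
      field_simp
      ring
    · simp [F, c]
  -- An interior point can be pushed slightly away from the barycentre inside `s`; a vanishing
  -- coordinate would then become negative.
  have hint : ∀ x ∈ interior s, ∀ j, 0 < F x j := by
    intro x hx j
    have hxs := interior_subset hx
    refine lt_of_le_of_ne ((hFs x).1 hxs j) fun h0 => ?_
    have hcont : Filter.Tendsto (fun ε : ℝ => x + ε • (x - c)) (𝓝 0) (𝓝 x) := by
      have : Continuous fun ε : ℝ => x + ε • (x - c) := by fun_prop
      simpa using this.tendsto 0
    have hev : ∀ᶠ ε in 𝓝[>] (0 : ℝ), x + ε • (x - c) ∈ s :=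
      (hcont.eventually (mem_interior_iff_mem_nhds.1 hx)).filter_mono nhdsWithin_le_nhds
    obtain ⟨ε, h1, h2⟩ := (hev.and self_mem_nhdsWithin).exists
    have h3 : F (x + ε • (x - c)) j = F x j + ε * (F x j - F c j) := by
      refine Fin.cases ?_ (fun j => ?_) j
      · simp only [F, Fin.cons_zero, Pi.add_apply, Pi.smul_apply, Pi.sub_apply, smul_eq_mul,
          Finset.sum_add_distrib, ← Finset.mul_sum, Finset.sum_sub_distrib]
        ring
      · simp [F]
    have h4 := (hFs _).1 h1 j
    rw [h3, ← h0, hc] at h4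
    have : 0 < ε * (1 / (n + 1)) := mul_pos h2 (by positivity)
    linarith
  have hfr : ∀ x, x ∈ frontier s ↔ x ∈ s ∧ ∃ j, F x j = 0 := by
    intro x
    rw [frontier, hclosed.closure_eq, Set.mem_sdiff]
    refine and_congr_right fun hx => ⟨fun h => ?_, fun ⟨j, hj⟩ h => (hint x h j).ne' hj⟩
    by_contra! h0
    exact h (hopen fun j => lt_of_le_of_ne ((hFs x).1 hx j) (h0 j).symm)
  have h1 : HasLift p s (frontier s) := hp.convexBody hconv hcompact
    ⟨c, hopen fun j => by rw [hc]; positivity⟩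
  have h2 : HasLift p (stdSimplex ℝ (Fin (n + 1))) {t | t ∈ stdSimplex ℝ (Fin (n + 1)) ∧ ∃ j, t j = 0} := by
    refine h1.of_equiv hclosed.frontier_subset (fun t ht => ht.1) hFc.continuousOn
      (g := Fin.tail) (continuous_pi fun i => continuous_apply i.succ).continuousOn
      (fun x hx => hFsimplex x hx) (fun t ht => (hFs _).2 fun j => by rw [hGF t ht]; exact ht.1 j)
      (fun x hx => ?_) (fun t ht => ?_) hGF
    · rw [hfr] at hx
      exact ⟨hFsimplex x hx.1, hx.2⟩
    · rw [hfr, hFs, hGF t ht.1]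
      exact ⟨ht.1.1, ht.2⟩
  convert h2.subtype fun t ht => ht.1 using 1
  ext t
  exact ⟨fun h => ⟨t.2, h⟩, fun h => h.2⟩

/-! ### Reduced words as normal forms -/

namespace ESpace

variable {G : Type u}

/-- Words without repeated consecutive letters. -/
def IsReduced {n : ℕ} (a : Fin (n + 1) → G) : Prop := ∀ i : Fin n, a i.castSucc ≠ a i.succ

/-- Delete one of two equal neighbouring letters; the degeneracy `predAbove` restores it. -/
theorem exists_isReduced {n : ℕ} (a : Fin (n + 1) → G) : ∃ m, ∃ (b : Fin (m + 1) → G)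
    (θ : Fin (n + 1) → Fin (m + 1)), IsReduced b ∧ Monotone θ ∧ Function.Surjective θ ∧ a = b ∘ θ := by
  induction n with
  | zero => exact ⟨0, a, id, fun i => i.elim0, monotone_id, Function.surjective_id, rfl⟩
  | succ n ih =>
    by_cases h : IsReduced a
    · exact ⟨n + 1, a, id, h, monotone_id, Function.surjective_id, rfl⟩
    · simp only [IsReduced, not_forall, not_not] at h
      obtain ⟨i, hi⟩ := h
      obtain ⟨m, b, θ, h1, h2, h3, h4⟩ := ih (a ∘ i.succ.succAbove)
      refine ⟨m, b, θ ∘ i.predAbove, h1, h2.comp (Fin.predAbove_right_monotone i),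
        h3.comp (Fin.predAbove_surjective i), ?_⟩
      rw [← Function.comp_assoc, ← h4]
      funext j
      simp only [Function.comp_apply]
      by_cases hj : j = i.succ
      · subst hj
        rw [Fin.predAbove_succ_self, Fin.succAbove_of_castSucc_lt _ _ (Fin.castSucc_lt_succ), hi]
      · rw [Fin.succ_succAbove_predAbove hj]

/-- An index is attained exactly when its interval has positive length. -/
theorem surjective_stepIdx_iff {n : ℕ} (t : stdSimplex ℝ (Fin (n + 1))) :
    Function.Surjective (stepIdx t) ↔ ∀ j, t j ≠ 0 := by
  refine ⟨fun h j hj => ?_, fun h j => ?_⟩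
  · obtain ⟨s, hs⟩ := h j
    have h1 := (le_stepIdx_iff t s j).1 (by rw [hs])
    have h2 := (stepIdx_lt_iff t s (j + 1)).1 (by rw [hs]; omega)
    rw [stepCum_succ, hj, add_zero] at h2
    exact h2.not_ge h1
  · have h1 := h j
    rw [← stepPush_stepIdx t, stepPush_apply] at h1
    obtain ⟨s, hs⟩ := MeasureTheory.nonempty_of_measureReal_ne_zero h1
    exact ⟨s, hs⟩

/-- A reduced word changes its letter when the index first grows beyond `ρ s`, at some `z` between
`s` and `s'`. The other word has the same values, so its index must grow there as well. -/
theorem IsReduced.lt_of_lt {n L : ℕ} {b : Fin (n + 1) → G} (hb : IsReduced b)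
    {ρ : StepDomain → Fin (n + 1)} (hρ : Monotone ρ) (hs : Function.Surjective ρ) {c : Fin L → G}
    {ρ' : StepDomain → Fin L} (hρ' : Monotone ρ') (h : b ∘ ρ = c ∘ ρ') {s s' : StepDomain}
    (hss : ρ s < ρ s') : ρ' s < ρ' s' := by
  have hlt : s < s' := lt_of_not_ge fun h => (hρ h).not_gt hss
  refine lt_of_le_of_ne (hρ' hlt.le) fun heq => ?_
  have hn : (ρ s : ℕ) < n := by have := (ρ s').2; have : (ρ s : ℕ) < ρ s' := hss; omega
  let i : Fin n := ⟨ρ s, hn⟩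
  have hi : i.castSucc = ρ s := rfl
  have hi' : i.succ ≤ ρ s' := hss
  obtain ⟨z, hz, hz1, hz2⟩ : ∃ z, ρ z = i.succ ∧ s ≤ z ∧ z ≤ s' := by
    obtain ⟨z, hz⟩ := hs i.succ
    have hsz : s ≤ z := le_of_not_ge fun h => by
      have := hρ h
      rw [hz, ← hi] at this
      exact this.not_gt Fin.castSucc_lt_succ
    rcases le_total z s' with h1 | h1
    · exact ⟨z, hz, hsz, h1⟩
    · exact ⟨s', le_antisymm (hz ▸ hρ h1) hi', hlt.le, le_rfl⟩
  have h1 : ρ' z = ρ' s := le_antisymm (heq ▸ hρ' hz2) (hρ' hz1)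
  apply hb i
  rw [hi, ← hz]
  have h2 := congrFun h s
  have h3 := congrFun h z
  simp only [Function.comp_apply] at h2 h3
  rw [h2, h3, h1]

/-- By `IsReduced.lt_of_lt` in both directions, the two index maps order the points of the interval
in the same way. They differ by an isomorphism of finite chains, which is the identity. -/
theorem IsReduced.unique {n n' : ℕ} {b : Fin (n + 1) → G} {b' : Fin (n' + 1) → G} (hb : IsReduced b)
    (hb' : IsReduced b') {t : stdSimplex ℝ (Fin (n + 1))} {t' : stdSimplex ℝ (Fin (n' + 1))}
    (ht : ∀ j, t j ≠ 0) (ht' : ∀ j, t' j ≠ 0) (h : mk b t = mk b' t') :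
    (⟨n, b, t⟩ : (n : ℕ) × (Fin (n + 1) → G) × stdSimplex ℝ (Fin (n + 1))) = ⟨n', b', t'⟩ := by
  rw [← surjective_stepIdx_iff] at ht ht'
  have hv : b ∘ stepIdx t = b' ∘ stepIdx t' := by
    funext s
    have := congrArg (fun x => val x s) h
    simpa only [val_mk, Function.comp_apply] using this
  have hm := (isStep_stepIdx t).mono
  have hm' := (isStep_stepIdx t').mono
  let g := Function.surjInv ht
  have hg : ∀ i, stepIdx t (g i) = i := Function.surjInv_eq ht
  have hlt : ∀ s s', stepIdx t s < stepIdx t s' ↔ stepIdx t' s < stepIdx t' s' := fun s s' =>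
    ⟨hb.lt_of_lt hm ht hm' hv, hb'.lt_of_lt hm' ht' hm hv.symm⟩
  have heq : ∀ s s', stepIdx t s = stepIdx t s' ↔ stepIdx t' s = stepIdx t' s' := fun s s' => by
    rw [eq_iff_le_not_lt, eq_iff_le_not_lt, ← not_lt, ← not_lt, hlt, hlt]
  let f : Fin (n + 1) → Fin (n' + 1) := fun i => stepIdx t' (g i)
  have hf : ∀ s, f (stepIdx t s) = stepIdx t' s := fun s => (heq _ _).1 (hg _)
  have hfmono : StrictMono f := fun i j hij => (hlt _ _).1 (by rwa [hg, hg])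
  have hfsurj : Function.Surjective f := fun j => by
    obtain ⟨s, rfl⟩ := ht' j
    exact ⟨_, hf s⟩
  obtain rfl : n = n' := by
    have := Fintype.card_of_bijective ⟨hfmono.injective, hfsurj⟩
    simpa using this
  have hfid : f = id := by
    let e := StrictMono.orderIsoOfSurjective f hfmono hfsurj
    have : e = OrderIso.refl _ := Subsingleton.elim _ _
    funext i
    exact congrArg (fun e : Fin (n + 1) ≃o Fin (n + 1) => e i) this
  have hidx : stepIdx t = stepIdx t' := funext fun s => by rw [← hf s, hfid, id]
  have htt : t = t' := by
    rw [← stepPush_stepIdx t, ← stepPush_stepIdx t']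
    congr 1
  subst htt
  have : b = b' := funext fun j => by
    obtain ⟨s, rfl⟩ := ht j
    exact congrFun hv s
  rw [this]

theorem exists_isReduced_mk (x : ESpace G) : ∃ (n : ℕ) (b : Fin (n + 1) → G)
    (t : stdSimplex ℝ (Fin (n + 1))), IsReduced b ∧ (∀ j, t j ≠ 0) ∧ mk b t = x := by
  obtain ⟨l, a, t, rfl, ht, -⟩ := exists_minimal x
  obtain ⟨m, b, θ, h1, h2, h3, rfl⟩ := exists_isReduced a
  refine ⟨m, b, stdSimplex.map θ t, h1, ?_, (mk_comp h2 b t).symm⟩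
  rw [← surjective_stepIdx_iff, stepIdx_map t h2]
  exact h3.comp ht

variable [Group G]

theorem IsReduced.smul {n : ℕ} {b : Fin (n + 1) → G} (hb : IsReduced b) (g : G) :
    IsReduced fun i => g * b i := fun i h => hb i (mul_left_cancel h)

/-- The cells of `|EG| / G`: reduced words starting with `1`. -/
def Cell (G : Type u) [Group G] (n : ℕ) : Type u :=
  {a : Fin (n + 1) → G // a 0 = 1 ∧ IsReduced a}

/-- Multiplication by the inverse of the first letter selects one word in each orbit. -/
theorem exists_cell {n : ℕ} {b : Fin (n + 1) → G} (hb : IsReduced b) (t : stdSimplex ℝ (Fin (n + 1))) :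
    ∃ c : Cell G n, c.1 = (fun i => (b 0)⁻¹ * b i) ∧
      Quotient.mk (MulAction.orbitRel G (ESpace G)) (mk c.1 t) = Quotient.mk _ (mk b t) := by
  refine ⟨⟨fun i => (b 0)⁻¹ * b i, inv_mul_cancel _, hb.smul _⟩, rfl, ?_⟩
  exact Quotient.sound (s := MulAction.orbitRel G (ESpace G)) ⟨(b 0)⁻¹, smul_mk _ _ _⟩

/-- The cell structure of `|EG| / G`. -/
def cellStructure (G : Type u) [Group G] :
    CellStructure (fun n => (Set.univ : Set (stdSimplex ℝ (Fin (n + 1))))) (fun n => {t | ∃ j, t j = 0})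
      (Quotient (MulAction.orbitRel G (ESpace G))) where
  cell := Cell G
  χ c t := Quotient.mk _ (mk c.1 t)
  continuousOn_χ c := (continuous_quot_mk.comp (continuous_mk c.1)).continuousOn
  exists_rep y := by
    induction y using Quotient.ind with | _ x =>
    obtain ⟨n, b, t, hb, ht, rfl⟩ := exists_isReduced_mk x
    obtain ⟨c, -, hc⟩ := exists_cell hb t
    exact ⟨n, c, t, ⟨trivial, fun ⟨j, hj⟩ => ht j hj⟩, hc⟩
  rep_unique {n n'} c c' t t' ht ht' h := by
    obtain ⟨g, hg⟩ := Quotient.exact h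
    have hpos : ∀ j, t j ≠ 0 := fun j hj => ht.2 ⟨j, hj⟩
    have hpos' : ∀ j, t' j ≠ 0 := fun j hj => ht'.2 ⟨j, hj⟩
    have h1 : mk (fun i => g * c'.1 i) t' = mk c.1 t := (smul_mk g c'.1 t').symm.trans hg
    have h2 := (c'.2.2.smul g).unique c.2.2 hpos' hpos h1
    obtain ⟨c, h0, hc⟩ := c
    obtain ⟨c', h0', hc'⟩ := c'
    obtain rfl : n' = n := congrArg Sigma.fst h2
    simp only [Sigma.mk.injEq, heq_eq_eq, true_and, Prod.mk.injEq] at h2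
    obtain ⟨h3, rfl⟩ := h2
    -- Both words start with `1`.
    obtain rfl : g = 1 := by
      have := congrFun h3 0
      rwa [h0, h0', mul_one] at this
    simp only [one_mul] at h3
    subst h3
    rfl
  b_finite n c := by
    -- A boundary point lies in the cell of a shorter word read off from `c` along some `θ` and
    -- normalized to start with `1`; there are finitely many candidates.
    let Θ := (m : Fin n) × (Fin ((m : ℕ) + 1) → Fin (n + 1))
    let w : Θ → Set ((n : ℕ) × Cell G n) := fun θ => {i | i.1 = θ.1 ∧
      ∀ (h : i.1 = θ.1), i.2.1 = fun j => (c.1 (θ.2 0))⁻¹ * c.1 (θ.2 (Fin.cast (by rw [h]) j))}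
    refine ⟨⋃ θ, w θ, ?_, ?_, ?_⟩
    · refine Set.finite_iUnion fun θ => Set.Subsingleton.finite ?_
      rintro ⟨p, c₁⟩ ⟨h1, h2⟩ ⟨q, c₂⟩ ⟨h3, h4⟩
      dsimp only at h1 h2 h3 h4
      subst h1
      subst h3
      obtain rfl : c₁ = c₂ := Subtype.ext ((h2 rfl).trans (h4 rfl).symm)
      rfl
    · simp only [Set.mem_iUnion]
      rintro i ⟨θ, h, -⟩
      rw [h]
      exact θ.1.2
    · rintro t ⟨j, hj⟩
      obtain ⟨m, b, t', hb, ht', hbt⟩ := exists_isReduced_mk (mk c.1 t)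
      rw [← surjective_stepIdx_iff] at ht'
      have hv : b ∘ stepIdx t' = c.1 ∘ stepIdx t := by
        funext s
        have := congrArg (fun x => val x s) hbt
        simpa only [val_mk, Function.comp_apply] using this
      have hg : ∀ i, stepIdx t' (Function.surjInv ht' i) = i := Function.surjInv_eq ht'
      let θ : Fin (m + 1) → Fin (n + 1) := fun i => stepIdx t (Function.surjInv ht' i)
      have hθ : StrictMono θ := fun i i' hi => hb.lt_of_lt (isStep_stepIdx t').mono ht'
        (isStep_stepIdx t).mono hv (by rwa [hg, hg])
      have hθj : ∀ i, θ i ≠ j := fun i hi => by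
        have h1 := (le_stepIdx_iff t (Function.surjInv ht' i) j).1 (by rw [← hi])
        have h2 := (stepIdx_lt_iff t (Function.surjInv ht' i) (j + 1)).1 (by rw [← hi]; exact Nat.lt_succ_self _)
        rw [stepCum_succ, hj, add_zero] at h2
        exact h2.not_ge h1
      have hm : m < n := by
        have h1 := Fintype.card_lt_of_injective_of_notMem θ hθ.injective (b := j)
          (by rintro ⟨i, hi⟩; exact hθj i hi)
        simpa using h1
      have hbθ : b = c.1 ∘ θ := funext fun i => by
        have := congrFun hv (Function.surjInv ht' i)
        rw [Function.comp_apply, hg] at this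
        exact this
      obtain ⟨c', hc', h⟩ := exists_cell hb t'
      refine ⟨⟨m, c'⟩, Set.mem_iUnion.2 ⟨⟨⟨m, hm⟩, θ⟩, rfl, fun _ => ?_⟩, t', trivial, ?_⟩
      · rw [hc', hbθ]
        rfl
      · rw [← hbt]
        exact h
  coherent S hS := by
    refine isQuotientMap_quot_mk.isClosed_preimage.1 (isClosed_iff.2 ?_)
    intro l a
    -- Every simplex is a degeneracy of a reduced one, and in the orbit space a reduced simplex
    -- coincides with a cell.
    obtain ⟨m, b, θ, hb, hθ, -, rfl⟩ := exists_isReduced a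
    obtain ⟨u, hu, hu'⟩ := hS m (exists_cell hb (stdSimplex.vertex 0)).choose
    have key : ∀ t, Quotient.mk (MulAction.orbitRel G (ESpace G))
        (mk (exists_cell hb (stdSimplex.vertex 0)).choose.1 t) = Quotient.mk _ (mk b t) := fun t => by
      rw [(exists_cell hb (stdSimplex.vertex 0)).choose_spec.1]
      exact Quotient.sound (s := MulAction.orbitRel G (ESpace G)) ⟨(b 0)⁻¹, smul_mk _ _ _⟩
    simp only [Set.inter_univ] at hu'
    have : mk (b ∘ θ) ⁻¹' (Quot.mk _ ⁻¹' S) = stdSimplex.map θ ⁻¹' u := by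
      rw [← hu']
      ext t
      simp only [Set.mem_preimage, mk_comp hθ, key]
      rfl
    rw [this]
    exact hu.preimage (stdSimplex.continuous_map θ)

/-! ### Hausdorff orbit spaces -/

theorem _root_.t2Space_orbits {K A : Type*} [Group K] [TopologicalSpace A] [MulAction K A] [ContinuousConstSMul K A]
    (h : ∀ x y : A, (∀ k : K, k • y ≠ x) → ∃ U ∈ 𝓝 x, ∃ V ∈ 𝓝 y, ∀ k : K, ∀ v ∈ V, k • v ∉ U) :
    T2Space (Quotient (MulAction.orbitRel K A)) := by
  refine ⟨fun x y hxy => ?_⟩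
  induction x using Quotient.ind with | _ x =>
  induction y using Quotient.ind with | _ y =>
  obtain ⟨U, hU, V, hV, hUV⟩ := h x y fun k hxy' =>
    hxy (Quotient.sound (s := MulAction.orbitRel K A) ⟨k, hxy'⟩)
  have hopen : IsOpenMap (Quotient.mk (MulAction.orbitRel K A)) := isOpenMap_quotient_mk'_mul
  obtain ⟨U', hU', hUo, hxU⟩ := mem_nhds_iff.1 hU
  obtain ⟨V', hV', hVo, hyV⟩ := mem_nhds_iff.1 hV
  refine ⟨_, _, hopen U' hUo, hopen V' hVo, ⟨x, hxU, rfl⟩, ⟨y, hyV, rfl⟩, ?_⟩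
  rw [Set.disjoint_left]
  rintro _ ⟨u, hu, rfl⟩ ⟨v, hv, huv⟩
  obtain ⟨k, hk⟩ := Quotient.exact huv.symm
  exact hUV k v (hV' hv) (hU' (by rw [show k • v = u from hk]; exact hu))

instance : T2Space (Quotient (MulAction.orbitRel G (ESpace G))) :=
  t2Space_orbits fun x y h => by
    obtain ⟨U, hU, V, hV, hUV⟩ := exists_disjoint_smul (⊤ : Subgroup G) x y fun k _ => h k
    exact ⟨U, hU, V, hV, fun k => hUV k trivial⟩

instance (H : Subgroup G) : T2Space (Quotient (MulAction.orbitRel H (ESpace G))) := by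
  have : ContinuousConstSMul H (ESpace G) := ⟨fun h => continuous_const_smul (h : G)⟩
  refine t2Space_orbits fun x y h => ?_
  obtain ⟨U, hU, V, hV, hUV⟩ := exists_disjoint_smul H x y fun k hk => h ⟨k, hk⟩
  exact ⟨U, hU, V, hV, fun k => hUV k k.2⟩

end ESpace

/-! ### Covering actions -/

theorem IsCoveringAction.of_nhds {G X : Type*} [Group G] [TopologicalSpace X] [MulAction G X]
    (h : ∀ x : X, ∃ U ∈ 𝓝 x, ∀ g : G, ∀ u ∈ U, g • u ∈ U → g = 1) : IsCoveringAction G X := by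
  intro x
  obtain ⟨U, hU, h⟩ := h x
  refine ⟨U, hU, fun g g' hg => Set.disjoint_left.2 ?_⟩
  rintro _ ⟨u, hu, rfl⟩ ⟨v, hv, huv⟩
  have h1 : (g⁻¹ * g') • v = u := by
    rw [mul_smul, inv_smul_eq_iff]
    exact huv
  exact hg (inv_mul_eq_one.1 (h _ v hv (by rwa [h1])))

theorem IsCoveringAction.exists_nhds {G X : Type*} [Group G] [TopologicalSpace X] [MulAction G X]
    (h : IsCoveringAction G X) (x : X) : ∃ U, IsOpen U ∧ x ∈ U ∧
      ∀ g : G, ∀ u ∈ U, g • u ∈ U → g = 1 := by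
  obtain ⟨U, hU, h⟩ := h x
  obtain ⟨V, hVU, hV, hxV⟩ := mem_nhds_iff.1 hU
  refine ⟨V, hV, hxV, fun g u hu hgu => ?_⟩
  by_contra hg
  exact Set.disjoint_left.1 (h g 1 hg) ⟨u, hVU hu, rfl⟩ ⟨g • u, hVU hgu, one_smul _ _⟩

theorem IsCoveringAction.eq_one {G X : Type*} [Group G] [TopologicalSpace X] [MulAction G X]
    (h : IsCoveringAction G X) {g : G} {x : X} (hg : g • x = x) : g = 1 := by
  obtain ⟨U, -, hx, h⟩ := h.exists_nhds x
  exact h g x hx (by rwa [hg])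

theorem IsCoveringAction.subgroup {G X : Type*} [Group G] [TopologicalSpace X] [MulAction G X]
    (h : IsCoveringAction G X) (H : Subgroup G) : IsCoveringAction H X := by
  refine .of_nhds fun x => ?_
  obtain ⟨U, hU, hx, h⟩ := h.exists_nhds x
  exact ⟨U, hU.mem_nhds hx, fun g u hu hgu => Subtype.ext (h g u hu hgu)⟩

theorem IsCoveringAction.isQuotientCoveringMap {G X Z : Type*} [Group G] [TopologicalSpace X]
    [MulAction G X] [ContinuousConstSMul G X] [TopologicalSpace Z] (h : IsCoveringAction G X) {p : X → Z}
    (hp : Topology.IsQuotientMap p) (hpo : ∀ x y, p x = p y ↔ x ∈ MulAction.orbit G y) :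
    IsQuotientCoveringMap p G where
  toIsQuotientMap := hp
  continuous_const_smul := continuous_const_smul
  apply_eq_iff_mem_orbit := hpo _ _
  disjoint x := by
    obtain ⟨U, hU, hx, h⟩ := h.exists_nhds x
    refine ⟨U, hU.mem_nhds hx, fun g => ?_⟩
    rintro ⟨_, ⟨u, hu, rfl⟩, hgu⟩
    exact h g u hu hgu

theorem IsCoveringAction.isQuotientCoveringMap_mk {G X : Type*} [Group G] [TopologicalSpace X]
    [MulAction G X] [ContinuousConstSMul G X] (h : IsCoveringAction G X) :
    IsQuotientCoveringMap (Quotient.mk (MulAction.orbitRel G X)) G :=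
  h.isQuotientCoveringMap isQuotientMap_quot_mk fun _ _ => Quotient.eq

/-! ### Compactly coherent spaces -/

theorem CompactlyCoherentSpace.of_continuousOn {X : Type*} [TopologicalSpace X]
    (h : ∀ A : Set X, (∀ K, IsCompact K → ∃ V, IsOpen V ∧ A ∩ K = V ∩ K) → IsOpen A) :
    CompactlyCoherentSpace X := by
  refine .of_isOpen fun A hA => h A fun K hK => ?_
  obtain ⟨V, hV, hVK⟩ := isOpen_induced_iff.1 (hA K hK)
  refine ⟨V, hV, ?_⟩
  ext x
  constructor
  · exact fun hx => ⟨(Set.ext_iff.1 hVK ⟨x, hx.2⟩).2 hx.1, hx.2⟩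
  · exact fun hx => ⟨(Set.ext_iff.1 hVK ⟨x, hx.2⟩).1 hx.1, hx.2⟩

theorem CompactlyCoherentSpace.isOpen_of_inter {X : Type*} [TopologicalSpace X] [CompactlyCoherentSpace X]
    {A : Set X} (h : ∀ K, IsCompact K → ∃ V, IsOpen V ∧ A ∩ K = V ∩ K) : IsOpen A := by
  refine CompactlyCoherentSpace.isOpen_iff.2 fun K hK => ?_
  obtain ⟨V, hV, hVK⟩ := h K hK
  refine isOpen_induced_iff.2 ⟨V, hV, ?_⟩
  ext x
  exact ⟨fun hx => (hVK.ge ⟨hx, x.2⟩).1, fun hx => (hVK.le ⟨hx, x.2⟩).1⟩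

theorem Topology.IsQuotientMap.compactlyCoherentSpace {X Y : Type*} [TopologicalSpace X]
    [TopologicalSpace Y] [CompactlyCoherentSpace X] {f : X → Y} (hf : Topology.IsQuotientMap f) :
    CompactlyCoherentSpace Y := by
  refine .of_continuousOn fun A hA => hf.isOpen_preimage.1 (CompactlyCoherentSpace.isOpen_of_inter ?_)
  intro K hK
  obtain ⟨V, hV, h⟩ := hA _ (hK.image hf.continuous)
  refine ⟨f ⁻¹' V, hV.preimage hf.continuous, ?_⟩
  ext x
  constructor
  · exact fun hx => ⟨(h.le ⟨hx.1, x, hx.2, rfl⟩).1, hx.2⟩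
  · exact fun hx => ⟨(h.ge ⟨hx.1, x, hx.2, rfl⟩).1, hx.2⟩

/-- A compact Hausdorff space is locally compact; this supplies compact pieces inside the domain of
a chart or of a local section. -/
theorem exists_isCompact_nhdsWithin {X : Type*} [TopologicalSpace X] [T2Space X] {K U : Set X}
    (hK : IsCompact K) (hU : IsOpen U) {x : X} (hxK : x ∈ K) (hxU : x ∈ U) :
    ∃ L V : Set X, IsCompact L ∧ L ⊆ U ∧ L ⊆ K ∧ IsOpen V ∧ x ∈ V ∧ V ∩ K ⊆ L := by
  have : CompactSpace K := isCompact_iff_compactSpace.1 hK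
  obtain ⟨L, hL, hLU, hLc⟩ := local_compact_nhds
    (show (Subtype.val ⁻¹' U : Set K) ∈ 𝓝 (⟨x, hxK⟩ : K) from
      (hU.preimage continuous_subtype_val).mem_nhds hxU)
  obtain ⟨V, hV, hVL⟩ := mem_nhds_subtype _ _ _ |>.1 hL
  obtain ⟨V', hV', hVo, hxV⟩ := mem_nhds_iff.1 hV
  refine ⟨Subtype.val '' L, V', hLc.image continuous_subtype_val, Set.image_subset_iff.2 hLU, ?_, hVo, hxV,
    fun y hy => ⟨⟨y, hy.2⟩, hVL (hV' hy.1), rfl⟩⟩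
  rintro _ ⟨y, -, rfl⟩
  exact y.2

/-- Inside a chart, compact subsets of the target pull back to compact subsets of `E`, so the test
for openness in `E` yields the test in `X`. -/
theorem IsLocalHomeomorph.compactlyCoherentSpace {E X : Type*} [TopologicalSpace E] [TopologicalSpace X]
    [T2Space X] [CompactlyCoherentSpace X] {p : E → X} (hp : IsLocalHomeomorph p) :
    CompactlyCoherentSpace E := by
  refine .of_continuousOn fun A hA => isOpen_iff_mem_nhds.2 fun w hw => ?_
  obtain ⟨f, hwf, rfl⟩ := hp w
  have hopen : IsOpen (f '' (A ∩ f.source)) := by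
    refine CompactlyCoherentSpace.isOpen_of_inter fun K hK => ?_
    suffices h : ∀ x ∈ f '' (A ∩ f.source) ∩ K, ∃ V, IsOpen V ∧ x ∈ V ∧ V ∩ K ⊆ f '' (A ∩ f.source) by
      choose! V h1 h2 h3 using h
      refine ⟨⋃ x ∈ f '' (A ∩ f.source) ∩ K, V x, isOpen_biUnion h1, ?_⟩
      ext x
      constructor
      · exact fun hx => ⟨Set.mem_biUnion hx (h2 x hx), hx.2⟩
      · rintro ⟨hx, hxK⟩
        obtain ⟨y, hy, hx⟩ := Set.mem_iUnion₂.1 hx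
        exact ⟨h3 y hy ⟨hx, hxK⟩, hxK⟩
    rintro _ ⟨⟨y, hy, rfl⟩, hyK⟩
    obtain ⟨L, V, hL, hLU, hLK, hV, hyV, hVL⟩ :=
      exists_isCompact_nhdsWithin hK f.open_target hyK (f.map_source hy.2)
    obtain ⟨W, hW, hWL⟩ := hA _ (hL.image_of_continuousOn (f.continuousOn_symm.mono hLU))
    have hyL : f y ∈ L := hVL ⟨hyV, hyK⟩
    have hyW : y ∈ W := (hWL.le ⟨hy.1, f y, hyL, f.left_inv hy.2⟩).1
    refine ⟨V ∩ (f.target ∩ f.symm ⁻¹' W), hV.inter (f.isOpen_inter_preimage_symm hW),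
      ⟨hyV, f.map_source hy.2, by rwa [Set.mem_preimage, f.left_inv hy.2]⟩, ?_⟩
    rintro z ⟨⟨hzV, hzt, hzW⟩, hzK⟩
    exact ⟨f.symm z, ⟨(hWL.ge ⟨hzW, z, hVL ⟨hzV, hzK⟩, rfl⟩).1, f.map_target hzt⟩, f.right_inv hzt⟩
  have h1 := f.isOpen_inter_preimage hopen
  refine Filter.mem_of_superset (h1.mem_nhds ⟨hwf, w, ⟨hw, hwf⟩, rfl⟩) ?_
  rintro v ⟨hv, v', ⟨hv', hv''⟩, h⟩
  rwa [← f.injOn hv'' hv h]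

theorem IsCoveringMap.t2Space {E X : Type*} [TopologicalSpace E] [TopologicalSpace X] [T2Space X]
    {p : E → X} (hp : IsCoveringMap p) : T2Space E := by
  refine ⟨fun x y hxy => ?_⟩
  by_cases h : p x = p y
  · exact hp.isSeparatedMap x y h hxy
  · exact separated_by_continuous hp.continuous h

/-- Homotopies relative to the boundary of the cube lift. The boundary is nonempty since the
dimension is positive, and this fixes the lift. -/
theorem IsCoveringMap.subsingleton_homotopyGroup {E X : Type*} [TopologicalSpace E] [TopologicalSpace X]
    {p : E → X} (hp : IsCoveringMap p) {n : ℕ} {x : E}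
    (h : Subsingleton (HomotopyGroup.Pi (n + 1) X (p x))) :
    Subsingleton (HomotopyGroup.Pi (n + 1) E x) := by
  refine ⟨fun a b => ?_⟩
  induction a using Quotient.ind with | _ f =>
  induction b using Quotient.ind with | _ g =>
  have h0 : (0 : Fin (n + 1) → unitInterval) ∈ Cube.boundary (Fin (n + 1)) := ⟨0, Or.inl rfl⟩
  refine Quotient.sound ?_
  change ContinuousMap.HomotopicRel f.1 g.1 (Cube.boundary (Fin (n + 1)))
  rw [hp.homotopicRel_iff_comp ⟨0, h0, (f.2 0 h0).trans (g.2 0 h0).symm⟩]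
  let F (f : GenLoop (Fin (n + 1)) E x) : GenLoop (Fin (n + 1)) X (p x) :=
    ⟨.comp ⟨p, hp.continuous⟩ f.1, fun y hy => congrArg p (f.2 y hy)⟩
  exact (Quotient.exact (h.elim ⟦F f⟧ ⟦F g⟧) : GenLoop.Homotopic (F f) (F g))

/-! ### Universal covers -/

theorem Path.Homotopic.Quotient.map_trans {X Y : Type*} [TopologicalSpace X] [TopologicalSpace Y]
    {x y z : X} (a : Path.Homotopic.Quotient x y) (b : Path.Homotopic.Quotient y z) (f : C(X, Y)) :
    (a.trans b).map f = (a.map f).trans (b.map f) := by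
  induction a using Path.Homotopic.Quotient.ind with | mk a =>
  induction b using Path.Homotopic.Quotient.ind with | mk b =>
  rw [← mk_trans, ← mk_map, Path.map_trans]
  rfl

/-- The universal cover of a space with basepoint `e`: points together with a class of paths
from `e`. -/
structure UCover {X : Type u} [TopologicalSpace X] (e : X) : Type u where
  pt : X
  cls : Path.Homotopic.Quotient e pt

namespace UCover

variable {X : Type u} [TopologicalSpace X] {e : X}

theorem mk_eq {x y : X} {p : Path e x} {q : Path e y} (h : y = x)
    (hpq : p.Homotopic (q.cast rfl h.symm)) :
    (⟨x, .mk p⟩ : UCover e) = ⟨y, .mk q⟩ := by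
  subst h
  rw [Path.Homotopic.Quotient.eq.2 hpq]
  rfl

/-- The action of a path on the fibers. -/
noncomputable abbrev along (w : UCover e) {y : X} (β : Path.Homotopic.Quotient w.pt y) : UCover e := ⟨y, w.cls.trans β⟩

variable (e) in
/-- The basepoint. -/
noncomputable def base : UCover e := ⟨e, .refl e⟩

theorem along_base {y : X} (β : Path.Homotopic.Quotient e y) : (base e).along β = ⟨y, β⟩ := by
  exact congrArg (UCover.mk y) (Path.Homotopic.Quotient.refl_trans β)

theorem along_along (w : UCover e) {y z : X} (β : Path.Homotopic.Quotient w.pt y)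
    (β' : Path.Homotopic.Quotient y z) : (w.along β).along β' = w.along (β.trans β') := by
  simp only [along, Path.Homotopic.Quotient.trans_assoc]

theorem along_refl (w : UCover e) : w.along (.refl w.pt) = w := by
  simp only [along, Path.Homotopic.Quotient.trans_refl]

theorem along_injective {w : UCover e} {y : X} {β β' : Path.Homotopic.Quotient w.pt y}
    (h : w.along β = w.along β') : β = β' := by
  simp only [along, mk.injEq, heq_eq_eq, true_and] at h
  have := congrArg (Path.Homotopic.Quotient.trans w.cls.symm) h
  simpa only [← Path.Homotopic.Quotient.trans_assoc, Path.Homotopic.Quotient.symm_trans,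
    Path.Homotopic.Quotient.refl_trans] using this

/-- Neighbourhoods of `w` are obtained by moving its end point along paths that stay near it. -/
instance : TopologicalSpace (UCover e) where
  IsOpen W := ∀ w ∈ W, ∃ U ∈ 𝓝 w.pt, ∀ (y : X) (β : Path w.pt y), (∀ t, β t ∈ U) → w.along (.mk β) ∈ W
  isOpen_univ _ _ := ⟨Set.univ, Filter.univ_mem, fun _ _ _ => trivial⟩
  isOpen_inter A B hA hB w hw := by
    obtain ⟨U, hU, h⟩ := hA w hw.1
    obtain ⟨V, hV, h'⟩ := hB w hw.2
    exact ⟨U ∩ V, Filter.inter_mem hU hV, fun y β hβ =>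
      ⟨h y β fun t => (hβ t).1, h' y β fun t => (hβ t).2⟩⟩
  isOpen_sUnion S hS w hw := by
    obtain ⟨A, hA, hw⟩ := hw
    obtain ⟨U, hU, h⟩ := hS A hA w hw
    exact ⟨U, hU, fun y β hβ => ⟨A, hA, h y β hβ⟩⟩

theorem isOpen_iff {W : Set (UCover e)} : IsOpen W ↔ ∀ w ∈ W, ∃ U ∈ 𝓝 w.pt, ∀ (y : X) (β : Path w.pt y),
    (∀ t, β t ∈ U) → w.along (.mk β) ∈ W := Iff.rfl

theorem continuous_pt : Continuous (pt : UCover e → X) := by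
  refine ⟨fun U hU => isOpen_iff.2 fun w hw => ⟨U, hU.mem_nhds hw, fun y β hβ => ?_⟩⟩
  change y ∈ U
  rw [← β.target]
  exact hβ 1

/-- The points reached from `w` along paths in `V`. -/
def sheet (w : UCover e) (V : Set X) : Set (UCover e) :=
  {v | ∃ (y : X) (β : Path w.pt y), (∀ t, β t ∈ V) ∧ v = w.along (.mk β)}

theorem isOpen_sheet (w : UCover e) {V : Set X} (hV : IsOpen V) : IsOpen (sheet w V) := by
  rw [isOpen_iff]
  rintro _ ⟨y, β, hβ, rfl⟩
  refine ⟨V, hV.mem_nhds (by have := hβ 1; rwa [β.target] at this), fun z β' hβ' =>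
    ⟨z, β.trans β', fun t => ?_, ?_⟩⟩
  · rw [Path.trans_apply]
    split_ifs
    · exact hβ _
    · exact hβ' _
  · rw [along_along, Path.Homotopic.Quotient.mk_trans]

theorem mem_sheet_self (w : UCover e) {V : Set X} (h : w.pt ∈ V) : w ∈ sheet w V :=
  ⟨w.pt, Path.refl _, fun _ => h, (along_refl w).symm⟩

theorem pt_mem_of_mem_sheet {w v : UCover e} {V : Set X} (h : v ∈ sheet w V) : v.pt ∈ V := by
  obtain ⟨y, β, hβ, rfl⟩ := h
  have := hβ 1
  rwa [β.target] at this

/-- Open path-connected sets in which all paths with the same endpoints are homotopic in the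
whole space. -/
structure IsNice (V : Set X) : Prop where
  isOpen : IsOpen V
  isPathConnected : IsPathConnected V
  homotopic : ∀ {y z : X} (p q : Path y z), (∀ t, p t ∈ V) → (∀ t, q t ∈ V) → p.Homotopic q

/-- The hypothesis concerns loops at `x` only: join `x` to the start of `p` and `q` by a path `r`,
and contract the loop `r p q⁻¹ r⁻¹`. -/
theorem exists_isNice [LocallyPathConnectedSpace X] (hX : SemilocallySimplyConnected X) (x : X) {U : Set X}
    (hU : U ∈ 𝓝 x) : ∃ V ⊆ U, x ∈ V ∧ IsNice V := by
  obtain ⟨N, hN, h⟩ := hX x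
  obtain ⟨V, ⟨hVo, hxV, hV⟩, hVN⟩ := (isOpen_isPathConnected_basis x).mem_iff.1
    (Filter.inter_mem hU hN)
  refine ⟨V, fun y hy => (hVN hy).1, hxV, hVo, hV, fun {y z} p q hp hq => ?_⟩
  obtain ⟨r, hr⟩ := hV.joinedIn x hxV y (by have := hp 0; rwa [p.source] at this)
  have h1 := h ((r.trans (p.trans q.symm)).trans r.symm) fun t => by
    refine (hVN ?_).2
    simp only [Path.trans_apply, Path.symm_apply]
    split_ifs
    exacts [hr _, hp _, hq _, hr _]
  rw [← Path.Homotopic.Quotient.eq] at h1 ⊢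
  simp only [Path.Homotopic.Quotient.mk_trans, Path.Homotopic.Quotient.mk_symm,
    Path.Homotopic.Quotient.mk_refl] at h1
  generalize Path.Homotopic.Quotient.mk p = p at h1 ⊢
  generalize Path.Homotopic.Quotient.mk q = q at h1 ⊢
  generalize Path.Homotopic.Quotient.mk r = r at h1 ⊢
  have h2 := congrArg (fun l => ((r.symm.trans l).trans r).trans q) h1
  simpa only [Path.Homotopic.Quotient.trans_assoc, Path.Homotopic.Quotient.symm_trans,
    Path.Homotopic.Quotient.trans_refl, Path.Homotopic.Quotient.refl_trans,
    ← Path.Homotopic.Quotient.trans_assoc r.symm r] using h2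

theorem IsNice.injOn {V : Set X} (hV : IsNice V) (w : UCover e) : Set.InjOn pt (sheet w V) := by
  rintro _ ⟨y, β, hβ, rfl⟩ _ ⟨z, β', hβ', rfl⟩ h
  change y = z at h
  subst h
  rw [Path.Homotopic.Quotient.eq.2 (hV.homotopic β β' hβ hβ')]

theorem exists_sheet_subset [LocallyPathConnectedSpace X] (hX : SemilocallySimplyConnected X) {w : UCover e}
    {W : Set (UCover e)} (hW : W ∈ 𝓝 w) {U : Set X} (hU : U ∈ 𝓝 w.pt) :
    ∃ V ⊆ U, w.pt ∈ V ∧ IsNice V ∧ sheet w V ⊆ W := by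
  obtain ⟨W', hW', hWo, hwW⟩ := mem_nhds_iff.1 hW
  obtain ⟨N, hN, h⟩ := isOpen_iff.1 hWo w hwW
  obtain ⟨V, hV, hwV, hVn⟩ := exists_isNice hX w.pt (Filter.inter_mem hU hN)
  refine ⟨V, fun x hx => (hV hx).1, hwV, hVn, ?_⟩
  rintro _ ⟨y, β, hβ, rfl⟩
  exact hW' (h y β fun t => (hV (hβ t)).2)

theorem isOpenMap_pt [LocallyPathConnectedSpace X] (hX : SemilocallySimplyConnected X) :
    IsOpenMap (pt : UCover e → X) := by
  intro W hW
  rw [isOpen_iff_mem_nhds]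
  rintro _ ⟨w, hw, rfl⟩
  obtain ⟨V, -, hwV, hV, hVW⟩ := exists_sheet_subset hX (hW.mem_nhds hw) Filter.univ_mem
  refine Filter.mem_of_superset (hV.isOpen.mem_nhds hwV) fun y hy => ?_
  obtain ⟨β, hβ⟩ := hV.isPathConnected.joinedIn _ hwV y hy
  exact ⟨w.along (.mk β), hVW ⟨y, β, hβ, rfl⟩, rfl⟩

theorem surjective_pt [PathConnectedSpace X] : Function.Surjective (pt : UCover e → X) := fun x =>
  ⟨⟨x, .mk (PathConnectedSpace.somePath e x)⟩, rfl⟩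

theorem along_congr (w : UCover e) {y z : X} {β : Path w.pt y} {β' : Path w.pt z} (h : ∀ t, β t = β' t) :
    w.along (.mk β) = w.along (.mk β') := by
  obtain rfl : y = z := by simpa using h 1
  obtain rfl : β = β' := Path.ext (funext h)
  rfl

theorem along_congr_of_eq {w w' : UCover e} (hw : w = w') {y z : X} {β : Path w.pt y} {β' : Path w'.pt z}
    (h : ∀ t, β t = β' t) : w.along (.mk β) = w'.along (.mk β') := by
  subst hw
  exact along_congr w h

/-- The lift at time `s` arises from the lift at time `t` by moving along the part of `ω` in
between, which is short for nearby times; this gives continuity of the lift. -/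
theorem along_subpath (w : UCover e) {y : X} (ω : Path w.pt y) (t s : unitInterval) :
    (w.along (.mk ((ω.subpath 0 t).cast ω.source.symm rfl))).along (.mk (ω.subpath t s)) =
      w.along (.mk ((ω.subpath 0 s).cast ω.source.symm rfl)) := by
  rw [along_along, ← Path.Homotopic.Quotient.mk_trans]
  have h : (((ω.subpath 0 t).trans (ω.subpath t s)).cast ω.source.symm rfl).Homotopic
      ((ω.subpath 0 s).cast ω.source.symm rfl) :=
    Path.Homotopic.pathCast ⟨Path.Homotopy.subpathTransSubpath ω 0 t s⟩ _ _
  rw [← Path.Homotopic.Quotient.eq.2 h]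
  exact along_congr w fun r => by simp [Path.trans_apply]

/-- The lift of a path. -/
noncomputable def liftPath (w : UCover e) {y : X} (ω : Path w.pt y) : Path w (w.along (.mk ω)) where
  toFun t := w.along (.mk ((ω.subpath 0 t).cast ω.source.symm rfl))
  continuous_toFun := by
    refine ⟨fun W hW => isOpen_iff_mem_nhds.2 fun t ht => ?_⟩
    obtain ⟨U, hU, h⟩ := isOpen_iff.1 hW (w.along (.mk ((ω.subpath 0 t).cast ω.source.symm rfl))) ht
    obtain ⟨T, hTm, hTc, hTU⟩ : ∃ T ∈ 𝓝 t, T.OrdConnected ∧ T ⊆ ω ⁻¹' U := by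
      obtain ⟨N, hN, hNU⟩ := mem_nhds_subtype _ t _ |>.1 (ω.continuous.continuousAt.preimage_mem_nhds hU)
      obtain ⟨T, hT, hTU⟩ := (LocallyConvexSpace.convex_basis (𝕜 := ℝ) (t : ℝ)).mem_iff.1 hN
      exact ⟨Subtype.val ⁻¹' T, continuous_subtype_val.continuousAt.preimage_mem_nhds hT.1,
        hT.2.ordConnected.preimage_mono (Subtype.mono_coe _), (Set.preimage_mono hTU).trans hNU⟩
    refine Filter.mem_of_superset hTm fun s hs => ?_
    rw [Set.mem_preimage, ← along_subpath w ω t s]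
    refine h (ω s) (ω.subpath t s) fun r => ?_
    have hr : ω.subpath t s r ∈ Set.range (ω.subpath t s) := ⟨r, rfl⟩
    rw [Path.range_subpath] at hr
    obtain ⟨r', hr', h2⟩ := hr
    exact Set.mem_of_eq_of_mem h2.symm (hTU (hTc.uIcc_subset (mem_of_mem_nhds hTm) hs hr'))
  source' := by
    conv_rhs => rw [← along_refl w]
    exact along_congr w (β' := Path.refl _) fun r => by simp [Path.subpath]
  target' := along_congr w fun r => by simp

instance [PathConnectedSpace X] : PathConnectedSpace (UCover e) := by
  refine ⟨⟨base e⟩, fun w v => ?_⟩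
  have h : ∀ w, Joined (base e) w := by
    rintro ⟨x, c⟩
    induction c using Path.Homotopic.Quotient.ind with | mk p =>
    rw [← along_base]
    exact ⟨liftPath (base e) p⟩
  exact (h w).symm.trans (h v)

/-! The group of classes of paths to the orbit of the basepoint acts on the universal cover. -/

variable {G : Type u} [Group G] [MulAction G X] [ContinuousConstSMul G X]

open OrbitPathClass (translate)

noncomputable instance : MulAction (OrbitPathClass G e) (UCover e) where
  smul a w := ⟨a.elt • w.pt, a.path.trans (w.cls.map (translate a.elt))⟩
  one_smul w := by
    obtain ⟨x, c⟩ := w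
    induction c using Path.Homotopic.Quotient.ind with | mk p =>
    have key := (Path.Homotopic.refl_trans p).pathCast (x₂ := e) (x₃ := (1 : G) • x) rfl (one_smul G x)
    refine mk_eq (p := ((Path.refl e).cast rfl (one_smul G e)).trans (p.map (continuous_const_smul (1 : G))))
      (one_smul G x).symm ?_
    convert key using 1
    ext t
    simp [Path.trans_apply]
  mul_smul a b w := by
    obtain ⟨x, c⟩ := w
    obtain ⟨g, p, rfl⟩ := a.exists_ofPath
    obtain ⟨h, q, rfl⟩ := b.exists_ofPath
    induction c using Path.Homotopic.Quotient.ind with | mk r =>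
    have key := (Path.Homotopic.trans_assoc p (q.map (continuous_const_smul g))
      ((r.map (continuous_const_smul h)).map (continuous_const_smul g))).pathCast (x₂ := e)
      (x₃ := (g * h) • x) rfl (mul_smul g h x)
    refine mk_eq
      (p := ((p.trans (q.map (continuous_const_smul g))).cast rfl (mul_smul g h e)).trans
        (r.map (continuous_const_smul (g * h))))
      (q := p.trans ((q.trans (r.map (continuous_const_smul h))).map (continuous_const_smul g)))
      (mul_smul g h x).symm ?_
    convert key using 1
    · ext t
      simp [Path.trans_apply, mul_smul]
    · ext t
      simp [Path.trans_apply]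

theorem pt_smul (a : OrbitPathClass G e) (w : UCover e) : (a • w).pt = a.elt • w.pt := rfl

theorem smul_along (a : OrbitPathClass G e) (w : UCover e) {y : X} (β : Path.Homotopic.Quotient w.pt y) :
    a • w.along β = (a • w).along (β.map (translate a.elt)) := by
  refine congrArg (UCover.mk (a.elt • y)) ?_
  exact (congrArg a.path.trans (Path.Homotopic.Quotient.map_trans w.cls β (translate a.elt))).trans
    (Path.Homotopic.Quotient.trans_assoc _ _ _).symm

theorem smul_base (a : OrbitPathClass G e) : a • base e = ⟨a.elt • e, a.path⟩ :=
  congrArg (UCover.mk (a.elt • e)) (Path.Homotopic.Quotient.trans_refl a.path)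

instance : ContinuousConstSMul (OrbitPathClass G e) (UCover e) where
  continuous_const_smul a := by
    refine ⟨fun W hW => isOpen_iff.2 fun w hw => ?_⟩
    obtain ⟨U, hU, h⟩ := isOpen_iff.1 hW (a • w) hw
    refine ⟨(a.elt • ·) ⁻¹' U, (continuous_const_smul a.elt).continuousAt.preimage_mem_nhds hU,
      fun y β hβ => ?_⟩
    rw [Set.mem_preimage, smul_along]
    exact h _ (β.map (continuous_const_smul a.elt)) hβ

theorem eq_of_smul_base (hG : IsCoveringAction G X) {a b : OrbitPathClass G e}
    (h : a • base e = b • base e) : a = b := by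
  rw [smul_base, smul_base] at h
  obtain ⟨g, p⟩ := a
  obtain ⟨g', p'⟩ := b
  have h1 : g • e = g' • e := congrArg UCover.pt h
  obtain rfl : g = g' := by
    have := hG.eq_one (g := g'⁻¹ * g) (x := e) (by rw [mul_smul, h1, inv_smul_smul])
    exact (inv_mul_eq_one.1 this).symm
  simp only [mk.injEq, heq_eq_eq, true_and] at h
  rw [h]

/-- The projection shows that `a.elt = 1`, so `a` leaves paths in `X` unchanged. Moving the fixed
point `w` back along its own path shows that `a` fixes the basepoint. -/
theorem eq_one_of_smul (hG : IsCoveringAction G X) {a : OrbitPathClass G e} {w : UCover e}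
    (h : a • w = w) : a = 1 := by
  refine eq_of_smul_base hG ?_
  rw [one_smul]
  have h1 : a.elt = 1 := hG.eq_one (congrArg UCover.pt h)
  obtain ⟨x, c⟩ := w
  induction c using Path.Homotopic.Quotient.ind with | mk p =>
  have h2 : (⟨x, .mk p⟩ : UCover e).along (.mk p.symm) = base e :=
    congrArg (UCover.mk e) (by
      rw [Path.Homotopic.Quotient.mk_symm]
      exact Path.Homotopic.Quotient.trans_symm _)
  calc a • base e = (a • (⟨x, .mk p⟩ : UCover e)).along (.mk (p.symm.map (continuous_const_smul a.elt))) := by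
        rw [← h2]
        exact smul_along a _ _
    _ = (⟨x, .mk p⟩ : UCover e).along (.mk p.symm) :=
        along_congr_of_eq h fun t => by
          change a.elt • p.symm t = p.symm t
          rw [h1, one_smul]
    _ = base e := h2

/-- An element that returns a point of a small sheet to it has trivial image in `G`, hence preserves
the projection and fixes the point, by injectivity on sheets. -/
theorem isCoveringAction [LocallyPathConnectedSpace X] (hX : SemilocallySimplyConnected X)
    (hG : IsCoveringAction G X) : IsCoveringAction (OrbitPathClass G e) (UCover e) := by
  refine .of_nhds fun w => ?_
  obtain ⟨U, hU, hwU, h⟩ := hG.exists_nhds w.pt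
  obtain ⟨V, hVU, hwV, hV, -⟩ := exists_sheet_subset hX (w := w) Filter.univ_mem (hU.mem_nhds hwU)
  refine ⟨sheet w V, (isOpen_sheet w hV.isOpen).mem_nhds (mem_sheet_self w hwV), fun a u hu hau => ?_⟩
  have h1 : a.elt = 1 := h a.elt u.pt (hVU (pt_mem_of_mem_sheet hu)) (hVU (pt_mem_of_mem_sheet hau))
  refine eq_one_of_smul hG (hV.injOn w hau hu ?_)
  rw [pt_smul, h1, one_smul]

theorem exists_smul_of_pt_eq {g : G} {w v : UCover e} (h : v.pt = g • w.pt) :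
    ∃ a : OrbitPathClass G e, a.elt = g ∧ a • w = v := by
  obtain ⟨x, c⟩ := w
  obtain ⟨y, d⟩ := v
  dsimp only at h
  subst h
  induction c using Path.Homotopic.Quotient.ind with | mk p =>
  induction d using Path.Homotopic.Quotient.ind with | mk q =>
  -- The path to `v`, then back along the translated path of `w`; acting on `w` cancels the second
  -- part.
  let a : OrbitPathClass G e := .ofPath g (q.trans (p.symm.map (continuous_const_smul g)))
  refine ⟨a, rfl, ?_⟩
  have key : ((q.trans (p.symm.map (continuous_const_smul g))).trans
      (p.map (continuous_const_smul g))).Homotopic q := by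
    rw [← Path.Homotopic.Quotient.eq]
    have : p.symm.map (continuous_const_smul g) = (p.map (continuous_const_smul g)).symm := rfl
    rw [this]
    simp only [Path.Homotopic.Quotient.mk_trans, Path.Homotopic.Quotient.mk_symm,
      Path.Homotopic.Quotient.trans_assoc, Path.Homotopic.Quotient.symm_trans,
      Path.Homotopic.Quotient.trans_refl]
  exact congrArg (UCover.mk (g • x)) (Path.Homotopic.Quotient.eq.2 key)

end UCover

/-- The classes of loops. -/
noncomputable abbrev OrbitPathClass.loops (G : Type u) [Group G] {X : Type u} [TopologicalSpace X]
    [MulAction G X] [ContinuousConstSMul G X] (e : X) : Subgroup (OrbitPathClass G e) :=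
  (OrbitPathClass.eltHom : OrbitPathClass G e →* G).ker

/-! ### The covering property and simple connectivity -/

namespace UCover

variable {X : Type u} [TopologicalSpace X] {e : X} [LocallyPathConnectedSpace X] [PathConnectedSpace X]
  {G : Type u} [Group G] [MulAction G X] [ContinuousConstSMul G X]

theorem isQuotientMap_pt (hX : SemilocallySimplyConnected X) : Topology.IsQuotientMap (pt : UCover e → X) :=
  (isOpenMap_pt hX).isQuotientMap continuous_pt surjective_pt

theorem isQuotientCoveringMap (hX : SemilocallySimplyConnected X) (hG : IsCoveringAction G X) :
    IsQuotientCoveringMap (pt : UCover e → X) (OrbitPathClass.loops G e) := by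
  have : ContinuousConstSMul (OrbitPathClass.loops G e) (UCover e) :=
    ⟨fun a => continuous_const_smul (a : OrbitPathClass G e)⟩
  refine ((isCoveringAction hX hG).subgroup _).isQuotientCoveringMap (isQuotientMap_pt hX) fun v w => ?_
  constructor
  · intro h
    obtain ⟨a, ha, rfl⟩ := exists_smul_of_pt_eq (g := (1 : G)) (w := w) (v := v) (by rw [h, one_smul])
    exact ⟨⟨a, ha⟩, rfl⟩
  · rintro ⟨a, rfl⟩
    change (a : OrbitPathClass G e).elt • w.pt = w.pt
    rw [show (a : OrbitPathClass G e).elt = 1 from a.2, one_smul]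

/-- The covering property does not involve `G`, so the trivial group may be used. -/
theorem isCoveringMap (hX : SemilocallySimplyConnected X) : IsCoveringMap (pt : UCover e → X) := by
  let : MulAction PUnit.{u + 1} X :=
    { smul := fun _ x => x, one_smul := fun _ => rfl, mul_smul := fun _ _ _ => rfl }
  have : ContinuousConstSMul PUnit.{u + 1} X := ⟨fun _ => continuous_id⟩
  exact (isQuotientCoveringMap (G := PUnit.{u + 1}) hX (.of_nhds fun x =>
    ⟨Set.univ, Filter.univ_mem, fun _ _ _ _ => Subsingleton.elim _ _⟩)).isCoveringMap

/-- Unique path lifting: a path in the cover is the canonical lift of its projection. -/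
theorem apply_one_eq_along (hX : SemilocallySimplyConnected X) {w v : UCover e} (P : Path w v) :
    v = w.along (.mk (P.map continuous_pt)) := by
  have h := (isCoveringMap hX).eq_of_comp_eq P.continuous
    (w.liftPath (P.map continuous_pt)).continuous (funext fun t => rfl) 0 (by simp)
  have := congrFun h 1
  rwa [P.target, Path.target] at this

/-- The projections of two paths with common ends are homotopic since `along` is injective, and a
covering map is injective on path classes. -/
theorem simplyConnectedSpace (hX : SemilocallySimplyConnected X) : SimplyConnectedSpace (UCover e) := by
  rw [simply_connected_iff_paths_homotopic']
  refine ⟨inferInstance, fun {w v} P Q => ?_⟩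
  rw [← Path.Homotopic.Quotient.eq]
  refine (isCoveringMap hX).injective_path_homotopic_map w v (along_injective (w := w) ?_)
  exact (apply_one_eq_along hX P).symm.trans (apply_one_eq_along hX Q)

theorem discExtension (hX : SemilocallySimplyConnected X)
    (h : ∀ n, 2 ≤ n → ∀ x : X, Subsingleton (HomotopyGroup.Pi n X x)) : DiscExtension (UCover e) := by
  refine .of_homotopyGroup fun d w => ?_
  obtain _ | d := d
  · have := simplyConnectedSpace (e := e) hX
    have : Subsingleton (FundamentalGroup (UCover e) w) := inferInstance
    exact HomotopyGroup.pi1EquivFundamentalGroup.injective.subsingleton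
  · exact (isCoveringMap hX).subsingleton_homotopyGroup (h _ (by omega) _)

end UCover

/-! ### Sections over orbit spaces -/

section Sections

variable {K Z A T X : Type*} [Group K] [TopologicalSpace Z] [TopologicalSpace A] [TopologicalSpace T]
  [TopologicalSpace X] [MulAction K Z] [MulAction K A] [ContinuousConstSMul K Z]

theorem IsQuotientCoveringMap.eq_one [ContinuousConstSMul K A] {p : A → X} (hp : IsQuotientCoveringMap p K) {k : K} {a : A}
    (h : k • a = a) : k = 1 := by
  obtain ⟨U, hU, h'⟩ := hp.disjoint a
  have ha := mem_of_mem_nhds hU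
  exact h' k ⟨a, ⟨a, ha, h⟩, ha⟩

omit [TopologicalSpace Z] [ContinuousConstSMul K Z] in
theorem IsQuotientCoveringMap.eq_of_equivariant [ContinuousConstSMul K A] {p : A → X}
    (hp : IsQuotientCoveringMap p K) {f : Z → A} (hf : ∀ (k : K) z, f (k • z) = k • f z) {z z' : Z}
    (h : f z = f z') (hzz : Quotient.mk (MulAction.orbitRel K Z) z = Quotient.mk _ z') : z = z' := by
  obtain ⟨k, hk⟩ := Quotient.exact hzz
  change k • z' = z at hk
  have : k = 1 := hp.eq_one (a := f z') (by rw [← hf, hk, h])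
  rw [← hk, this, one_smul]

/-- Points of an orbit space lift uniquely along equivariant maps to free spaces, and the lift is
continuous. -/
theorem IsQuotientCoveringMap.exists_section [ContinuousConstSMul K A] {p : A → X}
    (hp : IsQuotientCoveringMap p K) {f : Z → A} (hfc : Continuous f)
    (hf : ∀ (k : K) z, f (k • z) = k • f z) {u : T → A} (hu : Continuous u)
    {v : T → Quotient (MulAction.orbitRel K Z)} (hv : Continuous v)
    (huv : ∀ t z, Quotient.mk _ z = v t → p (f z) = p (u t)) :
    ∃ w : C(T, Z), (∀ t, f (w t) = u t) ∧ ∀ t, Quotient.mk _ (w t) = v t := by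
  have hex : ∀ t, ∃ z, f z = u t ∧ Quotient.mk _ z = v t := fun t => by
    obtain ⟨z, hz⟩ := Quotient.exists_rep (v t)
    obtain ⟨k, hk⟩ := hp.apply_eq_iff_mem_orbit.1 (huv t z hz).symm
    exact ⟨k • z, (hf k z).trans hk, by rw [← hz]; exact Quotient.sound (s := MulAction.orbitRel K Z) ⟨k, rfl⟩⟩
  choose w hw1 hw2 using hex
  refine ⟨⟨w, ⟨fun W hW => isOpen_iff_mem_nhds.2 fun t ht => ?_⟩⟩, hw1, hw2⟩
  obtain ⟨U, hU, h⟩ := hp.disjoint (u t)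
  have hopen : IsOpenMap (Quotient.mk (MulAction.orbitRel K Z)) := isOpenMap_quotient_mk'_mul
  -- Nearby, `v s` has a representative in `W` whose image lies in `U`. It differs from `w s` by an
  -- element that moves one point of `U` to another, hence by the identity.
  have h1 : Quotient.mk (MulAction.orbitRel K Z) '' (W ∩ f ⁻¹' interior U) ∈ 𝓝 (v t) :=
    (hopen _ (hW.inter (isOpen_interior.preimage hfc))).mem_nhds
      ⟨w t, ⟨ht, by rw [Set.mem_preimage, hw1]; exact mem_interior_iff_mem_nhds.2 hU⟩, hw2 t⟩
  filter_upwards [hu.continuousAt.preimage_mem_nhds hU, hv.continuousAt.preimage_mem_nhds h1] with s hs1 hs2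
  obtain ⟨z, ⟨hzW, hzU⟩, hz⟩ := hs2
  obtain ⟨k, hk⟩ := hp.apply_eq_iff_mem_orbit.1 (huv s z hz)
  have h2 : k = 1 := h k ⟨f z, ⟨u s, hs1, hk⟩, interior_subset hzU⟩
  have h3 : w s = z := hp.eq_of_equivariant hf
    (by rw [hw1, ← hk, h2]; exact (one_smul _ _).symm) ((hw2 s).trans hz.symm)
  rwa [Set.mem_preimage, h3]

end Sections

theorem HasLift.of_subtype {W Z M : Type*} [TopologicalSpace W] [TopologicalSpace Z] [TopologicalSpace M]
    {p : W → Z} {s b : Set M} (hb : b ⊆ s)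
    (h : ∀ (χ : C(s, Z)) (σ : C(b, W)), (∀ z : b, p (σ z) = χ ⟨z, hb z.2⟩) →
      ∃ τ : C(s, W), (∀ z, p (τ z) = χ z) ∧ ∀ z : b, τ ⟨z, hb z.2⟩ = σ z) : HasLift p s b := by
  classical
  intro χ σ hχ hσ hp
  obtain ⟨τ, h1, h2⟩ := h ⟨_, continuousOn_iff_continuous_domRestrict.1 hχ⟩
    ⟨_, continuousOn_iff_continuous_domRestrict.1 hσ⟩ fun z => hp z z.2
  have h3 : ∀ z (hz : z ∈ s), (if hz : z ∈ s then τ ⟨z, hz⟩ else σ z) = τ ⟨z, hz⟩ := fun z hz => dif_pos hz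
  refine ⟨fun z => if hz : z ∈ s then τ ⟨z, hz⟩ else σ z, ?_, fun z hz => ?_, fun z hz => ?_⟩
  · rw [continuousOn_iff_continuous_domRestrict]
    exact τ.continuous.congr fun z => (h3 z z.2).symm
  · exact (h3 z (hb hz)).trans (h2 ⟨z, hz⟩)
  · dsimp only
    rw [h3 z hz]
    exact h1 ⟨z, hz⟩

theorem ContinuousMap.exists_continuousOn_eq {M Z : Type*} [TopologicalSpace M] [TopologicalSpace Z] [Nonempty Z]
    {s : Set M} (f : C(s, Z)) : ∃ g : M → Z, ContinuousOn g s ∧ ∀ z : s, g z = f z := by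
  classical
  have h : ∀ z : s, (if hz : (z : M) ∈ s then f ⟨z, hz⟩ else Classical.arbitrary Z) = f z := fun z => dif_pos z.2
  refine ⟨fun z => if hz : z ∈ s then f ⟨z, hz⟩ else Classical.arbitrary Z, ?_, h⟩
  rw [continuousOn_iff_continuous_domRestrict]
  exact f.continuous.congr fun z => (h z).symm

theorem HasLift.exists_subtype {W Z M : Type*} [TopologicalSpace W] [TopologicalSpace Z] [TopologicalSpace M]
    [Nonempty W] {p : W → Z} {s b : Set M} (hb : b ⊆ s) (h : HasLift p s b) (χ : C(s, Z)) (σ : C(b, W))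
    (hχσ : ∀ z : b, p (σ z) = χ ⟨z, hb z.2⟩) :
    ∃ τ : C(s, W), (∀ z, p (τ z) = χ z) ∧ ∀ z : b, τ ⟨z, hb z.2⟩ = σ z := by
  have : Nonempty Z := ‹Nonempty W›.map p
  obtain ⟨χ', h1, h2⟩ := χ.exists_continuousOn_eq
  obtain ⟨σ', h3, h4⟩ := σ.exists_continuousOn_eq
  obtain ⟨τ, h5, h6, h7⟩ := h χ' σ' h1 h3 fun z hz => by
    rw [h4 ⟨z, hz⟩, h2 ⟨z, hb hz⟩]
    exact hχσ ⟨z, hz⟩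
  refine ⟨⟨_, continuousOn_iff_continuous_domRestrict.1 h5⟩, fun z => ?_, fun z => ?_⟩
  · exact (h7 z z.2).trans (h2 z)
  · exact (h6 z.2).trans (h4 z)

/-- The lifting property for discs descends to orbit spaces. -/
theorem HasDiscLift.orbits {K W A X : Type*} [Group K] [TopologicalSpace W] [TopologicalSpace A]
    [TopologicalSpace X] [MulAction K W] [MulAction K A] [ContinuousConstSMul K W] [ContinuousConstSMul K A]
    {p : A → X} (hp : IsQuotientCoveringMap p K) [Nonempty W] {f : W → A} (hfc : Continuous f)
    (hf : ∀ (k : K) w, f (k • w) = k • f w) (h : HasDiscLift f)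
    {q : Quotient (MulAction.orbitRel K W) → X} (hq : ∀ w, q (Quotient.mk _ w) = p (f w)) :
    HasDiscLift q := by
  intro d
  refine HasLift.of_subtype Metric.sphere_subset_closedBall fun χ σ hχσ => ?_
  let D := Metric.closedBall (0 : EuclideanSpace ℝ (Fin d)) 1
  let o : D := ⟨0, Metric.mem_closedBall_self zero_le_one⟩
  -- Contracting the disc lets `χ` lift through the covering to `A`. The boundary data then lift to
  -- `W` over that map, and the lifting property of `f` applies.
  let m : C(unitInterval × D, D) := ⟨fun x => ⟨(x.1 : ℝ) • (x.2 : EuclideanSpace ℝ (Fin d)), by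
    rw [mem_closedBall_zero_iff, norm_smul, Real.norm_eq_abs, abs_of_nonneg x.1.2.1]
    exact mul_le_one₀ x.1.2.2 (norm_nonneg _) (mem_closedBall_zero_iff.1 x.2.2)⟩, by fun_prop⟩
  have hm0 : ∀ z, m (0, z) = o := fun z => Subtype.ext (zero_smul ℝ _)
  have hm1 : ∀ z, m (1, z) = z := fun z => Subtype.ext (one_smul ℝ _)
  obtain ⟨a₀, ha₀⟩ := hp.surjective (χ o)
  have h0 : ∀ z : D, (χ.comp m) (0, z) = p (ContinuousMap.const D a₀ z) := fun z => by
    rw [ContinuousMap.comp_apply, hm0]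
    exact ha₀.symm
  let Λ := hp.isCoveringMap.liftHomotopy (χ.comp m) (.const D a₀) h0
  let χ' : C(D, A) := ⟨fun z => Λ (1, z), by fun_prop⟩
  have hχ' : ∀ z, p (χ' z) = χ z := fun z => by
    have := congrFun (hp.isCoveringMap.liftHomotopy_lifts (χ.comp m) (.const D a₀) h0) (1, z)
    refine this.trans ?_
    rw [ContinuousMap.comp_apply, hm1]
  let ι : C(Metric.sphere (0 : EuclideanSpace ℝ (Fin d)) 1, D) :=
    ⟨Set.inclusion Metric.sphere_subset_closedBall, continuous_inclusion _⟩
  obtain ⟨w, hw1, hw2⟩ := hp.exists_section hfc hf (u := χ' ∘ ι) (χ'.continuous.comp ι.continuous)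
    (v := σ) σ.continuous fun z w hw => by
      rw [← hq, hw, hχσ]
      exact (hχ' _).symm
  obtain ⟨τ, hτ1, hτ2⟩ := (h d).exists_subtype Metric.sphere_subset_closedBall χ' w fun z => hw1 z
  refine ⟨⟨fun z => Quotient.mk _ (τ z), continuous_quot_mk.comp τ.continuous⟩, fun z => ?_, fun z => ?_⟩
  · exact (hq _).trans ((congrArg p (hτ1 z)).trans (hχ' z))
  · exact (congrArg _ (hτ2 z)).trans (hw2 z)

/-! ### Equivariant maps out of covering spaces of cellular spaces -/

/-- Maps out of `Y` lift along maps with the lifting property for discs. -/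
def IsCellular (Y : Type u) [TopologicalSpace Y] : Prop :=
  ∀ (W Z : Type u) [TopologicalSpace W] [TopologicalSpace Z] (p : W → Z), Nonempty W → HasDiscLift p →
    ∀ g : C(Y, Z), ∃ f : C(Y, W), ∀ y, p (f y) = g y

/-- `X` is a homotopy retract of a cellular space. -/
def IsDominated (X : Type u) [TopologicalSpace X] : Prop :=
  ∃ (Y : Type u) (_ : TopologicalSpace Y), IsCellular Y ∧ ∃ (f : C(X, Y)) (g : C(Y, X)),
    (ContinuousMap.id X).Homotopic (g.comp f)

theorem IsCellular.isDominated {Y : Type u} [TopologicalSpace Y] (h : IsCellular Y) : IsDominated Y :=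
  ⟨Y, _, h, .id Y, .id Y, .refl _⟩

theorem IsKPiOne.isDominated {X : Type u} [TopologicalSpace X] (h : IsKPiOne X) : IsDominated X := by
  obtain ⟨-, -, Y, _, _, ⟨K⟩, ⟨e⟩⟩ := h
  refine ⟨Y, _, fun W Z _ _ p _ hp g => ?_, e.toFun, e.invFun, e.left_inv.symm⟩
  obtain ⟨f, hf, h⟩ := (CellStructure.ofCWComplex Y).exists_lift (fun _ => isCompact_closedBall _ _)
    (fun _ => Metric.sphere_subset_closedBall) hp.cube g.continuous
  exact ⟨⟨f, hf⟩, h⟩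

theorem ESpace.isCellular (G : Type u) [Group G] :
    IsCellular (Quotient (MulAction.orbitRel G (ESpace G))) := by
  intro W Z _ _ p _ hp g
  obtain ⟨f, hf, h⟩ := (ESpace.cellStructure G).exists_lift (fun _ => isCompact_univ)
    (fun _ => Set.subset_univ _) hp.simplex g.continuous
  exact ⟨⟨f, hf⟩, h⟩

/-- Equivariant homotopies. -/
def EquivariantlyHomotopic (K : Type*) {A F : Type*} [TopologicalSpace A] [TopologicalSpace F] [SMul K A]
    [SMul K F] (φ ψ : C(A, F)) : Prop :=
  ∃ h : φ.Homotopy ψ, ∀ (k : K) (t : unitInterval) (a : A), h (t, k • a) = k • h (t, a)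

namespace EquivariantlyHomotopic

variable {K A F : Type*} [TopologicalSpace A] [TopologicalSpace F] [SMul K A] [SMul K F]

theorem symm {φ ψ : C(A, F)} (h : EquivariantlyHomotopic K φ ψ) : EquivariantlyHomotopic K ψ φ := by
  obtain ⟨h, hh⟩ := h
  exact ⟨h.symm, fun k t a => hh k _ a⟩

theorem trans {φ ψ χ : C(A, F)} (h : EquivariantlyHomotopic K φ ψ) (h' : EquivariantlyHomotopic K ψ χ) :
    EquivariantlyHomotopic K φ χ := by
  obtain ⟨h, hh⟩ := h
  obtain ⟨h', hh'⟩ := h'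
  refine ⟨h.trans h', fun k t a => ?_⟩
  simp only [ContinuousMap.Homotopy.trans_apply]
  split_ifs
  · exact hh k _ a
  · exact hh' k _ a

end EquivariantlyHomotopic

/-! ### Equivariant sections, maps and homotopies -/

section

variable {K A W : Type u} {X : Type u} [Group K] [TopologicalSpace A] [TopologicalSpace W]
  [TopologicalSpace X] [MulAction K A] [MulAction K W] [ContinuousConstSMul K A] [ContinuousConstSMul K W]
  {p : A → X}

/-- Sections exist over the cellular space `Y`, and `X` is only a homotopy retract of it. So the
identity of `A` is first deformed to the end `u` of the lifted homotopy, and `w` is a section over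
`u`. -/
theorem IsDominated.exists_section (hX : IsDominated X) (hp : IsQuotientCoveringMap p K) [Nonempty W] {f : W → A}
    (hfc : Continuous f) (hf : ∀ (k : K) w, f (k • w) = k • f w) (h : HasDiscLift f) :
    ∃ (u : C(A, A)) (w : C(A, W)), EquivariantlyHomotopic K (.id A) u ∧ (∀ a, f (w a) = u a) ∧
      ∀ (k : K) a, w (k • a) = k • w a := by
  obtain ⟨Y, _, hY, r, g, ⟨H⟩⟩ := hX
  let q : Quotient (MulAction.orbitRel K W) → X := Quotient.lift (p ∘ f) (by
    rintro _ w ⟨k, rfl⟩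
    exact (congrArg p (hf k w)).trans (hp.map_smul k))
  have hq : HasDiscLift q := h.orbits hp hfc hf fun w => rfl
  obtain ⟨s, hs⟩ := hY _ _ q ⟨Quotient.mk _ (Classical.arbitrary W)⟩ hq g
  let p' : C(A, X) := ⟨p, hp.continuous⟩
  let H' : C(unitInterval × A, X) := H.toContinuousMap.comp ((ContinuousMap.id _).prodMap p')
  have h0 : ∀ a, H' (0, a) = p (ContinuousMap.id A a) := fun a => H.apply_zero _
  let L := hp.isCoveringMap.liftHomotopy H' (.id A) h0
  have hL : ∀ x, p (L x) = H' x := fun x => congrFun (hp.isCoveringMap.liftHomotopy_lifts H' (.id A) h0) x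
  have hL0 : ∀ a, L (0, a) = a := fun a => hp.isCoveringMap.liftHomotopy_zero H' (.id A) h0 a
  -- Both sides lift the same path and start at the same point.
  have hLs : ∀ (k : K) (t : unitInterval) (a : A), L (t, k • a) = k • L (t, a) := by
    intro k t a
    refine congrFun (hp.isCoveringMap.eq_of_comp_eq (g₁ := fun t => L (t, k • a)) (g₂ := fun t => k • L (t, a))
      (by fun_prop) ((continuous_const_smul k).comp (by fun_prop)) (funext fun t => ?_) 0 ?_) t
    · simp only [Function.comp_apply]
      rw [hp.map_smul, hL, hL]
      exact congrArg (fun x => H (t, x)) (hp.map_smul k)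
    · exact (hL0 _).trans (congrArg (k • ·) (hL0 a)).symm
  let u : C(A, A) := ⟨fun a => L (1, a), by fun_prop⟩
  have hu : ∀ a, p (u a) = g (r (p a)) := fun a => (hL (1, a)).trans (H.apply_one _)
  obtain ⟨w, hw1, hw2⟩ := hp.exists_section hfc hf u.continuous (v := s ∘ r ∘ p)
    (s.continuous.comp (r.continuous.comp hp.continuous)) fun a w hw => by
      rw [hu, ← hs]
      exact congrArg q hw
  refine ⟨u, w, ⟨⟨L, hL0, fun a => rfl⟩, hLs⟩, hw1, fun k a => ?_⟩
  refine hp.eq_of_equivariant hf ?_ ?_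
  · rw [hf, hw1, hw1]
    exact hLs k 1 a
  · rw [hw2]
    refine Eq.trans ?_ (Quotient.sound (s := MulAction.orbitRel K W) ⟨k⁻¹, inv_smul_smul k (w a)⟩)
    rw [hw2]
    simp only [Function.comp_apply, hp.map_smul]

variable {F : Type u} [TopologicalSpace F] [MulAction K F] [ContinuousConstSMul K F]

/-- Equivariant maps `A → F` are the second components of equivariant sections of `A × F → A`. -/
theorem IsDominated.exists_equivariant (hX : IsDominated X) (hp : IsQuotientCoveringMap p K) [Nonempty A]
    (hF : DiscExtension F) : ∃ φ : C(A, F), ∀ (k : K) a, φ (k • a) = k • φ a := by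
  have : Nonempty F := by
    -- The sphere bounding the disc of dimension `0` is empty, so extending over that disc produces
    -- a point of `F`.
    obtain ⟨τ, -⟩ := hF 0 ⟨fun z => absurd z.2 (by
      rw [mem_sphere_zero_iff_norm, Subsingleton.elim (z : EuclideanSpace ℝ (Fin 0)) 0, norm_zero]
      norm_num), continuous_of_discreteTopology⟩
    exact ⟨τ ⟨0, by simp⟩⟩
  obtain ⟨u, w, -, -, h⟩ := hX.exists_section hp (W := A × F) continuous_fst (fun _ _ => rfl) (.fst hF)
  exact ⟨⟨fun a => (w a).2, by fun_prop⟩, fun k a => congrArg Prod.snd (h k a)⟩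

/-- Points of `A` together with paths in `F` connecting two images. -/
def PathsBetween (φ ψ : C(A, F)) : Type u :=
  {x : A × C(unitInterval, F) // x.2 0 = φ x.1 ∧ x.2 1 = ψ x.1}

instance (φ ψ : C(A, F)) : TopologicalSpace (PathsBetween φ ψ) := instTopologicalSpaceSubtype

-- By adjunction, a lift over a disc `D` is a map on `D × [0,1]` prescribed at both ends by `φ` and
-- `ψ` and on the sides by `σ`; the product is a convex body.
omit [Group K] [MulAction K A] [ContinuousConstSMul K A] [MulAction K F] [ContinuousConstSMul K F] in
theorem PathsBetween.hasDiscLift (hF : DiscExtension F) (φ ψ : C(A, F)) :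
    HasDiscLift (fun x : PathsBetween φ ψ => x.1.1) := by
  refine fun d => .of_subtype Metric.sphere_subset_closedBall fun χ σ hχσ => ?_
  let D := Metric.closedBall (0 : EuclideanSpace ℝ (Fin d)) 1
  let S := Metric.sphere (0 : EuclideanSpace ℝ (Fin d)) 1
  let R : Set (EuclideanSpace ℝ (Fin d) × ℝ) := D ×ˢ Set.Icc 0 1
  have hF' : HasDiscLift (fun _ : F => PUnit.unit.{1}) := by
    refine fun d => .of_subtype Metric.sphere_subset_closedBall fun _ σ _ => ?_
    obtain ⟨τ, hτ⟩ := hF d σ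
    exact ⟨τ, fun _ => rfl, hτ⟩
  have hint : (interior R).Nonempty := by
    rw [interior_prod_eq, interior_closedBall _ one_ne_zero, interior_Icc]
    exact ⟨(0, 1 / 2), Metric.mem_ball_self one_pos, by norm_num, by norm_num⟩
  have hlift := hF'.convexBody (s := R) ((convex_closedBall _ _).prod (convex_Icc 0 1))
    ((isCompact_closedBall _ _).prod isCompact_Icc) hint
  have hfr : frontier R = (D ×ˢ {0} ∪ D ×ˢ {1}) ∪ S ×ˢ Set.Icc 0 1 := by
    rw [frontier_prod_eq, Metric.isClosed_closedBall.closure_eq, isClosed_Icc.closure_eq,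
      frontier_closedBall _ one_ne_zero, frontier_Icc zero_le_one, Set.insert_eq, Set.prod_union]
  have : Nonempty A := ⟨χ ⟨0, Metric.mem_closedBall_self zero_le_one⟩⟩
  have : Nonempty F := ‹Nonempty A›.map φ
  have : Nonempty C(unitInterval, F) := this.map fun x => .const _ x
  obtain ⟨χ', hχc, hχ'⟩ := χ.exists_continuousOn_eq
  obtain ⟨σ', hσc, hσ'⟩ := ContinuousMap.exists_continuousOn_eq (s := S) (Z := C(unitInterval, F))
    ⟨fun z => (σ z).1.2, (continuous_subtype_val.comp σ.continuous).snd⟩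
  let ρ : EuclideanSpace ℝ (Fin d) × ℝ → F := fun x =>
    if x.2 = 0 then φ (χ' x.1) else if x.2 = 1 then ψ (χ' x.1)
      else σ' x.1 (Set.projIcc 0 1 zero_le_one x.2)
  have hρ0 : ∀ z, ρ (z, 0) = φ (χ' z) := fun z => if_pos rfl
  have hρ1 : ∀ z, ρ (z, 1) = ψ (χ' z) := fun z => (if_neg one_ne_zero).trans (if_pos rfl)
  have hρS : ∀ z ∈ S, ∀ t, ρ (z, t) = σ' z (Set.projIcc 0 1 zero_le_one t) := by
    intro z hz t
    have h1 : χ' z = (σ ⟨z, hz⟩).1.1 := (hχ' ⟨z, Metric.sphere_subset_closedBall hz⟩).trans (hχσ ⟨z, hz⟩).symm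
    have h2 : σ' z = (σ ⟨z, hz⟩).1.2 := hσ' ⟨z, hz⟩
    by_cases ht : t = 0
    · subst ht
      rw [hρ0, h1, h2, ← (σ ⟨z, hz⟩).2.1]
      congr 1
      exact (Set.projIcc_left (h := zero_le_one)).symm
    by_cases ht1 : t = 1
    · subst ht1
      rw [hρ1, h1, h2, ← (σ ⟨z, hz⟩).2.2]
      congr 1
      exact (Set.projIcc_right (h := zero_le_one)).symm
    · exact (if_neg ht).trans (if_neg ht1)
  have hρ : ContinuousOn ρ (frontier R) := by
    rw [hfr]
    have hDc : IsClosed D := Metric.isClosed_closedBall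
    have hm : ∀ a : ℝ, Set.MapsTo Prod.fst (D ×ˢ {a}) D := fun a x hx => hx.1
    refine ContinuousOn.union_of_isClosed (.union_of_isClosed ?_ ?_ (hDc.prod isClosed_singleton)
      (hDc.prod isClosed_singleton)) ?_ ((hDc.prod isClosed_singleton).union (hDc.prod isClosed_singleton))
      (Metric.isClosed_sphere.prod isClosed_Icc)
    · refine (φ.continuous.comp_continuousOn (hχc.comp continuousOn_fst (hm 0))).congr ?_
      rintro ⟨z, t⟩ ⟨-, ht⟩
      obtain rfl : t = 0 := ht
      exact hρ0 z
    · refine (ψ.continuous.comp_continuousOn (hχc.comp continuousOn_fst (hm 1))).congr ?_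
      rintro ⟨z, t⟩ ⟨-, ht⟩
      obtain rfl : t = 1 := ht
      exact hρ1 z
    · have h1 : ContinuousOn (fun x : EuclideanSpace ℝ (Fin d) × ℝ => σ' x.1) (S ×ˢ Set.Icc 0 1) :=
        hσc.comp continuousOn_fst fun x hx => hx.1
      have h2 : ContinuousOn (fun x : EuclideanSpace ℝ (Fin d) × ℝ =>
          Set.projIcc (0 : ℝ) 1 zero_le_one x.2) (S ×ˢ Set.Icc 0 1) :=
        (continuous_projIcc.comp continuous_snd).continuousOn
      refine (h1.eval h2).congr ?_
      rintro ⟨z, t⟩ ⟨hz, -⟩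
      exact hρS z hz t
  obtain ⟨τ, hτ1, hτ2, -⟩ := hlift (fun _ => PUnit.unit) ρ continuousOn_const hρ fun _ _ => rfl
  let g : C(D × unitInterval, F) := ⟨fun x => τ (x.1, x.2), hτ1.comp_continuous (by fun_prop) fun x =>
    ⟨x.1.2, x.2.2⟩⟩
  have hg : ∀ x : D × unitInterval, ((x.1 : EuclideanSpace ℝ (Fin d)), (x.2 : ℝ)) ∈ frontier R →
    g x = ρ (x.1, x.2) := fun x hx => hτ2 hx
  refine ⟨⟨fun z => ⟨(χ z, g.curry z), ?_, ?_⟩, ?_⟩, fun z => rfl, fun z => ?_⟩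
  · refine (hg (z, 0) ?_).trans ((hρ0 z).trans (congrArg φ (hχ' z)))
    rw [hfr]
    exact Or.inl (Or.inl ⟨z.2, rfl⟩)
  · refine (hg (z, 1) ?_).trans ((hρ1 z).trans (congrArg ψ (hχ' z)))
    rw [hfr]
    exact Or.inl (Or.inr ⟨z.2, rfl⟩)
  · exact Continuous.subtype_mk (χ.continuous.prodMk g.curry.continuous) _
  · refine Subtype.ext (Prod.ext (hχσ z).symm (ContinuousMap.ext fun t => ?_))
    refine (hg (⟨z, Metric.sphere_subset_closedBall z.2⟩, t) ?_).trans ((hρS z z.2 t).trans ?_)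
    · rw [hfr]
      exact Or.inr ⟨z.2, t.2⟩
    · have h2 : σ' z = (σ z).1.2 := hσ' z
      rw [h2, Set.projIcc_val]

/-- A section of the space of paths over `u` is a homotopy from `φ ∘ u` to `ψ ∘ u`, and `u` is
equivariantly homotopic to the identity. -/
theorem IsDominated.equivariantlyHomotopic (hX : IsDominated X) (hp : IsQuotientCoveringMap p K)
    (hF : DiscExtension F) {φ ψ : C(A, F)} (hφ : ∀ (k : K) a, φ (k • a) = k • φ a)
    (hψ : ∀ (k : K) a, ψ (k • a) = k • ψ a) (h : Nonempty (PathsBetween φ ψ)) :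
    EquivariantlyHomotopic K φ ψ := by
  let : MulAction K (PathsBetween φ ψ) :=
    { smul := fun k x => ⟨k • x.1, by
        refine ⟨?_, ?_⟩
        · exact (congrArg (k • ·) x.2.1).trans (hφ k _).symm
        · exact (congrArg (k • ·) x.2.2).trans (hψ k _).symm⟩
      one_smul := fun x => Subtype.ext (one_smul K x.1)
      mul_smul := fun k l x => Subtype.ext (mul_smul k l x.1) }
  have : ContinuousConstSMul K (PathsBetween φ ψ) :=
    ⟨fun k => Continuous.subtype_mk ((continuous_const_smul k).comp continuous_subtype_val) _⟩
  obtain ⟨u, w, hu, hw, hwk⟩ := hX.exists_section hp (W := PathsBetween φ ψ) (f := fun x => x.1.1)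
    (continuous_subtype_val.fst) (fun k x => rfl) (PathsBetween.hasDiscLift hF φ ψ)
  have hc : ∀ {χ : C(A, F)}, (∀ (k : K) a, χ (k • a) = k • χ a) →
      EquivariantlyHomotopic K χ (χ.comp u) := by
    intro χ hχ
    obtain ⟨h, hh⟩ := hu
    refine ⟨⟨χ.comp h.toContinuousMap, fun a => congrArg χ (h.apply_zero a),
      fun a => congrArg χ (h.apply_one a)⟩, fun k t a => ?_⟩
    exact (congrArg χ (hh k t a)).trans (hχ k _)
  refine (hc hφ).trans (.trans ?_ (hc hψ).symm)
  change C(A, PathsBetween φ ψ) at w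
  refine ⟨⟨⟨fun x => (w x.2).1.2 x.1, ?_⟩, fun a => ?_, fun a => ?_⟩, fun k t a => ?_⟩
  · exact ((continuous_subtype_val.comp w.continuous).snd.comp continuous_snd).eval continuous_fst
  · exact (w a).2.1.trans (congrArg φ (hw a))
  · exact (w a).2.2.trans (congrArg ψ (hw a))
  · change (w (k • a)).1.2 t = k • (w a).1.2 t
    rw [hwk]
    rfl

end

/-! ### Comparison of universal covers with classifying spaces -/

namespace UCover

section

variable {X : Type u} [TopologicalSpace X] {e : X} [LocallyPathConnectedSpace X]
  {G : Type u} [Group G] [MulAction G X] [ContinuousConstSMul G X]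

variable (G e) in
/-- The universal cover of a `K(π,1)` is equivariantly homotopy equivalent to the classifying space. -/
theorem exists_equivariant_maps (hX : SemilocallySimplyConnected X) (hG : IsCoveringAction G X)
    (hK : IsKPiOne X) :
    ∃ (φ : C(UCover e, ESpace (OrbitPathClass G e))) (ψ : C(ESpace (OrbitPathClass G e), UCover e)),
      (∀ (k : OrbitPathClass.loops G e) x, φ (k • x) = k • φ x) ∧
      (∀ (k : OrbitPathClass.loops G e) x, ψ (k • x) = k • ψ x) ∧
      EquivariantlyHomotopic (OrbitPathClass.loops G e) (ψ.comp φ) (.id (UCover e)) := by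
  have := hK.1
  have hp := isQuotientCoveringMap (e := e) hX hG
  have hc := hp.toContinuousConstSMul
  have hE : ContinuousConstSMul (OrbitPathClass.loops G e) (ESpace (OrbitPathClass G e)) :=
    ⟨fun h => continuous_const_smul (h : OrbitPathClass G e)⟩
  have hD := discExtension (e := e) hX hK.2.1
  obtain ⟨φ, hφ⟩ := hK.isDominated.exists_equivariant hp (DiscExtension.of_contractible (ESpace (OrbitPathClass G e)))
  have : Nonempty (ESpace (OrbitPathClass G e)) := ⟨.vertex 1⟩
  obtain ⟨ψ, hψ⟩ := (ESpace.isCellular (OrbitPathClass G e)).isDominated.exists_equivariant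
    ESpace.isCoveringAction.isQuotientCoveringMap_mk hD
  refine ⟨φ, ψ, hφ, fun k x => hψ k x, ?_⟩
  refine hK.isDominated.equivariantlyHomotopic hp hD (fun k x => ?_) (fun k x => rfl) ?_
  · rw [ContinuousMap.comp_apply, hφ]
    exact hψ k (φ x)
  · let p := PathConnectedSpace.somePath (ψ (φ (base e))) (base e)
    exact ⟨⟨(base e, p), p.source, p.target⟩⟩

-- With a trivial acting group, the identity factors up to homotopy through a contractible space
-- `|EΠ|`.
variable (e) in
theorem contractibleSpace (hX : SemilocallySimplyConnected X) (hK : IsKPiOne X) :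
    ContractibleSpace (UCover e) := by
  let : MulAction PUnit.{u + 1} X :=
    { smul := fun _ x => x, one_smul := fun _ => rfl, mul_smul := fun _ _ _ => rfl }
  have : ContinuousConstSMul PUnit.{u + 1} X := ⟨fun _ => continuous_id⟩
  obtain ⟨φ, ψ, -, -, h, -⟩ := exists_equivariant_maps (G := PUnit.{u + 1}) (e := e) hX (.of_nhds fun x =>
    ⟨Set.univ, Filter.univ_mem, fun _ _ _ _ => Subsingleton.elim _ _⟩) hK
  rw [contractible_iff_id_nullhomotopic]
  obtain ⟨x, hx⟩ := ((id_nullhomotopic (ESpace (OrbitPathClass PUnit.{u + 1} e))).comp_left φ).comp_right ψ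
  exact ⟨x, ContinuousMap.Homotopic.trans ⟨h.symm⟩ hx⟩

end

end UCover

/-! ### Little intervals -/

namespace OrderedIntervals

instance (k : ℕ) : ContractibleSpace (OrderedIntervals k) := by
  rw [contractible_iff_id_nullhomotopic]
  refine ⟨std k, ⟨⟨⟨fun x => linearPath x.2 (std k) x.1, ?_⟩, fun c => (linearPath c _).source,
    fun c => (linearPath c _).target⟩⟩⟩
  refine Continuous.subtype_mk (continuous_pi fun i => ?_) _
  have h : Continuous fun x : unitInterval × OrderedIntervals k => x.2.1 i :=
    (continuous_apply i).comp (continuous_subtype_val.comp continuous_snd)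
  have h1 := h.fst
  have h2 := h.snd
  fun_prop

theorem eq_of_strictMono {n : ℕ} {f : Fin n → Fin n} (hf : StrictMono f) (i : Fin n) : f i = i := by
  let e := StrictMono.orderIsoOfSurjective f hf (Finite.surjective_of_injective hf.injective)
  have : e = OrderIso.refl _ := Subsingleton.elim _ _
  exact congrArg (fun e : Fin n ≃o Fin n => e i) this

theorem blockEquiv_const_left {n : ℕ} (h : ∑ _ : Fin 1, n = n) (j : Fin n) :
    blockEquiv h ⟨0, j⟩ = j :=
  eq_of_strictMono (f := fun j => blockEquiv h ⟨0, j⟩) (fun _ _ hj => blockEquiv_lt_of_snd h hj) j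

theorem blockEquiv_const_right {n : ℕ} (h : ∑ _ : Fin n, 1 = n) (i : Fin n) :
    blockEquiv h ⟨i, 0⟩ = i :=
  eq_of_strictMono (f := fun i => blockEquiv h ⟨i, 0⟩) (fun _ _ hi => blockEquiv_lt_of_fst h hi) i

theorem blockEquiv_lt_iff {k : ℕ} {m : Fin k → ℕ} {n : ℕ} (h : ∑ i, m i = n)
    (i i' : Fin k) (j : Fin (m i)) (j' : Fin (m i')) : blockEquiv h ⟨i, j⟩ < blockEquiv h ⟨i', j'⟩ ↔
      i < i' ∨ ∃ _ : i = i', (j : ℕ) < j' := by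
  rcases lt_trichotomy i i' with hi | rfl | hi
  · exact iff_of_true (blockEquiv_lt_of_fst h hi) (Or.inl hi)
  · rcases lt_trichotomy j j' with hj | rfl | hj
    · exact iff_of_true (blockEquiv_lt_of_snd h hj) (Or.inr ⟨rfl, hj⟩)
    · exact iff_of_false (lt_irrefl _) (by simp)
    · refine iff_of_false (blockEquiv_lt_of_snd h hj).not_gt ?_
      rintro (h' | ⟨-, h'⟩)
      · exact lt_irrefl _ h'
      · exact lt_asymm h' hj
  · refine iff_of_false (blockEquiv_lt_of_fst h (p := ⟨i', j'⟩) (q := ⟨i, j⟩) hi).not_gt ?_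
    rintro (h' | ⟨rfl, -⟩)
    · exact lt_asymm h' hi
    · exact lt_irrefl _ hi

/-- Both sides number the triples `(i, j, r)` in lexicographic order, and a finite chain has only
one numbering. -/
theorem blockEquiv_assoc {k : ℕ} {m : Fin k → ℕ} {n : ℕ} (h : ∑ i, m i = n) {l : Fin n → ℕ} {N : ℕ}
    (hN : ∑ j, l j = N) (i : Fin k) (j : Fin (m i)) (r : Fin (l (blockEquiv h ⟨i, j⟩))) :
    blockEquiv hN ⟨blockEquiv h ⟨i, j⟩, r⟩ =
      blockEquiv (sum_blocks h hN) ⟨i, blockEquiv (m := fun j => l (blockEquiv h ⟨i, j⟩)) rfl ⟨j, r⟩⟩ := by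
  let T := (i : Fin k) × (j : Fin (m i)) × Fin (l (blockEquiv h ⟨i, j⟩))
  let f : T → Fin N := fun p => blockEquiv hN ⟨blockEquiv h ⟨p.1, p.2.1⟩, p.2.2⟩
  let g : T → Fin N := fun p => blockEquiv (sum_blocks h hN)
    ⟨p.1, blockEquiv (m := fun j => l (blockEquiv h ⟨p.1, j⟩)) rfl ⟨p.2.1, p.2.2⟩⟩
  have hsurj : Function.Surjective g := fun x => by
    obtain ⟨⟨i, y⟩, rfl⟩ := (blockEquiv (sum_blocks h hN)).surjective x
    obtain ⟨⟨j, r⟩, rfl⟩ := (blockEquiv (m := fun j => l (blockEquiv h ⟨i, j⟩)) rfl).surjective y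
    exact ⟨⟨i, j, r⟩, rfl⟩
  have hlt : ∀ p q, f p < f q ↔ g p < g q := by
    rintro ⟨i, j, r⟩ ⟨i', j', r'⟩
    simp only [f, g]
    rw [blockEquiv_lt_iff, blockEquiv_lt_iff, blockEquiv_lt_iff]
    constructor
    · rintro (h1 | ⟨h1, h2⟩)
      · rcases h1 with h1 | ⟨rfl, h1⟩
        · exact Or.inl h1
        · exact Or.inr ⟨rfl, Fin.lt_def.1 (blockEquiv_lt_of_fst (m := fun j => l (blockEquiv h ⟨i, j⟩)) rfl
            (p := ⟨j, r⟩) (q := ⟨j', r'⟩) (Fin.lt_def.2 h1))⟩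
      · have h3 := (blockEquiv h).injective h1
        simp only [Sigma.mk.injEq] at h3
        obtain ⟨rfl, h3⟩ := h3
        obtain rfl := eq_of_heq h3
        exact Or.inr ⟨rfl, Fin.lt_def.1 (blockEquiv_lt_of_snd (m := fun j => l (blockEquiv h ⟨i, j⟩)) rfl
          (Fin.lt_def.2 h2))⟩
    · rintro (h1 | ⟨rfl, h1⟩)
      · exact Or.inl (Or.inl h1)
      · rcases (blockEquiv_lt_iff (m := fun j => l (blockEquiv h ⟨i, j⟩)) rfl j j' r r').1
            (Fin.lt_def.2 h1) with h1 | ⟨rfl, h1⟩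
        · exact Or.inl (Or.inr ⟨rfl, Fin.lt_def.1 h1⟩)
        · exact Or.inr ⟨rfl, h1⟩
  let s := Function.surjInv hsurj
  have hs : ∀ x, g (s x) = x := Function.surjInv_eq hsurj
  have key : ∀ p, f p = g p := fun p => by
    have h1 : StrictMono fun x => f (s x) := fun x y hxy => (hlt _ _).2 (by rwa [hs, hs])
    have h2 := eq_of_strictMono h1 (g p)
    refine le_antisymm ?_ ?_
    · by_contra! h3
      rw [← h2] at h3
      have := (hlt _ _).1 h3
      rw [hs] at this
      exact lt_irrefl _ this
    · by_contra! h3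
      rw [← h2] at h3
      have := (hlt _ _).1 h3
      rw [hs] at this
      exact lt_irrefl _ this
  exact key ⟨i, j, r⟩

theorem comp_apply {k : ℕ} {m : Fin k → ℕ} {n : ℕ} (h : ∑ i, m i = n) (c : OrderedIntervals k)
    (d : ∀ i, OrderedIntervals (m i)) (i : Fin k) (j : Fin (m i)) :
    (comp h c d).1 (blockEquiv h ⟨i, j⟩) =
      ((c.1 i).1 + ((c.1 i).2 - (c.1 i).1) * ((d i).1 j).1,
        (c.1 i).1 + ((c.1 i).2 - (c.1 i).1) * ((d i).1 j).2) := by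
  have : ∀ p, (comp h c d).1 (blockEquiv h p) =
      ((c.1 p.1).1 + ((c.1 p.1).2 - (c.1 p.1).1) * ((d p.1).1 p.2).1,
        (c.1 p.1).1 + ((c.1 p.1).2 - (c.1 p.1).1) * ((d p.1).1 p.2).2) := by
    intro p
    simp only [comp]
    rw [Equiv.symm_apply_apply]
  exact this ⟨i, j⟩

theorem ext_blocks {k : ℕ} {m : Fin k → ℕ} {n : ℕ} (h : ∑ i, m i = n) {c d : OrderedIntervals n}
    (hcd : ∀ i j, c.1 (blockEquiv h ⟨i, j⟩) = d.1 (blockEquiv h ⟨i, j⟩)) : c = d := by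
  refine Subtype.ext (funext fun x => ?_)
  obtain ⟨⟨i, j⟩, rfl⟩ := (blockEquiv h).surjective x
  exact hcd i j

theorem std_one : (std 1).1 0 = (0, 1) := by simp [std]

theorem std_comp {n : ℕ} (h : ∑ _ : Fin 1, n = n) (d : OrderedIntervals n) :
    comp h (std 1) (fun _ => d) = d := by
  refine ext_blocks h fun i j => ?_
  obtain rfl : i = 0 := Subsingleton.elim _ _
  rw [comp_apply, std_one, blockEquiv_const_left]
  simp

theorem comp_std {n : ℕ} (h : ∑ _ : Fin n, 1 = n) (c : OrderedIntervals n) :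
    comp h c (fun _ => std 1) = c := by
  refine ext_blocks h fun i j => ?_
  obtain rfl : j = 0 := Subsingleton.elim _ _
  rw [comp_apply, std_one, blockEquiv_const_right]
  simp

theorem comp_comp {k : ℕ} {m : Fin k → ℕ} {n : ℕ} (h : ∑ i, m i = n) {l : Fin n → ℕ} {N : ℕ}
    (hN : ∑ j, l j = N) (a : OrderedIntervals k) (b : ∀ i, OrderedIntervals (m i))
    (c : ∀ j, OrderedIntervals (l j)) : comp hN (comp h a b) c =
      comp (sum_blocks h hN) a fun i => comp rfl (b i) fun j => c (blockEquiv h ⟨i, j⟩) := by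
  refine ext_blocks hN fun x r => ?_
  obtain ⟨⟨i, j⟩, rfl⟩ := (blockEquiv h).surjective x
  rw [comp_apply, comp_apply, blockEquiv_assoc, comp_apply, comp_apply]
  ext <;> dsimp only <;> ring

end OrderedIntervals

theorem TopOperad.γClass_mk {𝒢 : GroupOperadData.{u}} (C : TopOperad 𝒢) {k : ℕ} {m : Fin k → ℕ} {n : ℕ}
    (h : ∑ i, m i = n) {a a' : C.X k} {b b' : ∀ i, C.X (m i)} (f : Path a a') (g : ∀ i, Path (b i) (b' i)) :
    C.γClass h (.mk f) (fun i => .mk (g i)) = .mk (C.γPath h f g) := by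
  let S (i : Fin k) : Setoid (Path (b i) (b' i)) := Path.Homotopic.setoid (b i) (b' i)
  exact congrArg (Quotient.map₂ (fun f g => C.γPath h f g)
    (fun _ _ hf _ _ hg => C.γPath_homotopic h hf hg) (Path.Homotopic.Quotient.mk f))
    (Quotient.choice_eq (S := S) g)

namespace UCover

variable {X : Type u} [TopologicalSpace X] {e : X}

theorem exists_eq_mk (x : UCover e) : ∃ (y : X) (p : Path e y), x = ⟨y, .mk p⟩ := by
  obtain ⟨y, c⟩ := x
  induction c using Path.Homotopic.Quotient.ind with | mk p =>
  exact ⟨y, p, rfl⟩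

theorem exists_eq_along (x : UCover e) : ∃ (y : X) (p : Path (base e).pt y), x = (base e).along (.mk p) := by
  obtain ⟨y, p, rfl⟩ := x.exists_eq_mk
  exact ⟨y, p, (along_base (.mk p)).symm⟩

theorem smul_along_mk {G : Type u} [Group G] [MulAction G X] [ContinuousConstSMul G X]
    (a : OrbitPathClass G e) (w : UCover e) {y : X} (β : Path w.pt y) :
    a • w.along (.mk β) = (a • w).along (.mk (β.map (continuous_const_smul a.elt))) :=
  smul_along a w (.mk β)

theorem mk_trans_symm_trans {a z z' w : X} (E : z = z') (d : Path.Homotopic.Quotient e a)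
    (c : Path.Homotopic.Quotient a z) (D : Path.Homotopic.Quotient w z') :
    (⟨z', (d.trans (c.trans (D.symm.cast E rfl))).trans D⟩ : UCover e) = ⟨z, d.trans c⟩ := by
  subst E
  simp only [Path.Homotopic.Quotient.cast_rfl_rfl, Path.Homotopic.Quotient.trans_assoc,
    Path.Homotopic.Quotient.symm_trans, Path.Homotopic.Quotient.trans_refl]

end UCover

/-! ### The operad of universal covers -/

namespace GoodBasepoint

open UCover

variable {𝒢 : GroupOperadData.{u}} {C : TopOperad 𝒢} (η : GoodBasepoint C)

/-- The composition of universal covers. -/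
noncomputable def coverγ {k : ℕ} {m : Fin k → ℕ} {n : ℕ} (h : ∑ i, m i = n) (x : UCover (η.e k))
    (y : ∀ i, UCover (η.e (m i))) : UCover (η.e n) :=
  ⟨C.γ h x.pt fun i => (y i).pt, (η.δ h).trans (C.γClass h x.cls fun i => (y i).cls)⟩

/-- This reduces identities in the cover to the basepoints: the rest is the identity of `C`, applied
at each time of the paths. -/
theorem coverγ_along {k : ℕ} {m : Fin k → ℕ} {n : ℕ} (h : ∑ i, m i = n) (x : UCover (η.e k))
    (y : ∀ i, UCover (η.e (m i))) {x' : C.X k} {y' : ∀ i, C.X (m i)} (f : Path x.pt x')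
    (g : ∀ i, Path (y i).pt (y' i)) :
    η.coverγ h (x.along (.mk f)) (fun i => (y i).along (.mk (g i))) =
      (η.coverγ h x y).along (.mk (C.γPath h f g)) := by
  obtain ⟨a, p, rfl⟩ := x.exists_eq_mk
  choose b q hq using fun i => (y i).exists_eq_mk
  obtain rfl : y = fun i => ⟨b i, .mk (q i)⟩ := funext hq
  refine congrArg (UCover.mk _) ?_
  change (η.δ h).trans (C.γClass h ((Path.Homotopic.Quotient.mk p).trans (.mk f))
    fun i => (Path.Homotopic.Quotient.mk (q i)).trans (.mk (g i))) =
      ((η.δ h).trans (C.γClass h (.mk p) fun i => .mk (q i))).trans (.mk (C.γPath h f g))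
  simp only [← Path.Homotopic.Quotient.mk_trans]
  rw [C.γClass_mk, C.γClass_mk, Path.Homotopic.Quotient.trans_assoc, ← Path.Homotopic.Quotient.mk_trans]
  congr 2
  ext t
  simp only [TopOperad.γPath, Path.trans_apply, Path.coe_mk_mk]
  split_ifs <;> rfl

/-- The lift of `η` to the universal covers. -/
noncomputable def coverη {k : ℕ} (c : OrderedIntervals k) : UCover (η.e k) :=
  ⟨η.η k c, .mk ((OrderedIntervals.linearPath (OrderedIntervals.std k) c).map (η.continuous_η k))⟩

/-- Ordered intervals form a simply connected space, so any path may replace the linear one. -/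
theorem mk_map_η {k : ℕ} {c : OrderedIntervals k} (p : Path (OrderedIntervals.std k) c) :
    (⟨η.η k c, .mk (p.map (η.continuous_η k))⟩ : UCover (η.e k)) = η.coverη c := by
  refine congrArg (UCover.mk _) (Path.Homotopic.Quotient.eq.2 ?_)
  exact (SimplyConnectedSpace.paths_homotopic p _).map ⟨η.η k, η.continuous_η k⟩

theorem coverη_std (k : ℕ) : η.coverη (OrderedIntervals.std k) = base (η.e k) :=
  (η.mk_map_η (Path.refl _)).symm

theorem coverγ_base {k : ℕ} {m : Fin k → ℕ} {n : ℕ} (h : ∑ i, m i = n) :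
    η.coverγ h (base (η.e k)) (fun i => base (η.e (m i))) = (base (η.e n)).along (η.δ h) := by
  refine Eq.trans ?_ (along_base _).symm
  refine congrArg (UCover.mk _) ?_
  refine (congrArg (η.δ h).trans (?_ : _ = .refl _)).trans (Path.Homotopic.Quotient.trans_refl _)
  exact C.γClass_mk h (Path.refl _) fun i => Path.refl _

theorem _root_.OrderedIntervals.continuous_comp {Z : Type*} [TopologicalSpace Z] {k : ℕ} {m : Fin k → ℕ} {n : ℕ}
    (h : ∑ i, m i = n) {c : Z → OrderedIntervals k} {d : ∀ i, Z → OrderedIntervals (m i)} (hc : Continuous c)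
    (hd : ∀ i, Continuous (d i)) : Continuous fun z => OrderedIntervals.comp h (c z) fun i => d i z := by
  refine Continuous.subtype_mk (continuous_pi fun l => ?_) _
  have h1 : Continuous fun z => (c z).1 ((blockEquiv h).symm l).1 :=
    (continuous_apply _).comp (continuous_subtype_val.comp hc)
  have h2 : Continuous fun z => (d ((blockEquiv h).symm l).1 z).1 ((blockEquiv h).symm l).2 :=
    (continuous_apply _).comp (continuous_subtype_val.comp (hd _))
  have := h1.fst
  have := h1.snd
  have := h2.fst
  have := h2.snd
  fun_prop

/-- Both sides are classes of images of paths of ordered intervals with the same ends. At the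
basepoints this yields the coherence of the linear paths. -/
theorem coverγ_coverη {k : ℕ} {m : Fin k → ℕ} {n : ℕ} (h : ∑ i, m i = n) (c : OrderedIntervals k)
    (d : ∀ i, OrderedIntervals (m i)) :
    η.coverγ h (η.coverη c) (fun i => η.coverη (d i)) = η.coverη (OrderedIntervals.comp h c d) := by
  let p {k : ℕ} (c : OrderedIntervals k) := OrderedIntervals.linearPath (OrderedIntervals.std k) c
  have h1 := η.coverγ_along h (base (η.e k)) (fun i => base (η.e (m i))) ((p c).map (η.continuous_η k))
    fun i => (p (d i)).map (η.continuous_η (m i))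
  refine (congrArg₂ (η.coverγ h) (along_base _).symm (funext fun i => (along_base _).symm)).trans (h1.trans ?_)
  let P : Path (OrderedIntervals.comp h (OrderedIntervals.std k) fun i => OrderedIntervals.std (m i))
      (OrderedIntervals.comp h c d) :=
    { toFun := fun t => OrderedIntervals.comp h (p c t) fun i => p (d i) t
      continuous_toFun := OrderedIntervals.continuous_comp h (p c).continuous fun i => (p (d i)).continuous
      source' := by simp
      target' := by simp }
  let L := (p (OrderedIntervals.comp h (OrderedIntervals.std k) fun i => OrderedIntervals.std (m i)))
  have h2 : η.coverγ h (base (η.e k)) (fun i => base (η.e (m i))) =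
      (⟨_, .mk (L.map (η.continuous_η n))⟩ : UCover (η.e n)) := by
    rw [coverγ_base, along_base]
    exact mk_eq (η.η_comp h (OrderedIntervals.std k) fun i => OrderedIntervals.std (m i)) (.refl _)
  refine (along_congr_of_eq h2 (β' := P.map (η.continuous_η n)) fun t => ?_).trans ?_
  · exact (η.η_comp h _ _).symm
  · refine Eq.trans ?_ (η.mk_map_η (L.trans P))
    exact congrArg (UCover.mk _) ((Path.Homotopic.Quotient.mk_trans _ _).symm.trans
      (congrArg Path.Homotopic.Quotient.mk (Path.map_trans L P (η.continuous_η n)).symm))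

theorem coverγ_unit_left {n : ℕ} (h : ∑ _ : Fin 1, n = n) (a : UCover (η.e n)) :
    η.coverγ h (base (η.e 1)) (fun _ => a) = a := by
  obtain ⟨y, p, rfl⟩ := a.exists_eq_along
  have h1 := η.coverγ_along h (base (η.e 1)) (fun _ => base (η.e n)) (Path.refl _) fun _ => p
  refine (congrArg (fun w => η.coverγ h w _) (along_refl (base (η.e 1))).symm).trans (h1.trans ?_)
  refine along_congr_of_eq ?_ fun t => ?_
  · have h2 := η.coverγ_coverη h (OrderedIntervals.std 1) fun _ => OrderedIntervals.std n
    rwa [OrderedIntervals.std_comp, coverη_std, coverη_std] at h2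
  · exact (congrArg (fun w => C.γ h w fun _ => p t) η.η_unit).trans (C.isOperad.unit_γ h (p t))

theorem coverγ_unit_right {n : ℕ} (h : ∑ _ : Fin n, 1 = n) (a : UCover (η.e n)) :
    η.coverγ h a (fun _ => base (η.e 1)) = a := by
  obtain ⟨y, p, rfl⟩ := a.exists_eq_along
  have h1 := η.coverγ_along h (base (η.e n)) (fun _ => base (η.e 1)) p fun _ => Path.refl _
  refine (congrArg (η.coverγ h _) (funext fun _ => (along_refl (base (η.e 1))).symm)).trans (h1.trans ?_)
  refine along_congr_of_eq ?_ fun t => ?_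
  · have h2 := η.coverγ_coverη h (OrderedIntervals.std n) fun _ => OrderedIntervals.std 1
    rwa [OrderedIntervals.comp_std, coverη_std, coverη_std] at h2
  · exact (congrArg (C.γ h (p t)) (funext fun _ => η.η_unit)).trans (C.isOperad.γ_unit h (p t))

theorem coverγ_assoc {k : ℕ} {m : Fin k → ℕ} {n : ℕ} (h : ∑ i, m i = n) {l : Fin n → ℕ} {N : ℕ}
    (hN : ∑ j, l j = N) (a : UCover (η.e k)) (b : ∀ i, UCover (η.e (m i))) (c : ∀ j, UCover (η.e (l j))) :
    η.coverγ hN (η.coverγ h a b) c =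
      η.coverγ (sum_blocks h hN) a fun i => η.coverγ rfl (b i) fun j => c (blockEquiv h ⟨i, j⟩) := by
  obtain ⟨a', p, rfl⟩ := a.exists_eq_along
  choose b' q hq using fun i => (b i).exists_eq_along
  obtain rfl : b = fun i => (base _).along (.mk (q i)) := funext hq
  choose c' r hr using fun i => (c i).exists_eq_along
  obtain rfl : c = fun i => (base _).along (.mk (r i)) := funext hr
  refine (congrArg (fun w => η.coverγ hN w _) (η.coverγ_along h _ _ p q)).trans ?_
  refine (η.coverγ_along hN (η.coverγ h (base _) fun i => base _) (fun j => base _)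
    (C.γPath h p q) r).trans ?_
  refine Eq.trans ?_ (congrArg (η.coverγ (sum_blocks h hN) _) (funext fun i =>
    (η.coverγ_along rfl (base _) (fun j => base _) (q i) fun j => r (blockEquiv h ⟨i, j⟩)).symm))
  refine Eq.trans ?_ (η.coverγ_along (sum_blocks h hN) (base _)
    (fun i => η.coverγ rfl (base _) fun j => base _) p fun i => C.γPath rfl (q i) fun j => r (blockEquiv h ⟨i, j⟩)).symm
  refine along_congr_of_eq ?_ fun t => ?_
  · have h1 := congrArg η.coverη (OrderedIntervals.comp_comp h hN (OrderedIntervals.std k)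
      (fun i => OrderedIntervals.std (m i)) fun j => OrderedIntervals.std (l j))
    simpa only [← coverγ_coverη, coverη_std] using h1
  · exact C.isOperad.assoc h hN (p t) (fun i => q i t) fun j => r j t

/-- The last part of `pi1γ` is a reversed translated linear path; it cancels the linear path of
`coverγ` at the basepoints. -/
theorem coverγ_smul_base {k : ℕ} {m : Fin k → ℕ} {n : ℕ} (h : ∑ i, m i = n) (σ : η.Pi1 k)
    (τ : ∀ i, η.Pi1 (m i)) :
    η.coverγ h (σ • base (η.e k)) (fun i => τ i • base (η.e (m i))) =
      η.pi1γ h σ τ • η.coverγ (sum_perm h (𝒢.perm σ.elt)) (base (η.e k))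
        fun i => base (η.e (m ((𝒢.perm σ.elt).symm i))) := by
  have h1 : η.coverγ h (σ • base (η.e k)) (fun i => τ i • base (η.e (m i))) =
      η.coverγ h ⟨_, σ.path⟩ fun i => ⟨_, (τ i).path⟩ :=
    congrArg₂ (η.coverγ h) (smul_base _) (funext fun i => smul_base _)
  refine h1.trans ?_
  have h2 : η.pi1γ h σ τ • η.coverγ (sum_perm h (𝒢.perm σ.elt)) (base (η.e k))
        (fun i => base (η.e (m ((𝒢.perm σ.elt).symm i)))) =
      ⟨_, (η.pi1γ h σ τ).path.trans ((η.δ (sum_perm h (𝒢.perm σ.elt))).map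
        (OrbitPathClass.translate (η.pi1γ h σ τ).elt))⟩ := by
    refine (congrArg ((η.pi1γ h σ τ) • ·) (η.coverγ_base (sum_perm h (𝒢.perm σ.elt)))).trans ?_
    refine (smul_along _ _ _).trans ?_
    exact congrArg (UCover.mk _) (congrArg (fun c => Path.Homotopic.Quotient.trans c _)
      (Path.Homotopic.Quotient.trans_refl (η.pi1γ h σ τ).path))
  refine Eq.trans ?_ h2.symm
  exact (mk_trans_symm_trans (C.isOperad.equivariant h σ.elt (fun i => (τ i).elt) (η.e k) fun i => η.e (m i))
    (η.δ h) (C.γClass h σ.path fun i => (τ i).path) ((η.δ (sum_perm h (𝒢.perm σ.elt))).map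
        (OrbitPathClass.translate (η.pi1γ h σ τ).elt))).symm

theorem coverγ_smul_along {k : ℕ} {m : Fin k → ℕ} {n : ℕ} (h : ∑ i, m i = n) (σ : η.Pi1 k)
    (τ : ∀ i, η.Pi1 (m i)) (x : UCover (η.e k)) (y : ∀ i, UCover (η.e (m i))) {a : C.X k}
    {b : ∀ i, C.X (m i)} (p : Path x.pt a) (q : ∀ i, Path (y i).pt (b i)) :
    η.coverγ h (σ • x.along (.mk p)) (fun i => τ i • (y i).along (.mk (q i))) =
      (η.coverγ h (σ • x) fun i => τ i • y i).along (.mk (C.γPath h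
        (p.map (continuous_const_smul σ.elt)) fun i => (q i).map (continuous_const_smul (τ i).elt))) := by
  have h1 := η.coverγ_along h (σ • x) (fun i => τ i • y i) (p.map (continuous_const_smul σ.elt))
        fun i => (q i).map (continuous_const_smul (τ i).elt)
  refine Eq.trans ?_ h1
  rw [smul_along_mk σ x p]
  congr 1
  funext i
  rw [smul_along_mk (τ i) (y i) (q i)]

theorem coverγ_smul {k : ℕ} {m : Fin k → ℕ} {n : ℕ} (h : ∑ i, m i = n) (σ : η.Pi1 k)
    (τ : ∀ i, η.Pi1 (m i)) (a : UCover (η.e k)) (b : ∀ i, UCover (η.e (m i))) :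
    η.coverγ h (σ • a) (fun i => τ i • b i) =
      η.pi1γ h σ τ • η.coverγ (sum_perm h (𝒢.perm σ.elt)) a fun i => b ((𝒢.perm σ.elt).symm i) := by
  obtain ⟨a', p, rfl⟩ := a.exists_eq_along
  choose b' q hq using fun i => (b i).exists_eq_along
  obtain rfl : b = fun i => (base _).along (.mk (q i)) := funext hq
  let ρ := η.pi1γ h σ τ
  let P := C.γPath (sum_perm h (𝒢.perm σ.elt)) p fun i => q ((𝒢.perm σ.elt).symm i)
  let w := η.coverγ (sum_perm h (𝒢.perm σ.elt)) (base (η.e k)) fun i => base (η.e (m ((𝒢.perm σ.elt).symm i)))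
  have h1 : ρ • η.coverγ (sum_perm h (𝒢.perm σ.elt)) ((base _).along (.mk p)) (fun i =>
      (base _).along (.mk (q ((𝒢.perm σ.elt).symm i)))) = (ρ • w).along (.mk (P.map (continuous_const_smul ρ.elt))) :=
    (congrArg (ρ • ·) (η.coverγ_along (sum_perm h (𝒢.perm σ.elt)) (base (η.e k))
      (fun i => base (η.e (m ((𝒢.perm σ.elt).symm i)))) p fun i => q ((𝒢.perm σ.elt).symm i))).trans
      (smul_along_mk ρ w P)
  have h2 : η.coverγ h (σ • (base _).along (.mk p)) (fun i => τ i • (base _).along (.mk (q i))) =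
      (η.coverγ h (σ • base _) fun i => τ i • base _).along (.mk (C.γPath h
        (p.map (continuous_const_smul σ.elt)) fun i => (q i).map (continuous_const_smul (τ i).elt))) :=
    η.coverγ_smul_along h σ τ (base _) (fun i => base _) p q
  refine h2.trans (Eq.trans ?_ h1.symm)
  exact along_congr_of_eq (η.coverγ_smul_base h σ τ) fun t =>
    C.isOperad.equivariant h σ.elt (fun i => (τ i).elt) (p t) fun i => q i t

/-- The operad of universal covers. -/
noncomputable def cover : OperadData η.fundamental where
  X n := UCover (η.e n)
  top n := inferInstanceAs (TopologicalSpace (UCover (η.e n)))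
  action n := inferInstanceAs (MulAction (OrbitPathClass (𝒢.G n) (η.e n)) (UCover (η.e n)))
  continuous_smul n :=
    inferInstanceAs (ContinuousConstSMul (OrbitPathClass (𝒢.G n) (η.e n)) (UCover (η.e n)))
  unit := base (η.e 1)
  γ := η.coverγ

/-- Contract all the factors. Composing along the contractions gives a continuous homotopy in `C(n)`
starting at a constant; its lift ends at `coverγ`, by uniqueness of path lifting at each point of
`K`. -/
theorem continuousOn_coverγ [∀ k, LocallyPathConnectedSpace (C.X k)]
    [hc : ∀ k, ContractibleSpace (UCover (η.e k))] [∀ k, PathConnectedSpace (C.X k)]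
    (hX : ∀ k, SemilocallySimplyConnected (C.X k)) {k : ℕ} {m : Fin k → ℕ} {n : ℕ} (h : ∑ i, m i = n)
    {K : Set (UCover (η.e k) × ∀ i, UCover (η.e (m i)))} (hK : IsCompact K) :
    ContinuousOn (fun p => η.coverγ h p.1 p.2) K := by
  have hF : ∀ k, ∃ (y : UCover (η.e k)) (F : C(unitInterval × UCover (η.e k), UCover (η.e k))),
      (∀ x, F (0, x) = y) ∧ ∀ x, F (1, x) = x := fun k => by
    obtain ⟨y, F⟩ := id_nullhomotopic (UCover (η.e k))
    exact ⟨y, F.some.symm.toContinuousMap, fun x => F.some.symm.apply_zero x, fun x => F.some.symm.apply_one x⟩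
  choose y F hF0 hF1 using hF
  have : CompactSpace K := isCompact_iff_compactSpace.1 hK
  have hcont : Continuous fun p : unitInterval × K =>
      (((F k (p.1, p.2.1.1)).pt, fun i => (F (m i) (p.1, p.2.1.2 i)).pt) : C.X k × ∀ i, C.X (m i)) := by
    refine Continuous.prodMk (continuous_pt.comp ((F k).continuous.comp ?_)) (continuous_pi fun i =>
      continuous_pt.comp ((F (m i)).continuous.comp ?_)) <;> fun_prop
  let H : C(unitInterval × K, C.X n) :=
    ⟨fun p => C.γ h (F k (p.1, p.2.1.1)).pt fun i => (F (m i) (p.1, p.2.1.2 i)).pt,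
      (C.isOperad.continuousOn_γ h _ (isCompact_range hcont)).comp_continuous hcont fun p => Set.mem_range_self p⟩
  let w := η.coverγ h (y k) fun i => y (m i)
  have hH : ∀ κ, H (0, κ) = UCover.pt (ContinuousMap.const K w κ) := fun κ => by
    change C.γ h (F k (0, κ.1.1)).pt (fun i => (F (m i) (0, κ.1.2 i)).pt) = w.pt
    simp only [hF0]
    rfl
  let Λ := (UCover.isCoveringMap (hX n)).liftHomotopy H (.const K w) hH
  have hΛ : ∀ p, (Λ p).pt = H p := congrFun ((UCover.isCoveringMap (hX n)).liftHomotopy_lifts H _ hH)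
  have hΛ0 : ∀ κ, Λ (0, κ) = w := (UCover.isCoveringMap (hX n)).liftHomotopy_zero H _ hH
  rw [continuousOn_iff_continuous_domRestrict]
  have key : ∀ κ : K, η.coverγ h κ.1.1 κ.1.2 = Λ (1, κ) := fun κ => by
    let P : Path w (Λ (1, κ)) := ⟨⟨fun t => Λ (t, κ), by fun_prop⟩, hΛ0 κ, rfl⟩
    let Q : Path (y k) κ.1.1 := ⟨⟨fun t => F k (t, κ.1.1), by fun_prop⟩, hF0 k _, hF1 k _⟩
    let R (i : Fin k) : Path (y (m i)) (κ.1.2 i) :=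
      ⟨⟨fun t => F (m i) (t, κ.1.2 i), by fun_prop⟩, hF0 (m i) _, hF1 (m i) _⟩
    rw [UCover.apply_one_eq_along (hX n) P]
    refine (congrArg₂ (η.coverγ h) (UCover.apply_one_eq_along (hX k) Q)
      (funext fun i => UCover.apply_one_eq_along (hX (m i)) (R i))).trans ?_
    rw [coverγ_along]
    exact along_congr w fun t => (hΛ (t, κ)).symm
  have : K.domRestrict (fun p => η.coverγ h p.1 p.2) = fun κ => Λ (1, κ) := funext key
  rw [this]
  fun_prop

theorem cover_isOperad [∀ k, LocallyPathConnectedSpace (C.X k)] [∀ k, PathConnectedSpace (C.X k)]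
    (hX : ∀ k, SemilocallySimplyConnected (C.X k)) (hK : ∀ k, IsKPiOne (C.X k)) : η.cover.IsOperad where
  t2 n := by
    have := C.isOperad.t2 n
    exact (UCover.isCoveringMap (e := η.e n) (hX n)).t2Space
  compactlyGenerated n := by
    have := C.isOperad.t2 n
    have := C.isOperad.compactlyGenerated n
    exact (UCover.isCoveringMap (e := η.e n) (hX n)).isLocalHomeomorph.compactlyCoherentSpace
  zero := by
    obtain ⟨hu⟩ := C.isOperad.zero
    refine ⟨⟨⟨base (η.e 0)⟩, fun a => ?_⟩⟩
    obtain ⟨y, p, rfl⟩ := a.exists_eq_mk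
    obtain rfl : y = η.e 0 := Subsingleton.elim _ _
    exact congrArg (fun p => (⟨η.e 0, .mk p⟩ : UCover (η.e 0)))
      (Path.ext (funext fun t => Subsingleton.elim _ _) : p = Path.refl _)
  continuousOn_γ h K hKc := by
    have : ∀ k, ContractibleSpace (UCover (η.e k)) := fun k => UCover.contractibleSpace (η.e k) (hX k) (hK k)
    exact η.continuousOn_coverγ hX h hKc
  unit_γ := η.coverγ_unit_left
  γ_unit := η.coverγ_unit_right
  assoc := η.coverγ_assoc
  equivariant := η.coverγ_smul

end GoodBasepoint

/-! ### Group operads from free operads -/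

namespace OperadData

variable {𝒬 : GroupOperadData.{u}} (Z : OperadData 𝒬)

/-- Permutations reindex the arities, so inputs are compared in the total space. -/
theorem sigma_γ_congr {k : ℕ} {m m' : Fin k → ℕ} {n n' : ℕ} (h : ∑ i, m i = n) (h' : ∑ i, m' i = n')
    {x x' : Z.X k} (hx : x = x') {y : ∀ i, Z.X (m i)} {y' : ∀ i, Z.X (m' i)}
    (hy : ∀ i, (⟨m i, y i⟩ : Σ n, Z.X n) = ⟨m' i, y' i⟩) :
    (⟨n, Z.γ h x y⟩ : Σ n, Z.X n) = ⟨n', Z.γ h' x' y'⟩ := by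
  obtain rfl : m = m' := funext fun i => congrArg Sigma.fst (hy i)
  obtain rfl : y = y' := funext fun i => eq_of_heq (Sigma.mk.inj (hy i)).2
  subst h h' hx
  rfl

theorem γ_congr {k : ℕ} {m m' : Fin k → ℕ} {n : ℕ} (h : ∑ i, m i = n) (h' : ∑ i, m' i = n)
    {x x' : Z.X k} (hx : x = x') {y : ∀ i, Z.X (m i)} {y' : ∀ i, Z.X (m' i)}
    (hy : ∀ i, (⟨m i, y i⟩ : Σ n, Z.X n) = ⟨m' i, y' i⟩) : Z.γ h x y = Z.γ h' x' y' :=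
  eq_of_heq (Sigma.mk.inj (Z.sigma_γ_congr h h' hx hy)).2

end OperadData

theorem blockPerm_symm_apply {k : ℕ} {m : Fin k → ℕ} {n : ℕ} (h : ∑ i, m i = n) (σ : Equiv.Perm (Fin k))
    (τ : ∀ i, Equiv.Perm (Fin (m i))) (i : Fin k) (j : Fin (m (σ.symm i))) :
    (blockPerm h σ τ).symm (blockEquiv (sum_perm h σ) ⟨i, j⟩) =
      blockEquiv h ⟨σ.symm i, (τ (σ.symm i)).symm j⟩ := by
  have h1 : ((Equiv.sigmaCongrRight τ).trans (Equiv.sigmaCongrLeft' σ)).symm ⟨i, j⟩ =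
      ⟨σ.symm i, (τ (σ.symm i)).symm j⟩ := rfl
  simp only [blockPerm, Equiv.symm_trans_apply, Equiv.symm_symm, Equiv.symm_apply_apply]
  rw [← h1, Equiv.symm_trans_apply]

/-- A group operad is determined by a free action on an operad. -/
theorem GroupOperadData.isGroupOperad_of_free {𝒬 : GroupOperadData.{u}} {Z : OperadData 𝒬} (hZ : Z.IsOperad)
    (hne : ∀ n, Nonempty (Z.X n)) (hfree : ∀ n (g g' : 𝒬.G n) (x : Z.X n), g • x = g' • x → g = g')
    (hperm : ∀ {k : ℕ} {m : Fin k → ℕ} {n : ℕ} (h : ∑ i, m i = n) (a : 𝒬.G k) (b : ∀ i, 𝒬.G (m i)),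
      𝒬.perm (𝒬.γ h a b) = blockPerm h (𝒬.perm a) fun i => 𝒬.perm (b i)) : 𝒬.IsGroupOperad where
  zero := by
    obtain ⟨hu⟩ := hZ.zero
    exact ⟨fun g g' => hfree 0 g g' default (Subsingleton.elim _ _)⟩
  one_γ {n} h a := by
    obtain ⟨x⟩ := hne n
    refine hfree _ _ _ x ?_
    have h1 := hZ.equivariant h 1 (fun _ => a) Z.unit fun _ => x
    rw [one_smul, hZ.unit_γ] at h1
    exact ((congrArg (𝒬.γ h 1 (fun _ => a) • ·) (hZ.unit_γ _ x)).symm.trans h1.symm)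
  γ_one {n} h a := by
    obtain ⟨x⟩ := hne n
    refine hfree _ _ _ x ?_
    have h1 := hZ.equivariant h a (fun _ => 1) x fun _ => Z.unit
    simp only [one_smul] at h1
    rw [hZ.γ_unit] at h1
    exact ((congrArg (𝒬.γ h a (fun _ => 1) • ·) (hZ.γ_unit _ x)).symm.trans h1.symm)
  assoc {k m n} h {l N} hN a b c := by
    obtain ⟨x⟩ := hne k
    let y : ∀ i, Z.X (m i) := fun i => (hne (m i)).some
    let z : ∀ j, Z.X (l j) := fun j => (hne (l j)).some
    have h1 := hZ.assoc h hN (a • x) (fun i => b i • y i) fun j => c j • z j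
    -- Equivariance collects the group elements on the left of both sides; freeness then identifies
    -- them.
    simp only [hZ.equivariant] at h1
    rw [hZ.assoc (sum_perm h (𝒬.perm a))] at h1
    refine hfree _ _ _ _ (h1.trans (congrArg _ (Z.γ_congr _ _ rfl fun i => ?_)))
    refine Z.sigma_γ_congr _ _ rfl fun j => ?_
    rw [hperm, blockPerm_symm_apply]
  perm_γ := hperm
  crossed {k m n} h a a' b b' := by
    obtain ⟨x⟩ := hne k
    let y : ∀ i, Z.X (m i) := fun i => (hne (m i)).some
    have h1 := hZ.equivariant h (a * a') (fun i => b i * b' i) x y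
    simp only [mul_smul] at h1
    rw [hZ.equivariant, hZ.equivariant] at h1
    rw [← mul_smul] at h1
    refine hfree _ _ _ _ (h1.symm.trans (congrArg _ (Z.γ_congr _ _ rfl fun i => ?_)))
    have : (𝒬.perm (a * a')).symm i = (𝒬.perm a).symm ((𝒬.perm a').symm i) := by
      simp [GroupOperadData.perm, ← Equiv.Perm.inv_def]
    rw [this]

/-- By the crossed law the composite of identities is an idempotent of a group. -/
theorem GroupOperadData.IsGroupOperad.γ_one_one {𝒢 : GroupOperadData.{u}} (h𝒢 : 𝒢.IsGroupOperad) {k : ℕ}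
    {m : Fin k → ℕ} {n : ℕ} (h : ∑ i, m i = n) : 𝒢.γ h 1 (fun i => (1 : 𝒢.G (m i))) = 1 := by
  have h1 := h𝒢.crossed h 1 1 (fun i => 1) fun i => 1
  have h2 : ∀ σ : Equiv.Perm (Fin k), σ = 1 → 𝒢.γ (sum_perm h σ) (1 : 𝒢.G k) (fun i => 1) = 𝒢.γ h 1 fun i => 1 := by
    rintro _ rfl
    rfl
  rw [h2 _ (by simp [GroupOperadData.perm])] at h1
  simpa using h1

namespace GoodBasepoint

variable {𝒢 : GroupOperadData.{u}} {C : TopOperad 𝒢} (η : GoodBasepoint C)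

theorem isNormalNonCrossed (h𝒢 : 𝒢.IsGroupOperad) : η.fundamental.IsNormalNonCrossed η.loops where
  normal n := MonoidHom.normal_ker (η.toBase n)
  π_eq_one n g hg := (congrArg (𝒢.π n) hg).trans (map_one _)
  γ_mem {k m n} h a b ha hb := by
    have h1 : a.elt = 1 := ha
    have h2 : (fun i => (b i).elt) = fun i => 1 := funext hb
    exact (congrArg₂ (𝒢.γ h) h1 h2).trans (h𝒢.γ_one_one h)

theorem fundamental_isGroupOperad [∀ k, LocallyPathConnectedSpace (C.X k)] [∀ k, PathConnectedSpace (C.X k)]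
    (h𝒢 : 𝒢.IsGroupOperad) (hcov : C.IsCovering) (hX : ∀ k, SemilocallySimplyConnected (C.X k))
    (hK : ∀ k, IsKPiOne (C.X k)) : η.fundamental.IsGroupOperad := by
  refine GroupOperadData.isGroupOperad_of_free (η.cover_isOperad hX hK) (fun n => ⟨UCover.base (η.e n)⟩)
    (fun n g g' x h => ?_) fun h a b => h𝒢.perm_γ h a.elt fun i => (b i).elt
  refine (inv_mul_eq_one.1 ((UCover.isCoveringAction (e := η.e n) (hX n) (hcov n)).eq_one (x := x) ?_)).symm
  exact (mul_smul g'⁻¹ g x).trans (inv_smul_eq_iff.2 h)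

end GoodBasepoint

/-! ### The fundamental group of the orbit space -/

namespace OrbitPathClass

variable {G X : Type u} [Group G] [TopologicalSpace X] [MulAction G X] [ContinuousConstSMul G X] {e : X}

theorem toQuotient_mul (x y : OrbitPathClass G e) : (x * y).toQuotient = x.toQuotient.trans y.toQuotient := by
  obtain ⟨g, p, rfl⟩ := x.exists_ofPath
  obtain ⟨h, q, rfl⟩ := y.exists_ofPath
  rw [ofPath_mul]
  refine congrArg Path.Homotopic.Quotient.mk (Path.ext (funext fun t => ?_))
  have h1 : ∀ x : X, Quotient.mk (MulAction.orbitRel G X) (g • x) = Quotient.mk (MulAction.orbitRel G X) x :=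
    fun x => Quotient.sound (s := MulAction.orbitRel G X) (MulAction.mem_orbit x g)
  change Quotient.mk (MulAction.orbitRel G X) ((p.trans (q.map (continuous_const_smul g))) t) = _
  rw [Path.trans_apply, Path.trans_apply]
  split_ifs
  · rfl
  · exact h1 _

/-- `X → X/G` is a covering: loops lift to paths ending in the orbit, lifts of homotopic loops are
homotopic with the same end, and freeness recovers `g` from `g e`. -/
theorem toQuotient_bijective (hG : IsCoveringAction G X) :
    Function.Bijective (OrbitPathClass.toQuotient (G := G) (e := e)) := by
  have hp := hG.isQuotientCoveringMap_mk.isCoveringMap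
  constructor
  · intro x y hxy
    obtain ⟨g, p, rfl⟩ := x.exists_ofPath
    obtain ⟨h, q, rfl⟩ := y.exists_ofPath
    have h1 := Path.Homotopic.Quotient.eq.1 hxy
    have hl {g : G} (p : Path e (g • e)) (hp0) : p.toContinuousMap =
        hp.liftPath ((ContinuousMap.mk (Quotient.mk (MulAction.orbitRel G X)) continuous_quotient_mk').comp
          p.toContinuousMap) e hp0 := (hp.eq_liftPath_iff' _).2 ⟨rfl, p.source⟩
    have h2 := hp.liftPath_apply_one_eq_of_homotopicRel h1 e (by simp) (by simp)
    have h3 : g • e = h • e := by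
      have e1 := congrArg (fun f : C(unitInterval, X) => f 1) (hl p (by simp))
      have e2 := congrArg (fun f : C(unitInterval, X) => f 1) (hl q (by simp))
      exact (p.target.symm.trans e1).trans (h2.trans (e2.symm.trans q.target))
    have h4 : g = h := by
      refine (inv_mul_eq_one.1 (hG.eq_one (x := e) ?_)).symm
      rw [mul_smul, h3, inv_smul_smul]
    subst h4
    refine congrArg (OrbitPathClass.mk g) (hp.injective_path_homotopic_map _ _ ?_)
    exact Path.Homotopic.Quotient.eq.2 h1
  · intro c
    induction c using Path.Homotopic.Quotient.ind with | mk q =>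
    let L := hp.liftPath q.toContinuousMap e q.source
    have hL : ∀ t, Quotient.mk (MulAction.orbitRel G X) (L t) = q t :=
      congrFun (hp.liftPath_lifts q.toContinuousMap e q.source)
    obtain ⟨g, hg⟩ : ∃ g : G, g • e = L 1 :=
      Quotient.exact (s := MulAction.orbitRel G X) ((hL 1).trans q.target)
    refine ⟨ofPath g ⟨L, hp.liftPath_zero q.toContinuousMap e q.source, hg.symm⟩, ?_⟩
    exact congrArg Path.Homotopic.Quotient.mk (Path.ext (funext hL))

end OrbitPathClass

/-! ### Local sections -/

/-- Maps with continuous sections near every point. -/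
def HasLocalSections {W B : Type*} [TopologicalSpace W] [TopologicalSpace B] (p : W → B) : Prop :=
  ∀ b, ∃ (U : Set B) (s : B → W), IsOpen U ∧ b ∈ U ∧ ContinuousOn s U ∧ ∀ x ∈ U, p (s x) = x

theorem IsLocalHomeomorph.hasLocalSections {W B : Type*} [TopologicalSpace W] [TopologicalSpace B] {p : W → B}
    (hp : IsLocalHomeomorph p) (hs : Function.Surjective p) : HasLocalSections p := fun b => by
  obtain ⟨w, rfl⟩ := hs b
  obtain ⟨f, hf, rfl⟩ := hp w
  exact ⟨f.target, f.symm, f.open_target, f.map_source hf, f.continuousOn_symm, fun x hx => f.right_inv hx⟩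

namespace HasLocalSections

theorem prodMap {W B W' B' : Type*} [TopologicalSpace W] [TopologicalSpace B] [TopologicalSpace W']
    [TopologicalSpace B'] {p : W → B} {q : W' → B'} (hp : HasLocalSections p) (hq : HasLocalSections q) :
    HasLocalSections (Prod.map p q) := fun b => by
  obtain ⟨U, s, hU, hbU, hs, hps⟩ := hp b.1
  obtain ⟨V, t, hV, hbV, ht, hqt⟩ := hq b.2
  exact ⟨U ×ˢ V, Prod.map s t, hU.prod hV, ⟨hbU, hbV⟩, hs.prodMap ht,
    fun x hx => Prod.ext (hps _ hx.1) (hqt _ hx.2)⟩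

theorem piMap {ι : Type*} [Finite ι] {W B : ι → Type*} [∀ i, TopologicalSpace (W i)]
    [∀ i, TopologicalSpace (B i)] {p : ∀ i, W i → B i} (hp : ∀ i, HasLocalSections (p i)) :
    HasLocalSections (Pi.map p) := fun b => by
  choose U s hU hbU hs hps using fun i => hp i (b i)
  refine ⟨Set.univ.pi U, Pi.map s, isOpen_set_pi Set.finite_univ fun i _ => hU i, fun i _ => hbU i, ?_,
    fun x hx => funext fun i => hps i _ (hx i trivial)⟩
  exact continuousOn_pi.2 fun i => (hs i).comp (continuous_apply i).continuousOn fun x hx => hx i trivial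

/-- Near a point of `K`, transport a compact piece upstairs by a local section; this replaces
lifting the compact set as a whole. -/
theorem continuousOn {W B T : Type*} [TopologicalSpace W] [TopologicalSpace B] [TopologicalSpace T] [T2Space B]
    {p : W → B} (hp : HasLocalSections p) {g : B → T} (hg : ∀ K, IsCompact K → ContinuousOn (g ∘ p) K)
    {K : Set B} (hK : IsCompact K) : ContinuousOn g K := fun b hb => by
  obtain ⟨U, s, hU, hbU, hs, hps⟩ := hp b
  obtain ⟨L, V, hL, hLU, -, hV, hbV, hVL⟩ := exists_isCompact_nhdsWithin hK hU hb hbU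
  have h1 : ContinuousOn g L := ((hg _ (hL.image_of_continuousOn (hs.mono hLU))).comp (hs.mono hLU)
    (Set.mapsTo_image s L)).congr fun x hx => by simp [hps x (hLU hx)]
  exact (h1 b (hVL ⟨hbV, hb⟩)).mono_of_mem_nhdsWithin
    (Filter.mem_of_superset (inter_mem_nhdsWithin _ (hV.mem_nhds hbV)) fun x hx => hVL ⟨hx.2, hx.1⟩)

end HasLocalSections

/-! ### Orbit spaces -/

theorem IsCoveringAction.hasLocalSections {G X : Type*} [Group G] [TopologicalSpace X] [MulAction G X]
    [ContinuousConstSMul G X] (h : IsCoveringAction G X) (H : Subgroup G) :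
    HasLocalSections (Quotient.mk (MulAction.orbitRel H X)) := by
  have : ContinuousConstSMul H X := ⟨fun k => continuous_const_smul (k : G)⟩
  exact (h.subgroup H).isQuotientCoveringMap_mk.isCoveringMap.isLocalHomeomorph.hasLocalSections Quotient.mk_surjective

/-- The map of orbit spaces induced by an equivariant map. -/
def orbitMap {K A B : Type*} [Group K] [TopologicalSpace A] [TopologicalSpace B] [MulAction K A] [MulAction K B]
    (f : C(A, B)) (hf : ∀ (k : K) a, f (k • a) = k • f a) :
    C(Quotient (MulAction.orbitRel K A), Quotient (MulAction.orbitRel K B)) where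
  toFun := Quotient.map f (by
    rintro _ a ⟨k, rfl⟩
    exact ⟨k, (hf k a).symm⟩)
  continuous_toFun := f.continuous.quotient_map' _

/-- The orbit projection is open, so its product with the interval is still a quotient map. -/
theorem EquivariantlyHomotopic.orbitMap {K A B : Type*} [Group K] [TopologicalSpace A] [TopologicalSpace B]
    [MulAction K A] [MulAction K B] [ContinuousConstSMul K A] {f g : C(A, B)} (h : EquivariantlyHomotopic K f g)
    (hf : ∀ (k : K) a, f (k • a) = k • f a) (hg : ∀ (k : K) a, g (k • a) = k • g a) :
    (orbitMap f hf).Homotopic (orbitMap g hg) := by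
  obtain ⟨h, hh⟩ := h
  have hq : Topology.IsQuotientMap (Prod.map id (Quotient.mk (MulAction.orbitRel K A)) : unitInterval × A → _) :=
    (IsOpenMap.id.prodMap isOpenMap_quotient_mk'_mul).isQuotientMap
      (continuous_id.prodMap continuous_quotient_mk')
      (Function.surjective_id.prodMap Quotient.mk_surjective)
  let F : unitInterval × Quotient (MulAction.orbitRel K A) → Quotient (MulAction.orbitRel K B) := fun p =>
    Quotient.map (fun a => h (p.1, a)) (by
      rintro _ a ⟨k, rfl⟩
      exact ⟨k, (hh k p.1 a).symm⟩) p.2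
  have hF : Continuous F := hq.continuous_iff.2
    ((continuous_quotient_mk' (s := MulAction.orbitRel K B)).comp h.continuous)
  refine ⟨⟨⟨F, hF⟩, fun a => ?_, fun a => ?_⟩⟩ <;> induction a using Quotient.ind with | _ a => ?_
  · exact congrArg (Quotient.mk (MulAction.orbitRel K B)) (h.apply_zero a)
  · exact congrArg (Quotient.mk (MulAction.orbitRel K B)) (h.apply_one a)

theorem isHomotopyEquivalence_orbitMap {K A B : Type*} [Group K] [TopologicalSpace A] [TopologicalSpace B]
    [MulAction K A] [MulAction K B] [ContinuousConstSMul K A] [ContinuousConstSMul K B] {f : C(A, B)} {g : C(B, A)}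
    (hf : ∀ (k : K) a, f (k • a) = k • f a) (hg : ∀ (k : K) a, g (k • a) = k • g a)
    (hgf : EquivariantlyHomotopic K (g.comp f) (.id A)) (hfg : EquivariantlyHomotopic K (f.comp g) (.id B)) :
    IsHomotopyEquivalence (orbitMap f hf) := by
  refine ⟨orbitMap g hg, ?_, ?_⟩
  · convert hgf.orbitMap (fun k a => by simp [hf, hg]) (fun k a => rfl) using 1
    · ext a
      induction a using Quotient.ind with | _ a => rfl
    · ext a
      induction a using Quotient.ind with | _ a => rfl
  · convert hfg.orbitMap (fun k a => by simp [hf, hg]) (fun k a => rfl) using 1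
    · ext a
      induction a using Quotient.ind with | _ a => rfl
    · ext a
      induction a using Quotient.ind with | _ a => rfl

/-! ### Quotient operads -/

namespace GoodBasepoint

variable {𝒢 : GroupOperadData.{u}} {C : TopOperad 𝒢} (η : GoodBasepoint C) [∀ k, PathConnectedSpace (C.X k)]

/-- The quotient of an operad over `π₁(C/𝒢)` by `π₁C`. -/
noncomputable def orbits (Z : OperadData η.fundamental) : OperadData 𝒢 where
  X n := KerQuotient (η.toBase n) (Z.X n)
  action n := kerQuotientAction (E := Z.X n) (η.toBase n) (fun g => η.lift g) fun _ => rfl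
  continuous_smul n :=
    letI := kerQuotientAction (E := Z.X n) (η.toBase n) (fun g => η.lift g) fun _ => rfl
    ⟨fun g => continuous_quot_lift _
      (continuous_quot_mk.comp (continuous_const_smul (η.lift g)))⟩
  unit := Quotient.mk _ Z.unit
  γ h x y := Quotient.mk _ (Z.γ h (Quotient.out x) fun i => Quotient.out (y i))

variable {Z : OperadData η.fundamental}

/-- The projection to the quotient operad. -/
noncomputable def orbitMk {n : ℕ} (x : Z.X n) : (η.orbits Z).X n := Quotient.mk _ x

theorem orbitMk_surjective {n : ℕ} : Function.Surjective (η.orbitMk (Z := Z) (n := n)) := Quotient.mk_surjective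

theorem toBase_smul_orbitMk {n : ℕ} (f : η.fundamental.G n) (x : Z.X n) :
    η.toBase n f • η.orbitMk x = η.orbitMk (f • x) :=
  kerQuotientAction_mk (η.toBase n) (fun g => η.lift g) (fun _ => rfl) f x

theorem orbitMk_eq_iff {n : ℕ} {x y : Z.X n} : η.orbitMk x = η.orbitMk y ↔ ∃ k : η.loops n, k • y = x :=
  Quotient.eq (r := MulAction.orbitRel (η.toBase n).ker (Z.X n))

-- Loops induce the identity permutation, so the inputs are not reindexed.
omit [∀ k, PathConnectedSpace (C.X k)] in
theorem γ_loops_smul (hZ : Z.IsOperad) {k : ℕ} {m : Fin k → ℕ} {n : ℕ} (h : ∑ i, m i = n) {a : η.fundamental.G k}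
    (b : ∀ i, η.fundamental.G (m i)) (ha : a ∈ η.loops k) (x : Z.X k) (y : ∀ i, Z.X (m i)) :
    Z.γ h (a • x) (fun i => b i • y i) = η.fundamental.γ h a b • Z.γ h x y := by
  rw [hZ.equivariant]
  congr 1
  refine Z.γ_congr _ _ rfl fun i => ?_
  have h1 : η.fundamental.perm a = 1 := by
    have : η.fundamental.π k a = 1 := (congrArg (𝒢.π k) ha).trans (map_one _)
    rw [GroupOperadData.perm, this, MulOpposite.unop_one]
  rw [h1]
  rfl

/-- Chosen representatives differ from the given ones by loops, and a composite of loops is a loop.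
-/
theorem orbits_γ (h𝒢 : 𝒢.IsGroupOperad) (hZ : Z.IsOperad) {k : ℕ} {m : Fin k → ℕ} {n : ℕ} (h : ∑ i, m i = n)
    (x : Z.X k) (y : ∀ i, Z.X (m i)) :
    (η.orbits Z).γ h (η.orbitMk x) (fun i => η.orbitMk (y i)) = η.orbitMk (Z.γ h x y) := by
  have hout : ∀ {n : ℕ} (x : Z.X n), ∃ a : η.loops n, a • x =
      Quotient.out (s := MulAction.orbitRel (η.toBase n).ker (Z.X n)) (η.orbitMk x) := fun x =>
    Quotient.mk_out (s := MulAction.orbitRel (η.toBase _).ker (Z.X _)) x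
  obtain ⟨a, ha⟩ := hout x
  choose b hb using fun i => hout (y i)
  refine (η.orbitMk_eq_iff (Z := Z)).2 ⟨⟨η.fundamental.γ h a fun i => b i,
    (η.isNormalNonCrossed h𝒢).γ_mem h _ _ a.2 fun i => (b i).2⟩, ?_⟩
  exact (η.γ_loops_smul hZ h (fun i => (b i : η.fundamental.G (m i))) a.2 x y).symm.trans
    (congrArg₂ (Z.γ h) ha (funext hb))

theorem orbits_isOperad (h𝒢 : 𝒢.IsGroupOperad) (hZ : Z.IsOperad)
    (hcov : ∀ n, IsCoveringAction (η.fundamental.G n) (Z.X n)) (ht2 : ∀ n, T2Space ((η.orbits Z).X n)) :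
    (η.orbits Z).IsOperad where
  t2 := ht2
  compactlyGenerated n := by
    have := hZ.compactlyGenerated n
    exact (isQuotientMap_quot_mk (r := (MulAction.orbitRel (η.toBase n).ker (Z.X n)))).compactlyCoherentSpace
  zero := by
    obtain ⟨hu⟩ := hZ.zero
    refine ⟨⟨⟨η.orbitMk default⟩, fun x => ?_⟩⟩
    obtain ⟨x, rfl⟩ := η.orbitMk_surjective x
    exact congrArg _ (Subsingleton.elim _ _)
  continuousOn_γ {k m n} h K hK := by
    refine HasLocalSections.continuousOn (p := Prod.map (η.orbitMk (Z := Z) (n := k))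
      (Pi.map fun i => η.orbitMk (Z := Z) (n := m i))) ?_ (fun L hL => ?_) hK
    · exact ((hcov k).hasLocalSections _).prodMap (.piMap fun i => (hcov (m i)).hasLocalSections _)
    · have h1 : ContinuousOn (fun p => η.orbitMk (Z.γ h p.1 p.2)) L :=
        continuous_quotient_mk'.comp_continuousOn (hZ.continuousOn_γ h L hL)
      exact h1.congr fun p _ => η.orbits_γ h𝒢 hZ h p.1 p.2
  unit_γ h a := by
    obtain ⟨a, rfl⟩ := η.orbitMk_surjective a
    exact (η.orbits_γ h𝒢 hZ h Z.unit fun _ => a).trans (congrArg _ (hZ.unit_γ h a))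
  γ_unit h a := by
    obtain ⟨a, rfl⟩ := η.orbitMk_surjective a
    exact (η.orbits_γ h𝒢 hZ h a fun _ => Z.unit).trans (congrArg _ (hZ.γ_unit h a))
  assoc h l N hN a b c := by
    obtain ⟨a, rfl⟩ := η.orbitMk_surjective a
    choose b' hb using fun i => η.orbitMk_surjective (b i)
    obtain rfl : (fun i => η.orbitMk (b' i)) = b := funext hb
    choose c' hc using fun i => η.orbitMk_surjective (c i)
    obtain rfl : (fun i => η.orbitMk (c' i)) = c := funext hc
    rw [η.orbits_γ h𝒢 hZ, η.orbits_γ h𝒢 hZ, hZ.assoc h hN]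
    simp only [η.orbits_γ h𝒢 hZ]
  equivariant {k m n} h σ τ a b := by
    obtain ⟨a, rfl⟩ := η.orbitMk_surjective a
    choose b' hb using fun i => η.orbitMk_surjective (b i)
    obtain rfl : (fun i => η.orbitMk (b' i)) = b := funext hb
    have h1 := hZ.equivariant h (η.lift σ) (fun i => η.lift (τ i)) a b'
    have h2 := (η.orbits_γ h𝒢 hZ h (η.lift σ • a) fun i => η.lift (τ i) • b' i).trans (congrArg _ h1)
    refine h2.trans ?_
    refine (η.toBase_smul_orbitMk _ _).symm.trans ?_
    exact congrArg (𝒢.γ h σ τ • ·) (η.orbits_γ h𝒢 hZ (sum_perm h (𝒢.perm σ)) a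
      fun i => b' ((𝒢.perm σ).symm i)).symm

/-- If `g` moves the image of `u ∈ U` back into the image of `U`, some loop times a lift of `g`
moves `u` back into `U` and is therefore `1`; its image in `G_n` is `g`. -/
theorem isCoveringAction_orbits {n : ℕ} (hcov : IsCoveringAction (η.fundamental.G n) (Z.X n)) :
    IsCoveringAction (𝒢.G n) ((η.orbits Z).X n) := by
  refine .of_nhds fun x => ?_
  obtain ⟨x, rfl⟩ := η.orbitMk_surjective x
  obtain ⟨U, hU, hxU, h⟩ := hcov.exists_nhds x
  have : ContinuousConstSMul (η.toBase n).ker (Z.X n) :=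
    ⟨fun k => continuous_const_smul (k : η.fundamental.G n)⟩
  have hopen : IsOpenMap (Quotient.mk (MulAction.orbitRel (η.toBase n).ker (Z.X n))) := isOpenMap_quotient_mk'_mul
  refine ⟨η.orbitMk '' U, (hopen U hU).mem_nhds ⟨x, hxU, rfl⟩, ?_⟩
  rintro g _ ⟨u, hu, rfl⟩ ⟨v, hv, hgv⟩
  have h1 : η.orbitMk v = η.orbitMk (η.lift g • u) := hgv.trans (η.toBase_smul_orbitMk (η.lift g) u)
  obtain ⟨⟨k, hk⟩, hkv⟩ := η.orbitMk_eq_iff.1 h1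
  have h2 : k * η.lift g = 1 := h _ u hu (by
    rw [mul_smul]
    exact Set.mem_of_eq_of_mem hkv hv)
  have h3 := congrArg (η.toBase n) h2
  rw [map_mul, map_one, show η.toBase n k = 1 from hk, one_mul] at h3
  exact h3

end GoodBasepoint

/-! ### Products of operads -/

theorem CompactCoherentification.continuous_of_continuous {A Z W : Type*} [TopologicalSpace A] [LocallyCompactSpace A]
    [TopologicalSpace Z] [CompactlyCoherentSpace Z] [TopologicalSpace W] {f : A × Z → CompactCoherentification W}
    (hA : CompactSpace A) (hf : Continuous ((CompactCoherentification.mk W).symm ∘ f)) : Continuous f :=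
  ESpace.continuous_of_continuousOn_univ_prod fun _ hK =>
    (CompactCoherentification.continuousOn_rng_of_isCompact (isCompact_univ.prod hK)).2 hf.continuousOn

instance {X Y : Type*} [TopologicalSpace X] [TopologicalSpace Y] {G : Type*} [Group G] [MulAction G X] [MulAction G Y] :
    MulAction G (CompactCoherentification (X × Y)) := inferInstanceAs (MulAction G (X × Y))

instance {X Y : Type*} [TopologicalSpace X] [TopologicalSpace Y] {G : Type*} [Group G] [MulAction G X] [MulAction G Y]
    [ContinuousConstSMul G X] [ContinuousConstSMul G Y] :
    ContinuousConstSMul G (CompactCoherentification (X × Y)) :=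
  ⟨fun g => CompactCoherentification.continuous_map_of_continuous (continuous_const_smul g : Continuous fun p : X × Y => g • p)⟩

namespace KProd

variable {X Y : Type*} [TopologicalSpace X] [TopologicalSpace Y]

/-- The projections of the product in the category of compactly generated spaces. -/
noncomputable def fst : C(CompactCoherentification (X × Y), X) :=
  ⟨fun p => ((CompactCoherentification.mk (X × Y)).symm p).1, continuous_fst.comp CompactCoherentification.continuous_mk_symm⟩

/-- The projections of the product in the category of compactly generated spaces. -/
noncomputable def snd : C(CompactCoherentification (X × Y), Y) :=
  ⟨fun p => ((CompactCoherentification.mk (X × Y)).symm p).2, continuous_snd.comp CompactCoherentification.continuous_mk_symm⟩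

/-- The pairing of maps to a product in the category of compactly generated spaces. -/
noncomputable def pair {Z : Type*} [TopologicalSpace Z] [CompactlyCoherentSpace Z] (f : C(Z, X)) (g : C(Z, Y)) :
    C(Z, CompactCoherentification (X × Y)) :=
  ⟨fun z => CompactCoherentification.mk (X × Y) (f z, g z), by
    rw [CompactlyCoherentSpace.isCoherentWith.continuous_iff]
    exact fun K hK => (CompactCoherentification.continuousOn_rng_of_isCompact hK).2
      (f.continuous.prodMk g.continuous).continuousOn⟩

theorem _root_.EquivariantlyHomotopic.kprod {Z K : Type*} [TopologicalSpace Z] [CompactlyCoherentSpace Z] [Group K]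
    [MulAction K X] [MulAction K Y] [MulAction K Z] {f f' : C(Z, X)} {g g' : C(Z, Y)}
    (hf : EquivariantlyHomotopic K f f') (hg : EquivariantlyHomotopic K g g') :
    EquivariantlyHomotopic K (pair f g) (pair f' g') := by
  obtain ⟨h, hh⟩ := hf
  obtain ⟨h', hh'⟩ := hg
  refine ⟨⟨⟨fun p => CompactCoherentification.mk (X × Y) (h p, h' p), ?_⟩, fun z => ?_, fun z => ?_⟩, fun k t z => ?_⟩
  · exact CompactCoherentification.continuous_of_continuous inferInstance (h.continuous.prodMk h'.continuous)
  · exact congrArg₂ (fun x y => CompactCoherentification.mk (X × Y) (x, y)) (h.apply_zero z) (h'.apply_zero z)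
  · exact congrArg₂ (fun x y => CompactCoherentification.mk (X × Y) (x, y)) (h.apply_one z) (h'.apply_one z)
  · exact congrArg₂ (fun x y => CompactCoherentification.mk (X × Y) (x, y)) (hh k t z) (hh' k t z)

end KProd

/-- The product of two operads. -/
noncomputable def OperadData.prod {𝒬 : GroupOperadData.{u}} (Z W : OperadData 𝒬) : OperadData 𝒬 where
  X n := CompactCoherentification (Z.X n × W.X n)
  unit := CompactCoherentification.mk _ (Z.unit, W.unit)
  γ h x y := CompactCoherentification.mk _ (Z.γ h (KProd.fst x) fun i => KProd.fst (y i), W.γ h (KProd.snd x) fun i => KProd.snd (y i))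

theorem OperadData.IsOperad.prod {𝒬 : GroupOperadData.{u}} {Z W : OperadData 𝒬} (hZ : Z.IsOperad) (hW : W.IsOperad) :
    (Z.prod W).IsOperad where
  t2 n := by
    have := hZ.t2 n
    have := hW.t2 n
    exact inferInstanceAs (T2Space (CompactCoherentification (Z.X n × W.X n)))
  compactlyGenerated n := inferInstanceAs (CompactlyCoherentSpace (CompactCoherentification (Z.X n × W.X n)))
  zero := by
    obtain ⟨hu⟩ := hZ.zero
    obtain ⟨hv⟩ := hW.zero
    exact ⟨⟨⟨(default, default)⟩, fun x => Prod.ext (Subsingleton.elim _ _) (Subsingleton.elim _ _)⟩⟩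
  continuousOn_γ {k m n} h K hK := by
    have h1 : Continuous (Prod.map KProd.fst (Pi.map fun i => KProd.fst) :
        (Z.prod W).X k × (∀ i, (Z.prod W).X (m i)) → Z.X k × ∀ i, Z.X (m i)) :=
      KProd.fst.continuous.prodMap (.piMap fun i => KProd.fst.continuous)
    have h2 : Continuous (Prod.map KProd.snd (Pi.map fun i => KProd.snd) :
        (Z.prod W).X k × (∀ i, (Z.prod W).X (m i)) → W.X k × ∀ i, W.X (m i)) :=
      KProd.snd.continuous.prodMap (.piMap fun i => KProd.snd.continuous)
    let f : (Z.prod W).X k × (∀ i, (Z.prod W).X (m i)) → CompactCoherentification (Z.X n × W.X n) :=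
      fun p => (Z.prod W).γ h p.1 p.2
    refine (CompactCoherentification.continuousOn_rng_of_isCompact (f := f) hK).2 ?_
    exact ((hZ.continuousOn_γ h _ (hK.image h1)).comp h1.continuousOn (Set.mapsTo_image _ _)).prodMk
      ((hW.continuousOn_γ h _ (hK.image h2)).comp h2.continuousOn (Set.mapsTo_image _ _))
  unit_γ h a := Prod.ext (hZ.unit_γ h a.1) (hW.unit_γ h a.2)
  γ_unit h a := Prod.ext (hZ.γ_unit h a.1) (hW.γ_unit h a.2)
  assoc h _ _ hN a b c := Prod.ext (hZ.assoc h hN a.1 (fun i => (b i).1) fun j => (c j).1)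
    (hW.assoc h hN a.2 (fun i => (b i).2) fun j => (c j).2)
  equivariant h σ τ a b := Prod.ext (hZ.equivariant h σ τ a.1 fun i => (b i).1)
    (hW.equivariant h σ τ a.2 fun i => (b i).2)

theorem IsCoveringAction.kprod {G X Y : Type*} [Group G] [TopologicalSpace X] [TopologicalSpace Y] [MulAction G X]
    [MulAction G Y] (h : IsCoveringAction G X) : IsCoveringAction G (CompactCoherentification (X × Y)) := by
  refine .of_nhds fun x => ?_
  obtain ⟨U, hU, hxU, h⟩ := h.exists_nhds (KProd.fst x)
  exact ⟨KProd.fst ⁻¹' U, (hU.preimage KProd.fst.continuous).mem_nhds hxU, fun g u hu hgu => h g _ hu hgu⟩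

/-- If the first coordinates are in one orbit, align them by `k` and separate the second
coordinates; the covering neighbourhood excludes all other translations. Otherwise separate in
`X/G`. -/
theorem t2Space_orbits_kprod {G X Y : Type*} [Group G] [TopologicalSpace X] [TopologicalSpace Y] [MulAction G X]
    [MulAction G Y] [ContinuousConstSMul G X] [ContinuousConstSMul G Y] [T2Space Y] (h : IsCoveringAction G X)
    [T2Space (Quotient (MulAction.orbitRel G X))] :
    T2Space (Quotient (MulAction.orbitRel G (CompactCoherentification (X × Y)))) := by
  refine t2Space_orbits fun x y hxy => ?_
  by_cases hq : ∃ k : G, k • KProd.fst y = KProd.fst x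
  · obtain ⟨k, hk⟩ := hq
    obtain ⟨U, hU, hxU, hUk⟩ := h.exists_nhds (KProd.fst x)
    have hne : KProd.snd x ≠ k • KProd.snd y := fun h' => hxy k (Prod.ext hk h'.symm)
    obtain ⟨V, V', hV, hV', hxV, hyV, hVV⟩ := t2_separation hne
    refine ⟨KProd.fst ⁻¹' U ∩ KProd.snd ⁻¹' V, ((hU.preimage KProd.fst.continuous).inter
      (hV.preimage KProd.snd.continuous)).mem_nhds ⟨hxU, hxV⟩, (k • ·) ⁻¹' (KProd.fst ⁻¹' U ∩ KProd.snd ⁻¹' V'),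
      (((hU.preimage KProd.fst.continuous).inter (hV'.preimage KProd.snd.continuous)).preimage
        (continuous_const_smul k)).mem_nhds ⟨(Set.mem_of_eq_of_mem hk hxU : k • KProd.fst y ∈ U), hyV⟩, ?_⟩
    rintro g v ⟨hv, hv'⟩ ⟨hgv, hgv'⟩
    have h1 : g * k⁻¹ = 1 := hUk (g * k⁻¹) (k • KProd.fst v) hv (by
      rw [mul_smul, inv_smul_smul]
      exact hgv)
    obtain rfl : g = k := mul_inv_eq_one.1 h1
    exact Set.disjoint_left.1 hVV hgv' hv'
  · have hne : Quotient.mk (MulAction.orbitRel G X) (KProd.fst x) ≠ Quotient.mk (MulAction.orbitRel G X) (KProd.fst y) :=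
      fun h' => hq (Quotient.exact h')
    obtain ⟨V, V', hV, hV', hxV, hyV, hVV⟩ := t2_separation hne
    have hc : Continuous fun x : CompactCoherentification (X × Y) => Quotient.mk (MulAction.orbitRel G X) (KProd.fst x) :=
      continuous_quotient_mk'.comp KProd.fst.continuous
    refine ⟨_, (hV.preimage hc).mem_nhds hxV, _, (hV'.preimage hc).mem_nhds hyV, fun g v hv hgv => ?_⟩
    refine Set.disjoint_left.1 hVV hgv ?_
    have h1 : Quotient.mk (MulAction.orbitRel G X) (KProd.fst (g • v)) = Quotient.mk (MulAction.orbitRel G X) (KProd.fst v) :=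
      Quotient.sound (s := MulAction.orbitRel G X) (MulAction.mem_orbit (KProd.fst v) g)
    exact Set.mem_of_eq_of_mem h1 hv

namespace EquivariantlyHomotopic

variable {K A B F : Type*} [TopologicalSpace A] [TopologicalSpace B] [TopologicalSpace F] [SMul K A] [SMul K B] [SMul K F]

theorem refl {φ : C(A, F)} (h : ∀ (k : K) a, φ (k • a) = k • φ a) : EquivariantlyHomotopic K φ φ :=
  ⟨.refl φ, fun k _ a => h k a⟩

theorem comp_left {φ ψ : C(A, B)} (h : EquivariantlyHomotopic K φ ψ) {f : C(B, F)}
    (hf : ∀ (k : K) a, f (k • a) = k • f a) : EquivariantlyHomotopic K (f.comp φ) (f.comp ψ) := by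
  obtain ⟨h, hh⟩ := h
  exact ⟨(ContinuousMap.Homotopy.refl f).comp h, fun k t a => (congrArg f (hh k t a)).trans (hf k _)⟩

theorem comp_right {φ ψ : C(B, F)} (h : EquivariantlyHomotopic K φ ψ) {f : C(A, B)}
    (hf : ∀ (k : K) a, f (k • a) = k • f a) : EquivariantlyHomotopic K (φ.comp f) (ψ.comp f) := by
  obtain ⟨h, hh⟩ := h
  exact ⟨h.comp (ContinuousMap.Homotopy.refl f), fun k t a => (congrArg (fun b => h (t, b)) (hf k a)).trans (hh k t _)⟩

end EquivariantlyHomotopic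

/-- Concatenation commutes with translation, so sliding the cut point joins the two maps
equivariantly. -/
theorem ESpace.equivariantlyHomotopic {G : Type u} [Group G] (H : Subgroup G) {Z : Type*} [TopologicalSpace Z]
    [CompactlyCoherentSpace Z] [SMul H Z] {f g : C(Z, ESpace G)} (hf : ∀ (k : H) a, f (k • a) = k • f a)
    (hg : ∀ (k : H) a, g (k • a) = k • g a) : EquivariantlyHomotopic H f g := by
  refine ⟨⟨⟨fun p => concat p.1 (f p.2) (g p.2), continuous_concat f.continuous g.continuous⟩,
    fun z => concat_zero _ _, fun z => concat_one _ _⟩, fun k t z => ?_⟩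
  change concat t (f (k • z)) (g (k • z)) = k • concat t (f z) (g z)
  rw [hf, hg]
  exact smul_concat (k : G) t _ _

theorem Homeomorph.isHomotopyEquivalence {X Y : Type*} [TopologicalSpace X] [TopologicalSpace Y] (f : X ≃ₜ Y) :
    IsHomotopyEquivalence (f : C(X, Y)) :=
  ⟨f.symm, by simp [ContinuousMap.Homotopic.refl], by simp [ContinuousMap.Homotopic.refl]⟩

namespace GoodBasepoint

variable {𝒢 : GroupOperadData.{u}} {C : TopOperad 𝒢} (η : GoodBasepoint C) [∀ k, PathConnectedSpace (C.X k)]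

/-- Only `f` has to respect the operads and the full groups. The inverses and homotopies need
equivariance under the loops alone, since between covering operads ordinary homotopy equivalences of
the orbit spaces are enough. -/
theorem exists_isEquivalence_orbits (h𝒢 : 𝒢.IsGroupOperad) {Z W : OperadData η.fundamental} (hZ : Z.IsOperad)
    (hW : W.IsOperad) (hZ' : (η.orbits Z).IsOperad) (hW' : (η.orbits W).IsOperad)
    (cZ : ∀ n, IsCoveringAction (η.fundamental.G n) (Z.X n)) (cW : ∀ n, IsCoveringAction (η.fundamental.G n) (W.X n))
    (f : ∀ n, C(Z.X n, W.X n)) (g : ∀ n, C(W.X n, Z.X n))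
    (hf : ∀ n (a : η.fundamental.G n) x, f n (a • x) = a • f n x)
    (hg : ∀ n (a : η.loops n) x, g n (a • x) = a • g n x) (hf1 : f 1 Z.unit = W.unit)
    (hfγ : ∀ {k : ℕ} {m : Fin k → ℕ} {n : ℕ} (h : ∑ i, m i = n) (a : Z.X k) (b : ∀ i, Z.X (m i)),
      f n (Z.γ h a b) = W.γ h (f k a) fun i => f (m i) (b i))
    (hgf : ∀ n, EquivariantlyHomotopic (η.loops n) ((g n).comp (f n)) (.id _))
    (hfg : ∀ n, EquivariantlyHomotopic (η.loops n) ((f n).comp (g n)) (.id _)) :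
    ∃ ψ : OperadHom ⟨η.orbits Z, hZ'⟩ ⟨η.orbits W, hW'⟩, ψ.IsEquivalence := by
  have cs {Z : OperadData η.fundamental} (n : ℕ) : ContinuousConstSMul (η.loops n) (Z.X n) :=
    ⟨fun k => continuous_const_smul (k : η.fundamental.G n)⟩
  have hfl (n) (a : η.loops n) (x) : f n (a • x) = a • f n x := hf n a x
  have hmk {n : ℕ} (x : Z.X n) : orbitMap (f n) (hfl n) (η.orbitMk x) = η.orbitMk (f n x) := rfl
  refine ⟨⟨fun n => orbitMap (f n) (hfl n), fun n => (orbitMap (f n) (hfl n)).continuous, fun n a x => ?_, ?_,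
    fun {k m n} h a b => ?_⟩, Or.inr ⟨fun n => ?_, fun n => η.isCoveringAction_orbits (cZ n),
      fun n => η.isCoveringAction_orbits (cW n)⟩⟩
  · obtain ⟨x, rfl⟩ := η.orbitMk_surjective x
    have h1 := congrArg (orbitMap (f n) (hfl n)) (η.toBase_smul_orbitMk (η.lift a) x)
    refine h1.trans ?_
    refine (congrArg η.orbitMk (hf n (η.lift a) x)).trans ?_
    exact (η.toBase_smul_orbitMk (η.lift a) (f n x)).symm
  · exact congrArg η.orbitMk hf1
  · obtain ⟨a, rfl⟩ := η.orbitMk_surjective a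
    choose b' hb using fun i => η.orbitMk_surjective (b i)
    obtain rfl : (fun i => η.orbitMk (b' i)) = b := funext hb
    refine (congrArg (orbitMap (f n) (hfl n)) (η.orbits_γ h𝒢 hZ h a b')).trans ?_
    refine (congrArg η.orbitMk (hfγ h a b')).trans ?_
    exact (η.orbits_γ h𝒢 hW h (f k a) fun i => f (m i) (b' i)).symm
  · exact isHomotopyEquivalence_orbitMap (hfl n) (hg n) (hgf n) (hfg n)

/-! ### The zigzag -/

variable [∀ k, LocallyPathConnectedSpace (C.X k)]

/-- The orbit spaces of the universal covers under the fundamental groups. -/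
noncomputable def coverHomeomorph (hcov : C.IsCovering) (hX : ∀ k, SemilocallySimplyConnected (C.X k)) (n : ℕ) :
    (η.orbits η.cover).X n ≃ₜ C.X n :=
  have hq := UCover.isQuotientCoveringMap (e := η.e n) (hX n) (hcov n)
  Equiv.toHomeomorphOfContinuousOpen
    (Equiv.ofBijective (Quotient.lift (UCover.pt : UCover (η.e n) → C.X n) fun _ _ h => hq.apply_eq_iff_mem_orbit.2 h) (by
      constructor
      · intro x y h
        induction x using Quotient.ind with | _ x =>
        induction y using Quotient.ind with | _ y =>
        exact Quotient.sound (s := MulAction.orbitRel (η.toBase n).ker (η.cover.X n)) (hq.apply_eq_iff_mem_orbit.1 h)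
      · intro x
        obtain ⟨w, rfl⟩ := UCover.surjective_pt (e := η.e n) x
        exact ⟨Quotient.mk _ w, rfl⟩))
    (UCover.continuous_pt.quotient_lift _)
    (by
      intro U hU
      have := UCover.isOpenMap_pt (hX n) _ (hU.preimage continuous_quotient_mk')
      convert this using 1
      ext x
      constructor
      · rintro ⟨y, hy, rfl⟩
        induction y using Quotient.ind with | _ y =>
        exact ⟨y, hy, rfl⟩
      · rintro ⟨y, hy, rfl⟩
        exact ⟨_, hy, rfl⟩)

theorem exists_isEquivalence_cover (h𝒢 : 𝒢.IsGroupOperad) (hcov : C.IsCovering)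
    (hX : ∀ k, SemilocallySimplyConnected (C.X k)) (hZ : η.cover.IsOperad) (hZ' : (η.orbits η.cover).IsOperad) :
    ∃ ψ : OperadHom ⟨η.orbits η.cover, hZ'⟩ C, ψ.IsEquivalence := by
  let q := η.coverHomeomorph hcov hX
  have hq {n : ℕ} (x : η.cover.X n) : q n (η.orbitMk x) = UCover.pt x := rfl
  refine ⟨⟨fun n => q n, fun n => (q n).continuous, fun n a x => ?_, η.η_unit, fun {k m n} h a b => ?_⟩,
    Or.inr ⟨fun n => (q n).isHomotopyEquivalence, fun n => η.isCoveringAction_orbits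
      (UCover.isCoveringAction (e := η.e n) (hX n) (hcov n)), hcov⟩⟩
  · obtain ⟨x, rfl⟩ := η.orbitMk_surjective x
    exact congrArg (q n) (η.toBase_smul_orbitMk (η.lift a) x)
  · obtain ⟨a, rfl⟩ := η.orbitMk_surjective a
    choose b' hb using fun i => η.orbitMk_surjective (b i)
    obtain rfl : (fun i => η.orbitMk (b' i)) = b := funext hb
    exact congrArg (q n) (η.orbits_γ h𝒢 hZ h a b')

theorem equivalent_orbits_classifying (h𝒢 : 𝒢.IsGroupOperad) (hcov : C.IsCovering)
    (hX : ∀ k, SemilocallySimplyConnected (C.X k)) (hK : ∀ k, IsKPiOne (C.X k))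
    (hE' : (η.orbits η.fundamental.classifying).IsOperad) :
    C.Equivalent ⟨η.orbits η.fundamental.classifying, hE'⟩ := by
  have hZ := η.cover_isOperad hX hK
  have hE := (η.fundamental_isGroupOperad h𝒢 hcov hX hK).classifying
  have hP := hZ.prod hE
  have cZ (n : ℕ) : IsCoveringAction (η.fundamental.G n) (η.cover.X n) :=
    UCover.isCoveringAction (e := η.e n) (hX n) (hcov n)
  have cE (n : ℕ) : IsCoveringAction (η.fundamental.G n) (η.fundamental.classifying.X n) := ESpace.isCoveringAction
  have cP (n : ℕ) : IsCoveringAction (η.fundamental.G n) ((η.cover.prod η.fundamental.classifying).X n) := (cZ n).kprod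
  have tZ (n : ℕ) : T2Space ((η.orbits η.cover).X n) := by
    have := C.isOperad.t2 n
    exact (η.coverHomeomorph hcov hX n).symm.t2Space
  have cs (Z : OperadData η.fundamental) (n : ℕ) : ContinuousConstSMul (η.toBase n).ker (Z.X n) :=
    ⟨fun k => continuous_const_smul (k : η.fundamental.G n)⟩
  have tP (n : ℕ) : T2Space ((η.orbits (η.cover.prod η.fundamental.classifying)).X n) := by
    have := hE.t2 n
    have : T2Space (Quotient (MulAction.orbitRel (η.toBase n).ker (η.cover.X n))) := tZ n
    have := cs η.cover n
    have := cs η.fundamental.classifying n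
    exact t2Space_orbits_kprod (Y := η.fundamental.classifying.X n) ((cZ n).subgroup (η.toBase n).ker)
  have hZ' := η.orbits_isOperad h𝒢 hZ cZ tZ
  have hP' := η.orbits_isOperad h𝒢 hP cP tP
  have := fun n => hZ.compactlyGenerated n
  have := fun n => hE.compactlyGenerated n
  have := fun n => hP.compactlyGenerated n
  choose φ ψ hφ hψ hψφ using fun n => UCover.exists_equivariant_maps (G := 𝒢.G n) (e := η.e n) (hX n) (hcov n) (hK n)
  have h1 := η.exists_isEquivalence_cover h𝒢 hcov hX hZ hZ'
  let Φ (n : ℕ) : C(η.cover.X n, η.fundamental.classifying.X n) := φ n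
  let Ψ (n : ℕ) : C(η.fundamental.classifying.X n, η.cover.X n) := ψ n
  have hΦ (n) (a : η.loops n) (x) : Φ n (a • x) = a • Φ n x := hφ n a x
  have hΨ (n) (a : η.loops n) (x) : Ψ n (a • x) = a • Ψ n x := hψ n a x
  have hΨΦ (n) : EquivariantlyHomotopic (η.loops n) ((Ψ n).comp (Φ n)) (.id _) := hψφ n
  let f (n : ℕ) : C((η.cover.prod η.fundamental.classifying).X n, η.cover.X n) := KProd.fst
  let g (n : ℕ) : C((η.cover.prod η.fundamental.classifying).X n, η.fundamental.classifying.X n) := KProd.snd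
  -- Equivariant maps into `|Eπ₁|` are all homotopic, so `(id, Φ)` inverts the first projection up
  -- to homotopy.
  have hfg (n : ℕ) : EquivariantlyHomotopic (η.loops n) ((Φ n).comp (f n)) (g n) :=
    ESpace.equivariantlyHomotopic (Z := CompactCoherentification (η.cover.X n × η.fundamental.classifying.X n))
      (η.loops n) (fun k a => hΦ n k _) fun k a => rfl
  have h2 : ∃ ψ : OperadHom ⟨_, hP'⟩ ⟨_, hZ'⟩, ψ.IsEquivalence := by
    refine η.exists_isEquivalence_orbits h𝒢 hP hZ hP' hZ' cP cZ f (fun n => KProd.pair (.id _) (Φ n))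
      (fun _ _ _ => rfl) (fun n a x => ?_) rfl (fun _ _ _ => rfl) (fun n => ?_) fun n => .refl fun k a => rfl
    · exact Prod.ext rfl (hΦ n a x)
    · exact (EquivariantlyHomotopic.refl (φ := f n) fun k a => rfl).kprod (hfg n)
  have h3 : ∃ ψ : OperadHom ⟨_, hP'⟩ ⟨_, hE'⟩, ψ.IsEquivalence := by
    refine η.exists_isEquivalence_orbits h𝒢 hP hE hP' hE' cP cE g (fun n => KProd.pair (Ψ n) (.id _))
      (fun _ _ _ => rfl) (fun n a x => ?_) rfl (fun _ _ _ => rfl) (fun n => ?_) fun n => .refl fun k a => rfl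
    · exact Prod.ext (hΨ n a x) rfl
    · have h4 : EquivariantlyHomotopic (η.loops n) ((Ψ n).comp (g n)) (f n) :=
        ((hfg n).symm.comp_left (hΨ n)).trans ((hΨΦ n).comp_right (f := f n) fun k a => rfl)
      exact h4.kprod (.refl (φ := g n) fun k a => rfl)
  exact .trans _ _ _ (.symm _ _ (.rel _ _ h1)) (.trans _ _ _ (.symm _ _ (.rel _ _ h2)) (.rel _ _ h3))

end GoodBasepoint

/-! ### The theorem -/

theorem mainTheorem3 (𝒢 : GroupOperad.{u}) (C : TopOperad 𝒢.toGroupOperadData)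
    (hcov : C.IsCovering) [hpc : ∀ k, PathConnectedSpace (C.X k)]
    (hlpc : ∀ k, LocallyPathConnectedSpace (C.X k))
    (hslsc : ∀ k, SemilocallySimplyConnected (C.X k))
    (η : GoodBasepoint C) (hK : ∀ k, IsKPiOne (C.X k)) :
    -- `π₁(C/𝒢)` is a group operad, with groups `π₁(C(k)/G_k)`
    η.fundamental.IsGroupOperad ∧
    (∀ k, Function.Bijective (OrbitPathClass.toQuotient (G := 𝒢.G k) (e := η.e k)) ∧
      ∀ x y : η.Pi1 k, (x * y).toQuotient = x.toQuotient.trans y.toQuotient) ∧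
    -- `π₁C` is a normal non-crossed sub group operad of it
    η.fundamental.IsNormalNonCrossed η.loops ∧
    -- `|Eπ₁(C/𝒢)|` is a topological `π₁(C/𝒢)`-operad, with the composition induced by that of
    -- simplices
    η.fundamental.classifying.IsOperad ∧
    (∀ {k : ℕ} {m : Fin k → ℕ} {n : ℕ} (h : ∑ i, m i = n) {l : ℕ}
      (t : stdSimplex ℝ (Fin (l + 1))) (c : Fin (l + 1) → η.fundamental.G k)
      (a : ∀ i, Fin (l + 1) → η.fundamental.G (m i)),
      η.fundamental.classifying.γ h (ESpace.mk c t) (fun i => ESpace.mk (a i) t) =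
        ESpace.mk (fun j => η.fundamental.γ h (c j) fun i => a i j) t) ∧
    -- the composition of its quotient by `π₁C` is induced by the projection
    (∀ {k : ℕ} {m : Fin k → ℕ} {n : ℕ} (h : ∑ i, m i = n) (x : η.fundamental.classifying.X k)
      (y : ∀ i, η.fundamental.classifying.X (m i)),
      η.reconstruction.γ h (η.proj x) (fun i => η.proj (y i)) =
        η.proj (η.fundamental.classifying.γ h x y)) ∧
    -- the quotient is a topological `𝒢`-operad equivalent to `C`
    ∃ hD : η.reconstruction.IsOperad, C.Equivalent ⟨η.reconstruction, hD⟩ := by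
  have h𝒢 := 𝒢.isGroupOperad
  have hF := η.fundamental_isGroupOperad h𝒢 hcov hslsc hK
  have hE := hF.classifying
  have cE (n : ℕ) : IsCoveringAction (η.fundamental.G n) (η.fundamental.classifying.X n) := ESpace.isCoveringAction
  have tE (n : ℕ) : T2Space ((η.orbits η.fundamental.classifying).X n) :=
    inferInstanceAs (T2Space (Quotient (MulAction.orbitRel (η.loops n) (ESpace (η.fundamental.G n)))))
  -- `η.reconstruction` is by definition the quotient `η.orbits` of the classifying operad.
  have hD := η.orbits_isOperad h𝒢 hE cE tE
  exact ⟨hF, fun k => ⟨OrbitPathClass.toQuotient_bijective (hcov k), OrbitPathClass.toQuotient_mul⟩,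
    η.isNormalNonCrossed h𝒢, hE, fun h _ t c a => ESpace.γ_mk _ h t c a, fun h x y => η.orbits_γ h𝒢 hE h x y,
    hD, η.equivalent_orbits_classifying h𝒢 hcov hslsc hK hD⟩
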